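/- **Model.** There are $n$ items $[n]$ and two disjoint nonempty sets $S_1,S_2\subseteq[n]$ with $|S_1|=s_1$, $|S_2|=s_2$, where $n,s_1,s_2$ are known but $S_1,S_2$ are not. A test on a set $X\subseteq[n]$ is positive if $X\cap S_1\ne\emptyset$ and $X\cap S_2\neq\emptyset$, and negative otherwise. Tests are carried out in stages: the tests of one stage are chosen before any of their outcomes is seen, but may depend on the outcomes of the earlier stages. The sets have to be found up to their order. A randomized algorithm consists of one fixed word-RAM program (unit-cost operations on words of $O(\log n)$ bits) and, for every $(n,s_1,s_2)$, a probability distribution on sequences of tables of pools (binary matrices with $n$ columns, with no more rows than the bound on the number of tests in the respective item below). The program can access the current table (its entries and the lists of ones of its rows and columns) in unit time, or turn to the next table; it requests tests, each a union of pools and single items, and decodes their outcomes. The runtime counts every operation of the program, including the requests of tests, but not the drawing of the random tables nor the execution of the tests. A Monte Carlo algorithm with success probability $p$ always obeys the stated bounds on stages, tests and runtime and, for every fixed pair $(S_1,S_2)$, finds $S_1$ and $S_2$ with probability at least $p$. A Las Vegas algorithm finds, for every fixed pair $(S_1,S_2)$, the sets $S_1$ and $S_2$ with probability one, and its bounds hold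 in expectation. **Theorem.** Let $s_{\max}=\max\{s_1,s_2\}$ and $s_{\min}=\min\{s_1,s_2\}$, where $s_1,s_2\ge1$ and $s_1+s_2\le n$. In (iii) and (iv), suppose in addition that $s_{\max}\le c\,n$ for a constant $c\in(0,1)$; the hidden constants there may depend on $c$, and in (iv) also on $\eta$. (i) There is a non-adaptive (one-stage) Monte Carlo algorithm with success probability $0.99$ that uses $O\big(\frac{s_{\max}^2}{s_{\min}}\log n\big)$ tests and $O\big(\frac{s_{\max}^2}{s_{\min}}\log n\big)$ time. (ii) There is a two-stage Monte Carlo algorithm with success probability $0.99$ that uses $O(s_{\max}\log n)$ tests and $O(s_{\max}\log n)$ time. (iii) There is a three-stage Monte Carlo algorithm with success probability $0.99$ that uses $O\big(s_{\max}\log\frac{n}{s_{\max}}\big)$ tests and $O\big(s_{\max}\log^2\frac{n}{s_{\max}}\big)$ time. (iv) For every $\eta>0$ there is a Las Vegas algorithm with zero error probability whose average number of stages is at most $3+\eta$, whose average number of tests is $O\big(s_{\max}\log\frac{n}{s_{\max}}\big)$, and whose average runtime is $O\big(s_{\max}\log^2\frac{n}{s_{\max}}\big)$. -/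

import Mathlib

open MeasureTheory

noncomputable section

namespace ConcGT

/-! ### Tests -/

/-- The outcome of a test on the set `X` of items (`true` is positive): it is positive iff `X`
contains an item of each of the two semi-defective sets. -/
def testOutcome {n : ℕ} (S₁ S₂ X : Finset (Fin n)) : Bool :=
  decide ((X ∩ S₁).Nonempty ∧ (X ∩ S₂).Nonempty)

/-- A table of `N` pools of items, i.e. an `N × n` binary test matrix, the rows being the pools. -/
def PoolTable (n N : ℕ) : Type := Fin N → Finset (Fin n)

instance (n N : ℕ) : MeasurableSpace (PoolTable n N) := ⊤

/-- The entry of the matrix in row `p` and column `x` is one. -/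
def PoolTable.Has {n N : ℕ} (L : PoolTable n N) (p x : ℕ) : Prop :=
  ∃ (hp : p < N) (hx : x < n), (⟨x, hx⟩ : Fin n) ∈ L ⟨p, hp⟩

/-- The pool with number `p` (no items if there is no such pool). -/
def PoolTable.row {n N : ℕ} (L : PoolTable n N) (p : ℕ) : Finset (Fin n) :=
  if hp : p < N then L ⟨p, hp⟩ else ∅

/-- The item with number `x`, as a set of items (empty if there is no such item). -/
def itemSet (n x : ℕ) : Finset (Fin n) :=
  if hx : x < n then {⟨x, hx⟩} else ∅

/-! ### A word RAM that designs and decodes tests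

The machine has variables, finitely many of which occur in a program, and arrays, all holding words,
that is, numbers below `W`; arithmetic is modulo `W`. Moreover it has random access to the outcomes
of the tests of the last completed stage (older ones it can keep in its arrays) and to the current
pool table, given by its entries and by the lists of ones of its rows and of its columns. A test is a
union of pools and single items. Every operation takes unit time; drawing the random pool tables and
carrying out the requested tests is not part of the running time. -/

/-- Expressions. -/
inductive Expr : Type
  /-- a constant -/
  | lit (c : ℕ)
  /-- the value of a variable -/
  | var (x : ℕ)
  /-- the word at position `i` of the array `a` -/
  | read (a : ℕ) (i : Expr)
  | add (e f : Expr)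
  | sub (e f : Expr)
  | mul (e f : Expr)
  | div (e f : Expr)
  /-- one if `e < f`, zero otherwise -/
  | lt (e f : Expr)
  /-- one if the test with number `j` (counted from zero) of the last completed stage was
  positive; else zero -/
  | result (j : Expr)
  /-- the entry of the pool table in row `p` and column `x` -/
  | entry (p x : Expr)
  /-- the number of pools that contain the item `x` -/
  | colDeg (x : Expr)
  /-- the `j`-th pool (counted from zero, in increasing order) that contains the item `x` -/
  | colNth (x j : Expr)
  /-- the number of items in the pool `p` -/
  | rowDeg (p : Expr)
  /-- the `j`-th item (counted from zero, in increasing order) in the pool `p` -/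
  | rowNth (p j : Expr)

/-- The time to evaluate an expression: one unit for each operation, constant and variable. -/
def Expr.cost : Expr → ℕ
  | lit _ => 1
  | var _ => 1
  | read _ i => i.cost + 1
  | add e f => e.cost + f.cost + 1
  | sub e f => e.cost + f.cost + 1
  | mul e f => e.cost + f.cost + 1
  | div e f => e.cost + f.cost + 1
  | lt e f => e.cost + f.cost + 1
  | result j => j.cost + 1
  | entry p x => p.cost + x.cost + 1
  | colDeg x => x.cost + 1
  | colNth x j => x.cost + j.cost + 1
  | rowDeg p => p.cost + 1
  | rowNth p j => p.cost + j.cost + 1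

/-- The state of the machine, for a population of `n` items. -/
structure State (n : ℕ) where
  /-- the variables -/
  var : ℕ → ℕ
  /-- the arrays -/
  arr : ℕ → ℕ → ℕ
  /-- the set of items that the next test is going to consist of, as assembled so far -/
  cur : Finset (Fin n)
  /-- the tests requested in the current stage, not yet carried out -/
  pending : List (Finset (Fin n))
  /-- the outcomes of the tests of the last completed stage, in the order of the requests -/
  results : List Bool
  /-- the number of the current pool table -/
  table : ℕ
  /-- the two sets of items that have been output -/
  out : Bool → Finset (Fin n)
  /-- the number of tests requested -/
  tests : ℕ
  /-- the number of stages -/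
  stages : ℕ
  /-- the running time -/
  time : ℕ

/-- The value of an expression: words below `W`, pool table `L`, state `σ`. -/
def Expr.eval {n N : ℕ} (W : ℕ) (L : PoolTable n N) (σ : State n) : Expr → ℕ
  | lit c => c % W
  | var x => σ.var x
  | read a i => σ.arr a (i.eval W L σ)
  | add e f => (e.eval W L σ + f.eval W L σ) % W
  | sub e f => e.eval W L σ - f.eval W L σ
  | mul e f => (e.eval W L σ * f.eval W L σ) % W
  | div e f => e.eval W L σ / f.eval W L σ
  | lt e f => if e.eval W L σ < f.eval W L σ then 1 else 0
  | result j => (σ.results.getD (j.eval W L σ) false).toNat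
  | entry p x => open Classical in if L.Has (p.eval W L σ) (x.eval W L σ) then 1 else 0
  | colDeg x => {p : ℕ | L.Has p (x.eval W L σ)}.ncard % W
  | colNth x j => Nat.nth (fun p => L.Has p (x.eval W L σ)) (j.eval W L σ) % W
  | rowDeg p => {x : ℕ | L.Has (p.eval W L σ) x}.ncard % W
  | rowNth p j => Nat.nth (fun x => L.Has (p.eval W L σ) x) (j.eval W L σ) % W

/-- Elementary commands. -/
inductive Atom : Type
  /-- assign the value of `e` to the variable `x` -/
  | assign (x : ℕ) (e : Expr)
  /-- write the value of `e` to position `i` of the array `a` -/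
  | store (a : ℕ) (i e : Expr)
  /-- add all items of the pool `p` to the test that is being assembled -/
  | putPool (p : Expr)
  /-- add the item `x` to the test that is being assembled -/
  | putItem (x : Expr)
  /-- request the assembled test in the current stage, and start assembling a new one -/
  | submit
  /-- end the current stage: carry out its tests simultaneously -/
  | runStage
  /-- turn to the next pool table -/
  | nextTable
  /-- add the item `x` to one of the two output sets -/
  | emit (b : Bool) (x : Expr)

/-- The effect of an elementary command. The only dependence on the semi-defective sets is through
the outcomes of the tests that `runStage` carries out. -/
def Atom.step {n N : ℕ} (S₁ S₂ : Finset (Fin n)) (T : ℕ → PoolTable n N) (W : ℕ) (σ : State n) :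
    Atom → State n
  | assign x e =>
      { σ with
        var := Function.update σ.var x (e.eval W (T σ.table) σ)
        time := σ.time + e.cost + 1 }
  | store a i e =>
      { σ with
        arr := Function.update σ.arr a (Function.update (σ.arr a)
          (i.eval W (T σ.table) σ) (e.eval W (T σ.table) σ))
        time := σ.time + i.cost + e.cost + 1 }
  | putPool p =>
      { σ with
        cur := σ.cur ∪ (T σ.table).row (p.eval W (T σ.table) σ)
        time := σ.time + p.cost + 1 }
  | putItem x =>
      { σ with
        cur := σ.cur ∪ itemSet n (x.eval W (T σ.table) σ)
        time := σ.time + x.cost + 1 }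
  | submit =>
      { σ with
        cur := ∅
        pending := σ.pending ++ [σ.cur]
        tests := σ.tests + 1
        time := σ.time + 1 }
  | runStage =>
      { σ with
        pending := []
        results := σ.pending.map (testOutcome S₁ S₂)
        stages := σ.stages + 1
        time := σ.time + 1 }
  | nextTable =>
      { σ with
        table := σ.table + 1
        time := σ.time + 1 }
  | emit b x =>
      { σ with
        out := Function.update σ.out b (σ.out b ∪ itemSet n (x.eval W (T σ.table) σ))
        time := σ.time + x.cost + 1 }

/-- Programs. -/
inductive Program : Type
  | atom (a : Atom)
  | seq (P Q : Program)
  | ite (e : Expr) (P Q : Program)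
  | loop (e : Expr) (P : Program)

/-- The time for evaluating the condition `e` of a branching or a loop is added. -/
def State.charge {n : ℕ} (σ : State n) (e : Expr) : State n :=
  { σ with time := σ.time + e.cost + 1 }

/-- `Exec S₁ S₂ T W P σ τ`: started in the state `σ`, the program `P` halts in the state `τ`, where
`S₁`, `S₂` are the semi-defective sets, `T` is the sequence of pool tables, and words are numbers
below `W`. -/
inductive Exec {n N : ℕ} (S₁ S₂ : Finset (Fin n)) (T : ℕ → PoolTable n N) (W : ℕ) :
    Program → State n → State n → Prop
  | atom (a : Atom) (σ : State n) : Exec S₁ S₂ T W (.atom a) σ (a.step S₁ S₂ T W σ)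
  | seq {P Q : Program} {σ σ' τ : State n} :
      Exec S₁ S₂ T W P σ σ' → Exec S₁ S₂ T W Q σ' τ → Exec S₁ S₂ T W (.seq P Q) σ τ
  | iteTrue {e : Expr} {P Q : Program} {σ τ : State n} :
      e.eval W (T σ.table) σ ≠ 0 → Exec S₁ S₂ T W P (σ.charge e) τ →
      Exec S₁ S₂ T W (.ite e P Q) σ τ
  | iteFalse {e : Expr} {P Q : Program} {σ τ : State n} :
      e.eval W (T σ.table) σ = 0 → Exec S₁ S₂ T W Q (σ.charge e) τ →
      Exec S₁ S₂ T W (.ite e P Q) σ τ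
  | loopTrue {e : Expr} {P : Program} {σ σ' τ : State n} :
      e.eval W (T σ.table) σ ≠ 0 → Exec S₁ S₂ T W P (σ.charge e) σ' →
      Exec S₁ S₂ T W (.loop e P) σ' τ → Exec S₁ S₂ T W (.loop e P) σ τ
  | loopFalse {e : Expr} {P : Program} {σ : State n} :
      e.eval W (T σ.table) σ = 0 → Exec S₁ S₂ T W (.loop e P) σ (σ.charge e)

/-- The initial state: the variables `0`, `1`, `2` hold `n`, `s₁`, `s₂`; all else is blank. -/
def State.init (n s₁ s₂ : ℕ) : State n where
  var := fun x => if x = 0 then n else if x = 1 then s₁ else if x = 2 then s₂ else 0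
  arr := fun _ _ => 0
  cur := ∅
  pending := []
  results := []
  table := 0
  out := fun _ => ∅
  tests := 0
  stages := 0
  time := 0

/-- The output is the pair of semi-defective sets, up to their order. -/
def State.Identifies {n : ℕ} (σ : State n) (S₁ S₂ : Finset (Fin n)) : Prop :=
  (σ.out false = S₁ ∧ σ.out true = S₂) ∨ (σ.out false = S₂ ∧ σ.out true = S₁)

/-- On the population `[n]` with semi-defective sets `S₁`, `S₂`, the program `P` with pool tables
drawn at random from `μ` always halts after at most `q` stages, at most `t` tests and time at most
`r`, and it identifies the two sets with probability at least `p`. -/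
def MonteCarlo {n N : ℕ} (P : Program) (W : ℕ) (μ : ProbabilityMeasure (ℕ → PoolTable n N))
    (S₁ S₂ : Finset (Fin n)) (q : ℕ) (t r : ℝ) (p : ENNReal) : Prop :=
  (∀ᵐ T ∂(μ : Measure (ℕ → PoolTable n N)),
    ∃ σ, Exec S₁ S₂ T W P (State.init n S₁.card S₂.card) σ ∧
      σ.stages ≤ q ∧ (σ.tests : ℝ) ≤ t ∧ (σ.time : ℝ) ≤ r) ∧
  p ≤ (μ : Measure (ℕ → PoolTable n N))
    {T | ∃ σ, Exec S₁ S₂ T W P (State.init n S₁.card S₂.card) σ ∧ σ.Identifies S₁ S₂}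

/-- On the population `[n]` with semi-defective sets `S₁`, `S₂`, the program `P` with pool tables
drawn at random from `μ` almost surely halts and identifies the two sets, and the expected numbers
of stages and of tests and the expected running time are at most `q`, `t` and `r`. -/
def LasVegas {n N : ℕ} (P : Program) (W : ℕ) (μ : ProbabilityMeasure (ℕ → PoolTable n N))
    (S₁ S₂ : Finset (Fin n)) (q t r : ℝ) : Prop :=
  ∃ σ : (ℕ → PoolTable n N) → State n,
    (∀ᵐ T ∂(μ : Measure (ℕ → PoolTable n N)),
      Exec S₁ S₂ T W P (State.init n S₁.card S₂.card) (σ T) ∧ (σ T).Identifies S₁ S₂) ∧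
    (Integrable (fun T => ((σ T).stages : ℝ)) (μ : Measure (ℕ → PoolTable n N)) ∧
      ∫ T, ((σ T).stages : ℝ) ∂(μ : Measure (ℕ → PoolTable n N)) ≤ q) ∧
    (Integrable (fun T => ((σ T).tests : ℝ)) (μ : Measure (ℕ → PoolTable n N)) ∧
      ∫ T, ((σ T).tests : ℝ) ∂(μ : Measure (ℕ → PoolTable n N)) ≤ t) ∧
    (Integrable (fun T => ((σ T).time : ℝ)) (μ : Measure (ℕ → PoolTable n N)) ∧
      ∫ T, ((σ T).time : ℝ) ∂(μ : Measure (ℕ → PoolTable n N)) ≤ r)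

end ConcGT

end

open MeasureTheory ConcGT

/-!
A pool is useful once it is known to meet exactly one of the two hidden sets: if `A` meets `S₁` but
not `S₂`, then `X ∪ A` tests positive iff `X` meets `S₂`, so that tests with `A` added are ordinary
group tests for `S₂`. Two pools of this kind, one for each set, are recognized by three tests: if
`A` and `B` test negative and `A ∪ B` tests positive, then each of them meets exactly one hidden
set, and not the same one (`exists_tagged`). It is not known which set is which, but the sets have
to be found up to their order only.

Let `s` be the larger and `s'` the smaller one of the two sizes. The preimages of two values under a
uniformly random function from the items to `8 s` values form such a pair with probability at least
`s₁ s₂ / (128 s ^ 2) = s' / (128 s)` (`card_separates_ge`), so `ρ (s / s' + 1)` independent trials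
all fail with probability at most `exp (-ρ / 128)` (`card_noTrial_le`).

Given a pair, both sets are found by binary splitting with hashing. At the start there are at most
`s` blocks of length `2 ^ k`, and the blocks are halved from level to level. On each level a random
function distributes the blocks to `4 s` pools, and a block remains a candidate for a set as long as
its pool meets that set. Hidden items are never lost (`exists_leaf`). The pool of a block without
hidden items is positive with probability at most `1 / 4`, which compensates for the two children of
a node, and so the expected number of candidates is at most `4 s` on each level
(`sum_length_cand_le`). A breadth-first search that stops at a constant multiple of the expected
number of candidates makes tests and time bounds hold always, at the price of a small failure
probability (`card_overBudget_le`).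

There are two ways to get rid of false candidates among the single items. About `log₂ n` further
levels of single items divide their expected number by `4` each (`four_pow_mul_sum_falseNodes_le`),
which leaves none with high probability; this costs `O(s log n)` tests, but no stage. Or another
stage tests the candidates one by one; this needs only `O(s log (n / s))` tests, and the result is
always right. The former gives the two-stage algorithm and, if the splitting tests are made in
advance with the pools of all `O(s / s')` trials, the one-stage algorithm. The latter gives the
three-stage algorithm, and with the first stage repeated, on a new table each time, until some trial
succeeds, also the Las Vegas algorithm. By choice of `ρ`, the expected number of repetitions of its
first stage is close to one. Its expected costs are computed from a form of Wald's identity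
(`lintegral_totalCost`). They are measurable functions of the sequence of tables because an
execution depends on finitely many tables only (`Exec.exists_prefix`).

The algorithms are concrete programs (`oneStage`, `twoStage`, `threeStage`, `untilSuccess`), whose
behaviour is derived with total-correctness rules (`Runs`). The random functions are encoded in a
single table (`tableOf`): an item lies in exactly one splitting pool per level, so that the list of
ones of its column gives the pool of its block on each level in unit time (`nth_has`).
-/

namespace ConcGT

/-! ### Total-correctness rules for programs -/

/-- Total correctness: started in `σ`, the program `P` halts in a state that satisfies `Q`. -/
def Runs {n N : ℕ} (S₁ S₂ : Finset (Fin n)) (T : ℕ → PoolTable n N) (W : ℕ) (P : Program)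
    (σ : State n) (Q : State n → Prop) : Prop :=
  ∃ τ, Exec S₁ S₂ T W P σ τ ∧ Q τ

section Rules

variable {n N : ℕ} {S₁ S₂ : Finset (Fin n)} {T : ℕ → PoolTable n N} {W : ℕ}

theorem Runs.mono {P : Program} {σ : State n} {Q Q' : State n → Prop}
    (h : Runs S₁ S₂ T W P σ Q) (hQ : ∀ τ, Q τ → Q' τ) : Runs S₁ S₂ T W P σ Q' :=
  let ⟨τ, h₁, h₂⟩ := h; ⟨τ, h₁, hQ τ h₂⟩

theorem Runs.atom {a : Atom} {σ : State n} {Q : State n → Prop} (h : Q (a.step S₁ S₂ T W σ)) :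
    Runs S₁ S₂ T W (.atom a) σ Q :=
  ⟨_, .atom a σ, h⟩

theorem Runs.seq {P P' : Program} {σ : State n} {Q : State n → Prop}
    (h : Runs S₁ S₂ T W P σ fun σ' => Runs S₁ S₂ T W P' σ' Q) :
    Runs S₁ S₂ T W (.seq P P') σ Q :=
  let ⟨_, h₁, τ, h₂, hQ⟩ := h; ⟨τ, .seq h₁ h₂, hQ⟩

theorem Runs.step {a : Atom} {P : Program} {σ : State n} {Q : State n → Prop}
    (h : Runs S₁ S₂ T W P (a.step S₁ S₂ T W σ) Q) :
    Runs S₁ S₂ T W (.seq (.atom a) P) σ Q :=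
  .seq (.atom h)

theorem Runs.ite {e : Expr} {P P' : Program} {σ : State n} {Q : State n → Prop}
    (h₁ : e.eval W (T σ.table) σ ≠ 0 → Runs S₁ S₂ T W P (σ.charge e) Q)
    (h₂ : e.eval W (T σ.table) σ = 0 → Runs S₁ S₂ T W P' (σ.charge e) Q) :
    Runs S₁ S₂ T W (.ite e P P') σ Q := by
  by_cases h : e.eval W (T σ.table) σ = 0
  · obtain ⟨τ, h', hQ⟩ := h₂ h
    exact ⟨τ, .iteFalse h h', hQ⟩
  · obtain ⟨τ, h', hQ⟩ := h₁ h
    exact ⟨τ, .iteTrue h h', hQ⟩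

/-- Loops: `I i` is the invariant after `i` rounds, and `k` bounds the number of rounds. -/
theorem Runs.loop {e : Expr} {P : Program} (I : ℕ → State n → Prop) (k : ℕ)
    (h : ∀ i σ, I i σ → e.eval W (T σ.table) σ ≠ 0 →
      i < k ∧ Runs S₁ S₂ T W P (σ.charge e) (I (i + 1)))
    {σ : State n} (h0 : I 0 σ) {Q : State n → Prop}
    (hQ : ∀ i σ, I i σ → e.eval W (T σ.table) σ = 0 → Q (σ.charge e)) :
    Runs S₁ S₂ T W (.loop e P) σ Q := by
  suffices H : ∀ j i σ, k - i ≤ j → I i σ → Runs S₁ S₂ T W (.loop e P) σ Q from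
    H k 0 σ (by omega) h0
  intro j
  induction j with
  | zero =>
    intro i σ hj hi
    by_cases he : e.eval W (T σ.table) σ = 0
    · exact ⟨_, .loopFalse he, hQ i σ hi he⟩
    · have := (h i σ hi he).1
      omega
  | succ j ih =>
    intro i σ hj hi
    by_cases he : e.eval W (T σ.table) σ = 0
    · exact ⟨_, .loopFalse he, hQ i σ hi he⟩
    · obtain ⟨hk, σ', h₁, h₂⟩ := h i σ hi he
      obtain ⟨τ, h₃, h₄⟩ := ih (i + 1) σ' (by omega) h₂
      exact ⟨τ, .loopTrue he h₁ h₃, h₄⟩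

/-- Loops that make exactly `k` rounds. -/
theorem Runs.rounds {e : Expr} {P : Program} (I : ℕ → State n → Prop) (k : ℕ)
    (h : ∀ i < k, ∀ σ, I i σ → e.eval W (T σ.table) σ ≠ 0 ∧
      Runs S₁ S₂ T W P (σ.charge e) (I (i + 1)))
    (hend : ∀ σ, I k σ → e.eval W (T σ.table) σ = 0)
    {σ : State n} (h0 : I 0 σ) {Q : State n → Prop}
    (hQ : ∀ σ, I k σ → Q (σ.charge e)) :
    Runs S₁ S₂ T W (.loop e P) σ Q := by
  refine Runs.loop (fun i σ => i ≤ k ∧ I i σ) k ?_ ⟨Nat.zero_le _, h0⟩ ?_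
  · rintro i σ ⟨hi, hI⟩ he
    rcases hi.lt_or_eq with hi | rfl
    · exact ⟨hi, (h i hi σ hI).2.mono fun τ hτ => ⟨hi, hτ⟩⟩
    · exact absurd (hend σ hI) he
  · rintro i σ ⟨hi, hI⟩ he
    rcases hi.lt_or_eq with hi | rfl
    · exact absurd he (h i hi σ hI).1
    · exact hQ σ hI

end Rules

/-! ### Requests of tests

The programs share these variables: `0`, `1`, `2` hold `n`, `s₁`, `s₂`; `3` and `4` hold `s`, the
maximum of `s₁` and `s₂`, and `4 * s`; `5` the number of levels, `6` the number of trials, `7` the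
length of the blocks on level zero, `8` the number of splitting pools, `9` the budget for the queue;
`10` tells whether a trial succeeded, and `11` holds the number of its first pool; `12` counts
rounds; `13` holds the number of splitting tests, `14` the position of their relevant outcomes; `15`
and `16` are the head and the length of the queue; `17` to `20` hold the node under consideration.
During the computation of the parameters, `19` and `20` are auxiliary. The arrays `0` to `3` store
the nodes of the queue. -/

/-- Sequential composition. -/
infixr:60 " ;; " => Program.seq

/-- The program that consists of one assignment. -/
abbrev set (x : ℕ) (e : Expr) : Program := .atom (.assign x e)

/-- A command without effect. -/
def skip : Program := set 12 (.var 12)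

/-- Request three tests for each of the `R` trials: the first pool of the trial, the second one, and
their union. -/
def reqCheck : Program :=
  set 12 (.lit 0) ;;
  .loop (.lt (.var 12) (.var 6)) (
    .atom (.putPool (.add (.var 8) (.mul (.lit 2) (.var 12)))) ;;
    .atom .submit ;;
    .atom (.putPool (.add (.add (.var 8) (.mul (.lit 2) (.var 12))) (.lit 1))) ;;
    .atom .submit ;;
    .atom (.putPool (.add (.var 8) (.mul (.lit 2) (.var 12)))) ;;
    .atom (.putPool (.add (.add (.var 8) (.mul (.lit 2) (.var 12))) (.lit 1))) ;;
    .atom .submit ;;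
    set 12 (.add (.var 12) (.lit 1)))

/-- Request `v₁₃` tests: number `i` is the union of the splitting pool `i % v₈` with the trial pool
`v₁₁ + i / v₈`. -/
def reqSplit : Program :=
  set 12 (.lit 0) ;;
  .loop (.lt (.var 12) (.var 13)) (
    .atom (.putPool (.sub (.var 12) (.mul (.div (.var 12) (.var 8)) (.var 8)))) ;;
    .atom (.putPool (.add (.var 11) (.div (.var 12) (.var 8)))) ;;
    .atom .submit ;;
    set 12 (.add (.var 12) (.lit 1)))

section Specs

variable {n N : ℕ} {S₁ S₂ : Finset (Fin n)} {T : ℕ → PoolTable n N} {W : ℕ}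

theorem runs_skip {σ : State n} {Q : State n → Prop} (h : Q { σ with time := σ.time + 2 }) :
    Runs S₁ S₂ T W skip σ Q := by
  refine .atom ?_
  simpa [Atom.step, Expr.eval, Expr.cost] using h

/-- The tests for the trials. -/
def checkTests (L : PoolTable n N) (V R : ℕ) : List (Finset (Fin n)) :=
  (List.range R).flatMap fun k =>
    [L.row (V + 2 * k), L.row (V + 2 * k + 1), L.row (V + 2 * k) ∪ L.row (V + 2 * k + 1)]

theorem checkTests_succ (L : PoolTable n N) (V R : ℕ) :
    checkTests L V (R + 1) = checkTests L V R ++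
      [L.row (V + 2 * R), L.row (V + 2 * R + 1), L.row (V + 2 * R) ∪ L.row (V + 2 * R + 1)] := by
  simp [checkTests, List.range_succ]

theorem checkTests_length (L : PoolTable n N) (V R : ℕ) : (checkTests L V R).length = 3 * R := by
  induction R with
  | zero => rfl
  | succ R ih => rw [checkTests_succ]; simp [ih]; omega

theorem runs_reqCheck {σ : State n} {V R : ℕ} (hV : σ.var 8 = V) (hR : σ.var 6 = R)
    (hc : σ.cur = ∅) (hW : V + 2 * R + 2 < W) (hW3 : 3 < W) :
    Runs S₁ S₂ T W reqCheck σ fun τ => ∃ v t,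
      (∀ x, x ≠ 12 → v x = σ.var x) ∧ t ≤ σ.time + 50 * R + 10 ∧
      τ = { σ with
        var := v
        pending := σ.pending ++ checkTests (T σ.table) V R
        tests := σ.tests + 3 * R
        time := t } := by
  refine .step ?_
  refine Runs.rounds (fun i τ => ∃ v t, v 12 = i ∧
      (∀ x, x ≠ 12 → v x = σ.var x) ∧ t ≤ σ.time + 50 * i + 2 ∧
      τ = { σ with
        var := v
        pending := σ.pending ++ checkTests (T σ.table) V i
        tests := σ.tests + 3 * i
        time := t }) R ?_ ?_ ?_ ?_
  · rintro i hi _ ⟨v, t, hv, hf, ht, rfl⟩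
    have h8 : v 8 = V := by rw [hf 8 (by decide), hV]
    have h6 : v 6 = R := by rw [hf 6 (by decide), hR]
    refine ⟨by simp [Expr.eval, hv, h6, hi], ?_⟩
    refine .step <| .step <| .step <| .step <| .step <| .step <| .step <| .atom ?_
    have e1 : (i + 1) % W = i + 1 := Nat.mod_eq_of_lt (by omega)
    have e2 : (2 * i) % W = 2 * i := Nat.mod_eq_of_lt (by omega)
    have e3 : (V + 2 * i) % W = V + 2 * i := Nat.mod_eq_of_lt (by omega)
    have e4 : (V + 2 * i + 1) % W = V + 2 * i + 1 := Nat.mod_eq_of_lt (by omega)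
    have e5 : 2 % W = 2 := Nat.mod_eq_of_lt (by omega)
    have e6 : 1 % W = 1 := Nat.mod_eq_of_lt (by omega)
    refine ⟨Function.update v 12 (i + 1), t + 39, by simp, fun x hx => by simp [hx, hf x hx],
      ?_, ?_⟩
    · omega
    · simp only [Atom.step, Expr.eval, State.charge, hv, h8, e1, e2, e3, e4, e5, e6, hc,
        checkTests_succ, Finset.empty_union]
      simp [Expr.cost]
      rfl
  · rintro _ ⟨v, t, hv, hf, ht, rfl⟩
    simp [Expr.eval, hv, hf, hR]
  · refine ⟨Function.update σ.var 12 0, σ.time + 2, by simp, fun x hx => by simp [hx], le_rfl, ?_⟩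
    simp [checkTests, Atom.step, Expr.eval, Expr.cost]
  · rintro _ ⟨v, t, hv, hf, ht, rfl⟩
    refine ⟨v, _, hf, ?_, rfl⟩
    simp [Expr.cost]; omega

theorem runs_reqSplit {σ : State n} {V k g : ℕ} (hV : σ.var 8 = V) (hk : σ.var 13 = k)
    (hg : σ.var 11 = g) (hc : σ.cur = ∅) (hW : g + k < W) (hW3 : 3 < W) :
    Runs S₁ S₂ T W reqSplit σ fun τ => ∃ v t,
      (∀ x, x ≠ 12 → v x = σ.var x) ∧ t ≤ σ.time + 30 * k + 10 ∧
      τ = { σ with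
        var := v
        pending := σ.pending ++ (List.range k).map fun i =>
          (T σ.table).row (i - i / V * V) ∪ (T σ.table).row (g + i / V)
        tests := σ.tests + k
        time := t } := by
  refine .step ?_
  refine Runs.rounds (fun i τ => ∃ v t, v 12 = i ∧
      (∀ x, x ≠ 12 → v x = σ.var x) ∧ t ≤ σ.time + 30 * i + 2 ∧
      τ = { σ with
        var := v
        pending := σ.pending ++ (List.range i).map fun i =>
          (T σ.table).row (i - i / V * V) ∪ (T σ.table).row (g + i / V)
        tests := σ.tests + i
        time := t }) k ?_ ?_ ?_ ?_
  · rintro i hi _ ⟨v, t, hv, hf, ht, rfl⟩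
    have h8 : v 8 = V := by rw [hf 8 (by decide), hV]
    have h13 : v 13 = k := by rw [hf 13 (by decide), hk]
    have h11 : v 11 = g := by rw [hf 11 (by decide), hg]
    refine ⟨by simp [Expr.eval, hv, h13, hi], ?_⟩
    refine .step <| .step <| .step <| .atom ?_
    have a1 := Nat.div_mul_le_self i V
    have a2 := Nat.div_le_self i V
    have e1 : (i + 1) % W = i + 1 := Nat.mod_eq_of_lt (by omega)
    have e2 : (i / V * V) % W = i / V * V := Nat.mod_eq_of_lt (by omega)
    have e3 : (g + i / V) % W = g + i / V := Nat.mod_eq_of_lt (by omega)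
    have e6 : 1 % W = 1 := Nat.mod_eq_of_lt (by omega)
    refine ⟨Function.update v 12 (i + 1), t + 23, by simp, fun x hx => by simp [hx, hf x hx],
      ?_, ?_⟩
    · omega
    · simp only [Atom.step, Expr.eval, State.charge, hv, h8, h11, e1, e2, e3, e6, hc,
        List.range_succ, Finset.empty_union]
      simp [Expr.cost]
      rfl
  · rintro _ ⟨v, t, hv, hf, ht, rfl⟩
    simp [Expr.eval, hv, hf, hk]
  · refine ⟨Function.update σ.var 12 0, σ.time + 2, by simp, fun x hx => by simp [hx], le_rfl, ?_⟩
    simp [Atom.step, Expr.eval, Expr.cost]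
  · rintro _ ⟨v, t, hv, hf, ht, rfl⟩
    refine ⟨v, _, hf, ?_, rfl⟩
    simp [Expr.cost]; omega

end Specs

/-! ### The splitting tree -/

/-- A node of the splitting tree for one of the two hidden sets: the block of items that starts with
`x` and has length `w` (one item if `w = 0`), on level `l`; the tag `b` tells the set. -/
structure Node where
  /-- the first item of the block -/
  x : ℕ
  /-- the level -/
  l : ℕ
  /-- the length of the block -/
  w : ℕ
  /-- the tag of the hidden set, zero or one -/
  b : ℕ

/-- The candidate children of a node: the block is halved, and the halves with a positive test are
kept. -/
def Node.children (pos : ℕ → ℕ → ℕ → Bool) (n Λ : ℕ) (u : Node) : List Node :=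
  if u.l < Λ then
    (if pos u.x u.l u.b then [⟨u.x, u.l + 1, u.w / 2, u.b⟩] else []) ++
    (if 0 < u.w / 2 ∧ u.x + u.w / 2 < n then
      (if pos (u.x + u.w / 2) u.l u.b then [⟨u.x + u.w / 2, u.l + 1, u.w / 2, u.b⟩] else [])
      else [])
  else []

/-- The two nodes of level zero for the `j`-th block of length `w`. -/
def rootPair (w j : ℕ) : List Node := [⟨j * w, 0, w, 0⟩, ⟨j * w, 0, w, 1⟩]

/-- The nodes of level zero. -/
def roots (n w : ℕ) : List Node := (List.range ((n + w - 1) / w)).flatMap (rootPair w)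

/-- The candidate nodes of level `l`. -/
def cand (pos : ℕ → ℕ → ℕ → Bool) (n Λ w : ℕ) : ℕ → List Node
  | 0 => roots n w
  | l + 1 => (cand pos n Λ w l).flatMap (Node.children pos n Λ)

/-- All candidate nodes, level by level. -/
def allCand (pos : ℕ → ℕ → ℕ → Bool) (n Λ w : ℕ) : List Node :=
  (List.range (Λ + 1)).flatMap (cand pos n Λ w)

section Tree

variable {pos : ℕ → ℕ → ℕ → Bool} {n Λ w : ℕ}

theorem Node.l_of_mem_children {u u' : Node} (h : u' ∈ u.children pos n Λ) :
    u'.l = u.l + 1 := by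
  unfold Node.children at h
  split_ifs at h <;> simp at h <;> aesop

theorem l_of_mem_cand {l : ℕ} : ∀ {u : Node}, u ∈ cand pos n Λ w l → u.l = l := by
  induction l with
  | zero => simp [cand, roots, rootPair]; aesop
  | succ l ih =>
    intro u hu
    obtain ⟨u', h₁, h₂⟩ := List.mem_flatMap.1 hu
    rw [Node.l_of_mem_children h₂, ih h₁]

theorem Node.children_of_le {u : Node} (h : Λ ≤ u.l) : u.children pos n Λ = [] := by
  simp [Node.children, h]

/-- The list of all candidates is what a breadth-first search finds. -/
theorem allCand_eq :
    allCand pos n Λ w = roots n w ++ (allCand pos n Λ w).flatMap (Node.children pos n Λ) := by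
  have h : (cand pos n Λ w Λ).flatMap (Node.children pos n Λ) = [] := by
    rw [List.flatMap_eq_nil_iff]
    exact fun u hu => Node.children_of_le (l_of_mem_cand hu).ge
  have h2 : (allCand pos n Λ w).flatMap (Node.children pos n Λ) =
      (List.range Λ).flatMap fun l => cand pos n Λ w (l + 1) := by
    rw [allCand, List.flatMap_assoc, List.range_succ, List.flatMap_append]
    simp [h, cand]
  rw [h2, allCand, List.range_succ_eq_map]
  simp [cand, List.flatMap_map]

theorem l_le_of_mem_allCand {u : Node} (h : u ∈ allCand pos n Λ w) : u.l ≤ Λ := by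
  obtain ⟨l, h₁, h₂⟩ := List.mem_flatMap.1 h
  rw [l_of_mem_cand h₂]
  have := List.mem_range.1 h₁
  omega

/-- The queue of the breadth-first search after `i` rounds. -/
def queue (pos : ℕ → ℕ → ℕ → Bool) (n Λ w i : ℕ) : List Node :=
  roots n w ++ ((allCand pos n Λ w).take i).flatMap (Node.children pos n Λ)

theorem queue_prefix (i : ℕ) : queue pos n Λ w i <+: allCand pos n Λ w := by
  conv_rhs => rw [allCand_eq]
  rw [queue]
  refine (List.prefix_append_right_inj _).2 ?_
  conv_rhs => rw [← List.take_append_drop i (allCand pos n Λ w), List.flatMap_append]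
  exact List.prefix_append _ _

theorem queue_succ {i : ℕ} (h : i < (queue pos n Λ w i).length) :
    queue pos n Λ w (i + 1) =
      queue pos n Λ w i ++ ((queue pos n Λ w i)[i]).children pos n Λ := by
  have h' := h.trans_le (queue_prefix i).length_le
  rw [(queue_prefix i).getElem h]
  simp only [queue]
  rw [List.take_succ_eq_append_getElem h', List.flatMap_append, List.append_assoc]
  simp

theorem queue_eq_of_length {i : ℕ} (h : (queue pos n Λ w i).length = i) :
    queue pos n Λ w i = allCand pos n Λ w := by
  obtain ⟨r, hr⟩ := queue_prefix (pos := pos) (n := n) (Λ := Λ) (w := w) i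
  have hd : (allCand pos n Λ w).drop i = r := by
    rw [← hr, List.drop_left' h]
  have hrec : r = r.flatMap (Node.children pos n Λ) := by
    have h3 := allCand_eq (pos := pos) (n := n) (Λ := Λ) (w := w)
    conv at h3 =>
      rhs
      rw [← List.take_append_drop i (allCand pos n Λ w), List.flatMap_append, ← List.append_assoc]
    rw [hd] at h3
    change _ = queue pos n Λ w i ++ _ at h3
    rw [← hr] at h3
    exact List.append_cancel_left h3
  -- the levels in `r` would have to be arbitrarily large
  have hl : ∀ k, ∀ u ∈ r, k ≤ u.l := by
    intro k
    induction k with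
    | zero => exact fun _ _ => Nat.zero_le _
    | succ k ih =>
      intro u hu
      rw [hrec] at hu
      obtain ⟨u', h₁, h₂⟩ := List.mem_flatMap.1 hu
      rw [Node.l_of_mem_children h₂]
      exact Nat.succ_le_succ (ih u' h₁)
  have hnil : r = [] := by
    refine List.eq_nil_iff_forall_not_mem.2 fun u hu => ?_
    have h₁ := hl (Λ + 1) u hu
    have h₂ := l_le_of_mem_allCand (pos := pos) (n := n) (Λ := Λ) (w := w) (u := u)
      (hr ▸ List.mem_append_right _ hu)
    omega
  rw [← hr, hnil, List.append_nil]

theorem queue_zero : queue pos n Λ w 0 = roots n w := by simp [queue]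

end Tree

/-! ### Breadth-first search -/

/-- Append the node in the variables 17 to 20 to the queue. -/
def push : Program :=
  .atom (.store 0 (.var 16) (.var 17)) ;;
  .atom (.store 1 (.var 16) (.var 18)) ;;
  .atom (.store 2 (.var 16) (.var 19)) ;;
  .atom (.store 3 (.var 16) (.var 20)) ;;
  set 16 (.add (.var 16) (.lit 1))

/-- Append the node in the variables 17 to 20 to the queue if the test of its pool is positive. -/
def pushIf : Program :=
  .ite (.result (.add (.var 14) (.add (.mul (.var 20) (.var 8))
    (.colNth (.var 17) (.sub (.var 18) (.lit 1)))))) push skip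

/-- Put the nodes of level zero in the queue. -/
def pushRoots : Program :=
  set 16 (.lit 0) ;; set 17 (.lit 0) ;; set 18 (.lit 0) ;; set 19 (.var 7) ;;
  .loop (.lt (.var 17) (.var 0)) (
    set 20 (.lit 0) ;; push ;; set 20 (.lit 1) ;; push ;;
    set 17 (.add (.var 17) (.var 7)))

/-- Breadth-first search of the splitting tree: the outcomes of the tests for the tags `0` and `1`
start at positions `v₁₄` and `v₁₄ + v₈`; the search stops as soon as the queue has at least `v₉`
nodes. -/
def decode : Program :=
  pushRoots ;;
  set 15 (.lit 0) ;;
  .loop (.mul (.lt (.var 15) (.var 16)) (.lt (.var 16) (.var 9))) (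
    set 17 (.read 0 (.var 15)) ;;
    set 18 (.add (.read 1 (.var 15)) (.lit 1)) ;;
    set 19 (.div (.read 2 (.var 15)) (.lit 2)) ;;
    set 20 (.read 3 (.var 15)) ;;
    .ite (.lt (.read 1 (.var 15)) (.var 5)) (
      pushIf ;;
      set 17 (.add (.var 17) (.var 19)) ;;
      .ite (.mul (.lt (.lit 0) (.var 19)) (.lt (.var 17) (.var 0))) pushIf skip) skip ;;
    set 15 (.add (.var 15) (.lit 1)))

/-- The arrays 0 to 3 hold the queue `q`. -/
def Holds (a : ℕ → ℕ → ℕ) (q : List Node) : Prop :=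
  ∀ i (h : i < q.length), a 0 i = q[i].x ∧ a 1 i = q[i].l ∧ a 2 i = q[i].w ∧ a 3 i = q[i].b

/-- The outcome of the splitting test for the block of `x` on level `l` and the tag `b`, as the
decoder reads it. -/
noncomputable def posOf {n N : ℕ} (L : PoolTable n N) (res : List Bool) (W V base x l b : ℕ) :
    Bool :=
  res.getD ((base + (b * V % W + Nat.nth (fun p => L.Has p x) l % W) % W) % W) false

section Specs

variable {n N : ℕ} {S₁ S₂ : Finset (Fin n)} {T : ℕ → PoolTable n N} {W : ℕ}

theorem Holds.append {a : ℕ → ℕ → ℕ} {q : List Node} (h : Holds a q) (u : Node) :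
    Holds (Function.update (Function.update (Function.update (Function.update a
      0 (Function.update (a 0) q.length u.x)) 1 (Function.update (a 1) q.length u.l))
      2 (Function.update (a 2) q.length u.w)) 3 (Function.update (a 3) q.length u.b)) (q ++ [u]) := by
  intro i hi
  simp only [List.length_append, List.length_singleton] at hi
  rcases Nat.lt_succ_iff_lt_or_eq.1 hi with hi | rfl
  · have := h i hi
    simp [Function.update, hi.ne, List.getElem_append_left hi, this]
  · simp [Function.update]

theorem runs_push {σ : State n} {q : List Node} {u : Node} (hq : Holds σ.arr q)
    (h16 : σ.var 16 = q.length) (hx : σ.var 17 = u.x) (hl : σ.var 18 = u.l)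
    (hw : σ.var 19 = u.w) (hb : σ.var 20 = u.b) (hW : q.length + 1 < W) (hW3 : 3 < W) :
    Runs S₁ S₂ T W push σ fun τ => ∃ a, Holds a (q ++ [u]) ∧
      τ = { σ with
        var := Function.update σ.var 16 (q.length + 1)
        arr := a
        time := σ.time + 16 } := by
  refine .step <| .step <| .step <| .step <| .atom ⟨_, hq.append u, ?_⟩
  have e1 : (q.length + 1) % W = q.length + 1 := Nat.mod_eq_of_lt (by omega)
  have e6 : 1 % W = 1 := Nat.mod_eq_of_lt (by omega)
  simp [Atom.step, Expr.eval, Expr.cost, h16, hx, hl, hw, hb, e1, e6]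

theorem runs_pushIf {σ : State n} {q : List Node} {u : Node} {V base l : ℕ} (hq : Holds σ.arr q)
    (h16 : σ.var 16 = q.length) (hx : σ.var 17 = u.x) (hl : σ.var 18 = u.l)
    (hw : σ.var 19 = u.w) (hb : σ.var 20 = u.b) (hV : σ.var 8 = V) (hbase : σ.var 14 = base)
    (hul : u.l = l + 1) (hW : q.length + 1 < W) (hW3 : 3 < W) :
    Runs S₁ S₂ T W pushIf σ fun τ => ∃ a v t,
      Holds a (q ++ if posOf (T σ.table) σ.results W V base u.x l u.b then [u] else []) ∧
      v 16 = (q ++ if posOf (T σ.table) σ.results W V base u.x l u.b then [u] else []).length ∧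
      (∀ x, x ≠ 16 → v x = σ.var x) ∧ t ≤ σ.time + 29 ∧
      τ = { σ with
        var := v
        arr := a
        time := t } := by
  have e6 : 1 % W = 1 := Nat.mod_eq_of_lt (by omega)
  have hcond : (Expr.result (.add (.var 14) (.add (.mul (.var 20) (.var 8))
      (.colNth (.var 17) (.sub (.var 18) (.lit 1)))))).eval W (T σ.table) σ =
      (posOf (T σ.table) σ.results W V base u.x l u.b).toNat := by
    simp [Expr.eval, posOf, hx, hl, hb, hV, hbase, hul, e6]
  refine .ite (fun h => ?_) (fun h => ?_)
  · have hp : posOf (T σ.table) σ.results W V base u.x l u.b = true := by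
      rw [hcond] at h; simpa using h
    refine (runs_push (σ := State.charge σ _) hq h16 hx hl hw hb hW hW3).mono ?_
    rintro _ ⟨a, ha, rfl⟩
    refine ⟨a, Function.update σ.var 16 (q.length + 1), σ.time + 29, ?_, ?_, ?_, le_rfl, ?_⟩
    · simpa [hp] using ha
    · simp [hp]
    · intro x hx; simp [hx]
    · simp [State.charge, Expr.cost]
  · have hp : posOf (T σ.table) σ.results W V base u.x l u.b = false := by
      rw [hcond] at h; simpa using h
    refine runs_skip ⟨σ.arr, σ.var, σ.time + 15, ?_, ?_, fun _ _ => rfl, by omega, ?_⟩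
    · simpa [hp] using hq
    · simpa [hp] using h16
    · simp [State.charge, Expr.cost]

theorem lt_ceil_iff {n w j : ℕ} (hw : 0 < w) : j < (n + w - 1) / w ↔ j * w < n := by
  rw [← Nat.succ_le_iff, Nat.le_div_iff_mul_le hw, Nat.succ_mul]
  omega

theorem runs_pushRoots {σ : State n} {w : ℕ} (h0 : σ.var 0 = n) (h7 : σ.var 7 = w) (hw : 0 < w)
    (hW : (roots n w).length + 2 < W) (hnw : n + w < W) (hW3 : 3 < W) :
    Runs S₁ S₂ T W pushRoots σ fun τ => ∃ a v t,
      Holds a (roots n w) ∧ v 16 = (roots n w).length ∧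
      (∀ x, x < 15 → v x = σ.var x) ∧ t ≤ σ.time + 50 * (roots n w).length + 20 ∧
      τ = { σ with
        var := v
        arr := a
        time := t } := by
  have hlen : ∀ k, ((List.range k).flatMap (rootPair w)).length = 2 * k := by
    intro k
    induction k with
    | zero => simp
    | succ k ih => rw [List.range_succ, List.flatMap_append]; simp [ih, rootPair]; omega
  rw [roots, hlen] at hW
  have e0 : 0 % W = 0 := Nat.zero_mod _
  have e6 : 1 % W = 1 := Nat.mod_eq_of_lt (by omega)
  refine .step <| .step <| .step <| .step ?_
  refine Runs.rounds (fun j τ => ∃ a v t,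
      Holds a ((List.range j).flatMap (rootPair w)) ∧ v 16 = 2 * j ∧
      v 17 = j * w ∧ v 18 = 0 ∧ v 19 = w ∧
      (∀ x, x < 15 → v x = σ.var x) ∧ t ≤ σ.time + 50 * j + 10 ∧
      τ = { σ with
        var := v
        arr := a
        time := t }) ((n + w - 1) / w) ?_ ?_ ?_ ?_
  · rintro j hj _ ⟨a, v, t, ha, h16, h17, h18, h19, hf, ht, rfl⟩
    have hv0 : v 0 = n := by rw [hf 0 (by decide), h0]
    have hv7 : v 7 = w := by rw [hf 7 (by decide), h7]
    have hjw := (lt_ceil_iff (n := n) hw).1 hj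
    refine ⟨by simp [Expr.eval, h17, hv0, hjw], ?_⟩
    refine .step <| .seq <| (runs_push (q := (List.range j).flatMap (rootPair w))
      (u := ⟨j * w, 0, w, 0⟩) ?_ ?_ ?_ ?_ ?_ ?_ ?_ hW3).mono ?_
    · simpa [Atom.step, State.charge] using ha
    · simp [Atom.step, State.charge, h16, hlen]
    · simp [Atom.step, State.charge, h17]
    · simp [Atom.step, State.charge, h18]
    · simp [Atom.step, State.charge, h19]
    · simp [Atom.step, Expr.eval]
    · rw [hlen]; omega
    rintro _ ⟨a', ha', rfl⟩
    refine .step <| .seq <| (runs_push (q := (List.range j).flatMap (rootPair w) ++ [⟨j * w, 0, w, 0⟩])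
      (u := ⟨j * w, 0, w, 1⟩) ?_ ?_ ?_ ?_ ?_ ?_ ?_ hW3).mono ?_
    · simpa [Atom.step, State.charge] using ha'
    · simp [Atom.step, State.charge, hlen]
    · simp [Atom.step, State.charge, h17]
    · simp [Atom.step, State.charge, h18]
    · simp [Atom.step, State.charge, h19]
    · simp [Atom.step, Expr.eval, e6]
    · simp only [List.length_append, hlen, List.length_singleton]; omega
    rintro _ ⟨a'', ha'', rfl⟩
    have e7 : (j * w + w) % W = j * w + w := Nat.mod_eq_of_lt (by omega)
    have e8 : ((List.range j).flatMap (rootPair w) ++ [(⟨j * w, 0, w, 0⟩ : Node)]).length + 1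
        = 2 * (j + 1) := by simp only [List.length_append, hlen, List.length_singleton]; omega
    refine .atom ⟨a'', _, t + 44, ?_, ?_, ?_, ?_, ?_, ?_, ?_, rfl⟩
    · rw [List.range_succ, List.flatMap_append]
      simpa [rootPair] using ha''
    · exact e8
    · simp [Atom.step, Expr.eval, State.charge, h17, hv7, e7]; ring
    · simp [Atom.step, h18, State.charge]
    · simp [Atom.step, h19, State.charge]
    · intro x hx
      simp [Atom.step, State.charge, hf x hx, show x ≠ 17 by omega, show x ≠ 16 by omega,
        show x ≠ 20 by omega]
    · omega
  · rintro _ ⟨a, v, t, ha, h16, h17, h18, h19, hf, ht, rfl⟩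
    have := mt (lt_ceil_iff (n := n) hw).2 (lt_irrefl _)
    have hv0 : v 0 = n := by rw [hf 0 (by decide), h0]
    simp [Expr.eval, h17, hv0]
    omega
  · refine ⟨σ.arr, _, _, ?_, ?_, ?_, ?_, ?_, ?_, ?_, rfl⟩
    · intro i hi; simp at hi
    · simp [Atom.step, Expr.eval]
    · simp [Atom.step, Expr.eval]
    · simp [Atom.step, Expr.eval]
    · simp [Atom.step, Expr.eval, h7]
    · intro x hx
      simp [Atom.step, show x ≠ 17 by omega, show x ≠ 16 by omega, show x ≠ 18 by omega,
        show x ≠ 19 by omega]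
    · simp [Atom.step, Expr.cost]
  · rintro _ ⟨a, v, t, ha, h16, h17, h18, h19, hf, ht, rfl⟩
    refine ⟨a, v, _, ha, ?_, hf, ?_, rfl⟩
    · rw [h16, roots, hlen]
    · rw [roots, hlen]; simp [Expr.cost]; omega

end Specs

section Specs

variable {n N : ℕ} {S₁ S₂ : Finset (Fin n)} {T : ℕ → PoolTable n N} {W : ℕ}

theorem bounds_of_mem_cand {pos : ℕ → ℕ → ℕ → Bool} {Λ w l : ℕ} :
    ∀ {u : Node}, u ∈ cand pos n Λ w l → u.x < n ∧ u.w ≤ w ∧ u.b ≤ 1 := by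
  induction l with
  | zero =>
    intro u hu
    obtain ⟨j, hj, hu⟩ := List.mem_flatMap.1 hu
    have hj := List.mem_range.1 hj
    rcases Nat.eq_zero_or_pos w with rfl | hw
    · simp at hj
    · have := (lt_ceil_iff hw).1 hj
      simp only [rootPair, List.mem_cons, List.not_mem_nil, or_false] at hu
      rcases hu with rfl | rfl <;> simp [this]
  | succ l ih =>
    intro u hu
    obtain ⟨u', h₁, h₂⟩ := List.mem_flatMap.1 hu
    have := ih h₁
    unfold Node.children at h₂
    split_ifs at h₂ <;> simp at h₂ <;> try rcases h₂ with rfl | rfl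
    all_goals refine ⟨?_, ?_, ?_⟩ <;> simp only [] <;> omega

theorem bounds_of_mem_allCand {pos : ℕ → ℕ → ℕ → Bool} {Λ w : ℕ} {u : Node}
    (h : u ∈ allCand pos n Λ w) : u.x < n ∧ u.w ≤ w ∧ u.b ≤ 1 := by
  obtain ⟨l, -, h⟩ := List.mem_flatMap.1 h
  exact bounds_of_mem_cand h

theorem runs_expand {σ : State n} {q : List Node} {u : Node} {Λ V base : ℕ}
    {pos : ℕ → ℕ → ℕ → Bool} (h0 : σ.var 0 = n) (h5 : σ.var 5 = Λ) (h8 : σ.var 8 = V)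
    (h14 : σ.var 14 = base) (hpos : posOf (T σ.table) σ.results W V base = pos)
    (hq : Holds σ.arr q) (h16 : σ.var 16 = q.length) (hl' : σ.arr 1 (σ.var 15) = u.l)
    (hx : σ.var 17 = u.x) (hl : σ.var 18 = u.l + 1)
    (hw : σ.var 19 = u.w / 2) (hb : σ.var 20 = u.b) (hW : q.length + 3 < W)
    (hxw : u.x + u.w < W) (hW3 : 3 < W) :
    Runs S₁ S₂ T W (.ite (.lt (.read 1 (.var 15)) (.var 5)) (
      pushIf ;;
      set 17 (.add (.var 17) (.var 19)) ;;
      .ite (.mul (.lt (.lit 0) (.var 19)) (.lt (.var 17) (.var 0))) pushIf skip) skip) σ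
    fun τ => ∃ a v t,
      Holds a (q ++ u.children pos n Λ) ∧ v 16 = (q ++ u.children pos n Λ).length ∧
      (∀ x, x < 16 → v x = σ.var x) ∧ t ≤ σ.time + 80 ∧
      τ = { σ with
        var := v
        arr := a
        time := t } := by
  have e6 : 1 % W = 1 := Nat.mod_eq_of_lt (by omega)
  refine .ite (fun h => ?_) (fun h => ?_)
  · have hΛ : u.l < Λ := by
      by_contra hc
      simp [Expr.eval, hl', h5, hc] at h
    refine .seq <| (runs_pushIf (σ := σ.charge _) (q := q)
      (u := ⟨u.x, u.l + 1, u.w / 2, u.b⟩) (l := u.l) (V := V)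
      (base := base) hq h16 hx hl hw hb h8 h14 rfl (by omega) hW3).mono ?_
    rintro _ ⟨a, v, t, ha, h16', hf, ht, rfl⟩
    change Holds a (q ++ if posOf (T σ.table) σ.results W V base u.x u.l u.b then _ else _) at ha
    change v 16 = (q ++ if posOf (T σ.table) σ.results W V base u.x u.l u.b then _ else _).length
      at h16'
    rw [hpos] at ha h16'
    set q1 := q ++ if pos u.x u.l u.b then [(⟨u.x, u.l + 1, u.w / 2, u.b⟩ : Node)] else [] with hq1
    have hlen : q1.length ≤ q.length + 1 := by
      rw [hq1]; split_ifs <;> simp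
    replace hf : ∀ x, x ≠ 16 → v x = σ.var x := hf
    replace ht : t ≤ σ.time + 34 := ht
    have e7 : (u.x + u.w / 2) % W = u.x + u.w / 2 := Nat.mod_eq_of_lt (by omega)
    have hv17 : v 17 = u.x := by rw [hf _ (by decide), hx]
    have hv19 : v 19 = u.w / 2 := by rw [hf _ (by decide), hw]
    have hv0 : v 0 = n := by rw [hf _ (by decide), h0]
    refine .step <| .ite (fun h' => ?_) (fun h' => ?_)
    · have hc : 0 < u.w / 2 ∧ u.x + u.w / 2 < n := by
        by_contra hc
        apply h'
        rcases not_and_or.1 hc with h | h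
        · simp [Atom.step, Expr.eval, hv17, hv19, hv0, Nat.eq_zero_of_not_pos h]
        · simp [Atom.step, Expr.eval, hv17, hv19, hv0, e7, h]
      refine (runs_pushIf (q := q1) (u := ⟨u.x + u.w / 2, u.l + 1, u.w / 2, u.b⟩) (l := u.l)
        (V := V) (base := base) ha ?_ ?_ ?_ ?_ ?_ ?_ ?_ rfl (by omega) hW3).mono ?_
      · simp [Atom.step, State.charge, h16']
      · simp [Atom.step, State.charge, Expr.eval, hv17, hv19, e7]
      · simp [Atom.step, State.charge, hf, hl]
      · simp [Atom.step, State.charge, hv19]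
      · simp [Atom.step, State.charge, hf, hb]
      · simp [Atom.step, State.charge, hf, h8]
      · simp [Atom.step, State.charge, hf, h14]
      rintro _ ⟨a', v', t', ha', h16'', hf', ht', rfl⟩
      simp only [Atom.step, State.charge, hpos] at ha' h16''
      have hch : q ++ u.children pos n Λ = q1 ++ if pos (u.x + u.w / 2) u.l u.b then
          [(⟨u.x + u.w / 2, u.l + 1, u.w / 2, u.b⟩ : Node)] else [] := by
        rw [Node.children, if_pos hΛ, if_pos hc, hq1, List.append_assoc]
      refine ⟨a', v', t', ?_, ?_, ?_, ?_, rfl⟩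
      · rw [hch]; exact ha'
      · rw [hch]; exact h16''
      · intro x hx
        rw [hf' x (by omega)]
        simp [Atom.step, State.charge, show x ≠ 17 by omega, hf x (by omega)]
      · simp [Atom.step, State.charge, Expr.cost] at ht'
        omega
    · have hc : ¬ (0 < u.w / 2 ∧ u.x + u.w / 2 < n) := by
        rintro ⟨hc1, hc2⟩
        simp [Atom.step, Expr.eval, hv17, hv19, hv0, e6, e7, hc1, hc2] at h'
      have hch : q ++ u.children pos n Λ = q1 := by
        rw [Node.children, if_pos hΛ, if_neg hc, hq1, List.append_nil]
      refine runs_skip ⟨a, _, _, ?_, ?_, ?_, ?_, rfl⟩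
      · rw [hch]; exact ha
      · rw [hch]; exact h16'
      · intro x hx
        simp [Atom.step, State.charge, show x ≠ 17 by omega, hf x (by omega)]
      · simp [Atom.step, State.charge, Expr.cost]; omega
  · have hΛ : ¬ u.l < Λ := by
      intro hc
      simp [Expr.eval, hl', h5, hc] at h
    have hch : q ++ u.children pos n Λ = q := by
      rw [Node.children, if_neg hΛ, List.append_nil]
    refine runs_skip ⟨σ.arr, σ.var, _, ?_, ?_, fun _ _ => rfl, ?_, rfl⟩
    · rw [hch]; exact hq
    · rw [hch]; exact h16
    · simp [State.charge, Expr.cost]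

theorem children_length_le {pos : ℕ → ℕ → ℕ → Bool} {Λ : ℕ} (u : Node) :
    (u.children pos n Λ).length ≤ 2 := by
  unfold Node.children
  split_ifs <;> simp

theorem runs_decode {σ : State n} {w Λ V base bud : ℕ} {pos : ℕ → ℕ → ℕ → Bool}
    (h0 : σ.var 0 = n) (h5 : σ.var 5 = Λ) (h7 : σ.var 7 = w) (h8 : σ.var 8 = V)
    (h9 : σ.var 9 = bud) (h14 : σ.var 14 = base)
    (hpos : posOf (T σ.table) σ.results W V base = pos)
    (hw : 0 < w) (hW : bud + (roots n w).length + 5 < W) (hnw : n + w < W) (hΛ : Λ + 1 < W)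
    (hW3 : 3 < W) :
    Runs S₁ S₂ T W decode σ fun τ => ∃ q a v t,
      Holds a q ∧ v 16 = q.length ∧ (bud ≤ q.length ∨ q = allCand pos n Λ w) ∧
      q.length ≤ bud + (roots n w).length + 2 ∧
      q <+: allCand pos n Λ w ∧
      (∀ x, x < 15 → v x = σ.var x) ∧ t ≤ σ.time + 200 * q.length + 50 ∧
      τ = { σ with
        var := v
        arr := a
        time := t } := by
  have e6 : 1 % W = 1 := Nat.mod_eq_of_lt (by omega)
  have e2 : 2 % W = 2 := Nat.mod_eq_of_lt (by omega)
  refine .seq <| (runs_pushRoots h0 h7 hw (by omega) hnw hW3).mono ?_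
  rintro _ ⟨a₀, v₀, t₀, ha₀, h16₀, hf₀, ht₀, rfl⟩
  refine .step ?_
  refine Runs.loop (fun i τ => ∃ a v t,
      i ≤ (queue pos n Λ w i).length ∧
      (queue pos n Λ w i).length ≤ bud + (roots n w).length + 2 ∧
      Holds a (queue pos n Λ w i) ∧ v 15 = i ∧ v 16 = (queue pos n Λ w i).length ∧
      (∀ x, x < 15 → v x = σ.var x) ∧ t ≤ σ.time + 50 * (roots n w).length + 22 + 150 * i ∧
      τ = { σ with
        var := v
        arr := a
        time := t }) (allCand pos n Λ w).length ?_ ?_ ?_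
  · rintro i _ ⟨a, v, t, hi, hlen, ha, h15, h16, hf, ht, rfl⟩ he
    have hv0 : v 0 = n := by rw [hf _ (by decide), h0]
    have hv5 : v 5 = Λ := by rw [hf _ (by decide), h5]
    have hv8 : v 8 = V := by rw [hf _ (by decide), h8]
    have hv9 : v 9 = bud := by rw [hf _ (by decide), h9]
    have hv14 : v 14 = base := by rw [hf _ (by decide), h14]
    have hc : i < (queue pos n Λ w i).length ∧ (queue pos n Λ w i).length < bud := by
      by_contra hc
      apply he
      rcases not_and_or.1 hc with h | h <;> simp [Expr.eval, h15, h16, hv9, h]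
    obtain ⟨hi', hbud⟩ := hc
    refine ⟨hi'.trans_le (queue_prefix i).length_le, ?_⟩
    set u := (queue pos n Λ w i)[i] with hu
    have hmem : u ∈ allCand pos n Λ w := (queue_prefix i).mem (List.getElem_mem hi')
    obtain ⟨hux, huw, -⟩ := bounds_of_mem_allCand hmem
    have hul := l_le_of_mem_allCand hmem
    obtain ⟨hax, hal, haw, hab⟩ := ha i hi'
    have e7 : (u.l + 1) % W = u.l + 1 := Nat.mod_eq_of_lt (by omega)
    refine .step <| .step <| .step <| .step <| .seq <| (runs_expand (q := queue pos n Λ w i)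
      (u := u) (Λ := Λ) (V := V) (base := base) (pos := pos)
      ?_ ?_ ?_ ?_ ?_ ?_ ?_ ?_ ?_ ?_ ?_ ?_ (by omega) (by omega) hW3).mono ?_
    · simp [Atom.step, State.charge, hv0]
    · simp [Atom.step, State.charge, hv5]
    · simp [Atom.step, State.charge, hv8]
    · simp [Atom.step, State.charge, hv14]
    · simpa [Atom.step, State.charge] using hpos
    · simpa [Atom.step, State.charge] using ha
    · simp [Atom.step, State.charge, h16]
    · simp [Atom.step, State.charge, h15, hal, hu]
    · simp [Atom.step, State.charge, Expr.eval, h15, hax, hu]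
    · simp [Atom.step, State.charge, Expr.eval, h15, hal, e6, e7, ← hu]
    · simp [Atom.step, State.charge, Expr.eval, h15, haw, e2, hu]
    · simp [Atom.step, State.charge, Expr.eval, h15, hab, hu]
    rintro _ ⟨a', v', t', ha', h16', hf', ht', rfl⟩
    rw [← queue_succ hi'] at ha' h16'
    have hlen' : (queue pos n Λ w (i + 1)).length ≤ (queue pos n Λ w i).length + 2 := by
      rw [queue_succ hi', List.length_append]
      exact Nat.add_le_add_left (children_length_le _) _
    have hlen'' : (queue pos n Λ w i).length ≤ (queue pos n Λ w (i + 1)).length := by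
      rw [queue_succ hi', List.length_append]
      omega
    have h15' : v' 15 = i := by
      rw [hf' 15 (by decide)]; simp [Atom.step, State.charge, h15]
    have e8 : (i + 1) % W = i + 1 := Nat.mod_eq_of_lt (by omega)
    refine .atom ⟨a', _, _, by omega, by omega, ha', ?_, ?_, ?_, ?_, rfl⟩
    · simp [Expr.eval, h15', e6, e8]
    · simpa using h16'
    · intro x hx
      simp only [Function.update_of_ne (show x ≠ 15 by omega)]
      rw [hf' x (by omega)]
      simp [Atom.step, State.charge, hf x hx, show x ≠ 17 by omega, show x ≠ 18 by omega,
        show x ≠ 19 by omega, show x ≠ 20 by omega]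
    · simp [Atom.step, State.charge, Expr.cost] at ht' ⊢
      omega
  · refine ⟨a₀, _, _, Nat.zero_le _, ?_, ?_, ?_, ?_, ?_, ?_, rfl⟩
    · rw [queue_zero]; omega
    · rw [queue_zero]; exact ha₀
    · simp [Expr.eval]
    · rw [queue_zero]; simp [h16₀]
    · intro x hx
      simp [show x ≠ 15 by omega, hf₀ x hx]
    · simp [Expr.cost]; omega
  · rintro i _ ⟨a, v, t, hi, hlen, ha, h15, h16, hf, ht, rfl⟩ he
    have hv9 : v 9 = bud := by rw [hf _ (by decide), h9]
    have hroots : (roots n w).length ≤ (queue pos n Λ w i).length := by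
      simp [queue]
    refine ⟨queue pos n Λ w i, a, v, _, ha, h16, ?_, hlen, queue_prefix i, hf, ?_, rfl⟩
    · by_contra hc
      push Not at hc
      refine hc.2 (queue_eq_of_length (le_antisymm ?_ hi))
      by_contra hlt
      simp [Expr.eval, h15, h16, hv9, e6, hc.1, not_le.1 hlt] at he
    · simp [Expr.cost]; omega

end Specs

/-! ### Trials and output -/

/-- Look for a successful trial: both pools tested negative and their union positive. If there is
one, then variable 10 is set to one and variable 11 to the number of its first pool. -/
def scan : Program :=
  set 10 (.lit 0) ;; set 12 (.lit 0) ;;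
  .loop (.lt (.var 12) (.var 6)) (
    .ite (.lt (.add (.result (.mul (.lit 3) (.var 12)))
        (.result (.add (.mul (.lit 3) (.var 12)) (.lit 1))))
        (.result (.add (.mul (.lit 3) (.var 12)) (.lit 2))))
      (set 10 (.lit 1) ;; set 11 (.add (.var 8) (.mul (.lit 2) (.var 12)))) skip ;;
    set 12 (.add (.var 12) (.lit 1)))

/-- Request tests of all single items in the queue, each united with the trial pool for its tag. -/
def reqItems : Program :=
  set 12 (.lit 0) ;;
  .loop (.lt (.var 12) (.var 16)) (
    .atom (.putItem (.read 0 (.var 12))) ;;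
    .atom (.putPool (.add (.var 11) (.read 3 (.var 12)))) ;;
    .atom .submit ;;
    set 12 (.add (.var 12) (.lit 1)))

/-- Output the first items of those nodes of the queue for which `e` is not zero. -/
def output (e : Expr) : Program :=
  set 12 (.lit 0) ;;
  .loop (.lt (.var 12) (.var 16)) (
    .ite e (.ite (.read 3 (.var 12)) (.atom (.emit true (.read 0 (.var 12))))
      (.atom (.emit false (.read 0 (.var 12))))) skip ;;
    set 12 (.add (.var 12) (.lit 1)))

section Specs

variable {n N : ℕ} {S₁ S₂ : Finset (Fin n)} {T : ℕ → PoolTable n N} {W : ℕ}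

/-- According to the test outcomes `res`, trial `k` was successful. -/
def Passed (res : List Bool) (k : ℕ) : Prop :=
  res.getD (3 * k) false = false ∧ res.getD (3 * k + 1) false = false ∧
    res.getD (3 * k + 2) false = true

theorem runs_scan {σ : State n} {V R : ℕ} (hV : σ.var 8 = V) (hR : σ.var 6 = R)
    (hW : V + 3 * R + 3 < W) :
    Runs S₁ S₂ T W scan σ fun τ => ∃ v t,
      ((v 10 = 1 ∧ ∃ k < R, Passed σ.results k ∧ v 11 = V + 2 * k) ∨
        (v 10 = 0 ∧ ∀ k < R, ¬ Passed σ.results k)) ∧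
      (∀ x, x ≠ 10 → x ≠ 11 → x ≠ 12 → v x = σ.var x) ∧ t ≤ σ.time + 50 * R + 10 ∧
      τ = { σ with
        var := v
        time := t } := by
  have e0 : 0 % W = 0 := Nat.zero_mod _
  have e1 : 1 % W = 1 := Nat.mod_eq_of_lt (by omega)
  have e2 : 2 % W = 2 := Nat.mod_eq_of_lt (by omega)
  have e3 : 3 % W = 3 := Nat.mod_eq_of_lt (by omega)
  refine .step <| .step ?_
  refine Runs.rounds (fun i τ => ∃ v t, v 12 = i ∧
      ((v 10 = 1 ∧ ∃ k < R, Passed σ.results k ∧ v 11 = V + 2 * k) ∨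
        (v 10 = 0 ∧ ∀ k < i, ¬ Passed σ.results k)) ∧
      (∀ x, x ≠ 10 → x ≠ 11 → x ≠ 12 → v x = σ.var x) ∧ t ≤ σ.time + 50 * i + 4 ∧
      τ = { σ with
        var := v
        time := t }) R ?_ ?_ ?_ ?_
  · rintro i hi _ ⟨v, t, hv, hk, hf, ht, rfl⟩
    have h8 : v 8 = V := by rw [hf 8 (by decide) (by decide) (by decide), hV]
    have h6 : v 6 = R := by rw [hf 6 (by decide) (by decide) (by decide), hR]
    have a1 : (i + 1) % W = i + 1 := Nat.mod_eq_of_lt (by omega)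
    have a2 : (2 * i) % W = 2 * i := Nat.mod_eq_of_lt (by omega)
    have a3 : (3 * i) % W = 3 * i := Nat.mod_eq_of_lt (by omega)
    have a4 : (3 * i + 1) % W = 3 * i + 1 := Nat.mod_eq_of_lt (by omega)
    have a5 : (3 * i + 2) % W = 3 * i + 2 := Nat.mod_eq_of_lt (by omega)
    have a6 : (V + 2 * i) % W = V + 2 * i := Nat.mod_eq_of_lt (by omega)
    refine ⟨by simp [Expr.eval, hv, h6, hi], ?_⟩
    have hcond : ∀ t', (Expr.lt (.add (.result (.mul (.lit 3) (.var 12)))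
        (.result (.add (.mul (.lit 3) (.var 12)) (.lit 1))))
        (.result (.add (.mul (.lit 3) (.var 12)) (.lit 2)))).eval W (T σ.table)
        { σ with var := v, time := t' } ≠ 0 ↔ Passed σ.results i := by
      intro t'
      simp only [Expr.eval, hv, e1, e2, e3, a3, a4, a5, Passed]
      cases σ.results.getD (3 * i) false <;> cases σ.results.getD (3 * i + 1) false <;>
        cases σ.results.getD (3 * i + 2) false <;> simp [e1, e2]
    refine .seq <| .ite (fun h => ?_) (fun h => ?_)
    · have hp := (hcond _).1 h
      refine .step <| .atom <| .atom ⟨_, _, ?_, ?_, ?_, ?_, rfl⟩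
      · simp [Atom.step, State.charge, Expr.eval, hv, e1, a1]
      · refine .inl ⟨?_, i, hi, hp, ?_⟩
        · simp [Atom.step, State.charge, Expr.eval, e1]
        · simp [Atom.step, State.charge, Expr.eval, hv, h8, e2, a2, a6]
      · intro x h10 h11 h12
        simp [Atom.step, State.charge, h10, h11, h12, hf x h10 h11 h12]
      · simp [Atom.step, State.charge, Expr.cost]; omega
    · have hp := mt (hcond _).2 (not_not.2 h)
      refine runs_skip <| .atom ⟨_, _, ?_, ?_, ?_, ?_, rfl⟩
      · simp [State.charge, Expr.eval, hv, e1, a1]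
      · refine hk.imp (fun hk => ?_) (fun hk => ?_)
        · simpa [State.charge, Expr.eval] using hk
        · refine ⟨by simpa [State.charge, Expr.eval] using hk.1, fun k hki => ?_⟩
          rcases Nat.lt_succ_iff_lt_or_eq.1 hki with hki | rfl
          · exact hk.2 k hki
          · exact hp
      · intro x h10 h11 h12
        simp [State.charge, h12, hf x h10 h11 h12]
      · simp [State.charge, Expr.cost]; omega
  · rintro _ ⟨v, t, hv, hk, hf, ht, rfl⟩
    simp [Expr.eval, hv, hf, hR]
  · refine ⟨_, _, ?_, .inr ⟨?_, ?_⟩, ?_, ?_, rfl⟩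
    · simp [Expr.eval]
    · simp [Atom.step, Expr.eval]
    · simp
    · intro x h10 h11 h12
      simp [Atom.step, h10, h12]
    · simp [Atom.step, Expr.cost]
  · rintro _ ⟨v, t, hv, hk, hf, ht, rfl⟩
    refine ⟨v, _, hk, hf, ?_, rfl⟩
    simp [Expr.cost]; omega

theorem runs_reqItems {σ : State n} {q : List Node} {g : ℕ} (hq : Holds σ.arr q)
    (h16 : σ.var 16 = q.length) (hg : σ.var 11 = g) (hc : σ.cur = ∅) (hb : ∀ u ∈ q, u.b ≤ 1)
    (hW : g + q.length + 2 < W) :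
    Runs S₁ S₂ T W reqItems σ fun τ => ∃ v t,
      (∀ x, x ≠ 12 → v x = σ.var x) ∧ t ≤ σ.time + 30 * q.length + 10 ∧
      τ = { σ with
        var := v
        pending := σ.pending ++ q.map fun u => itemSet n u.x ∪ (T σ.table).row (g + u.b)
        tests := σ.tests + q.length
        time := t } := by
  have e1 : 1 % W = 1 := Nat.mod_eq_of_lt (by omega)
  refine .step ?_
  refine Runs.rounds (fun i τ => ∃ v t, v 12 = i ∧
      (∀ x, x ≠ 12 → v x = σ.var x) ∧ t ≤ σ.time + 30 * i + 2 ∧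
      τ = { σ with
        var := v
        pending := σ.pending ++ (q.take i).map fun u => itemSet n u.x ∪ (T σ.table).row (g + u.b)
        tests := σ.tests + i
        time := t }) q.length ?_ ?_ ?_ ?_
  · rintro i hi _ ⟨v, t, hv, hf, ht, rfl⟩
    have h11 : v 11 = g := by rw [hf 11 (by decide), hg]
    have h16 : v 16 = q.length := by rw [hf 16 (by decide), h16]
    have a1 : (i + 1) % W = i + 1 := Nat.mod_eq_of_lt (by omega)
    have hbi := hb _ (List.getElem_mem hi)
    have a2 : (g + q[i].b) % W = g + q[i].b := Nat.mod_eq_of_lt (by omega)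
    obtain ⟨hax, -, -, hab⟩ := hq i hi
    refine ⟨by simp [Expr.eval, hv, h16, hi], ?_⟩
    refine .step <| .step <| .step <| .atom
      ⟨Function.update v 12 (i + 1), t + 17, by simp, fun x hx => by simp [hx, hf x hx], ?_, ?_⟩
    · omega
    · rw [List.take_succ_eq_append_getElem hi]
      simp [Atom.step, State.charge, Expr.eval, hv, h11, hax, hab, a1, a2, hc, Expr.cost, e1,
        -List.map_take, -List.take_append_getElem]
      rfl
  · rintro _ ⟨v, t, hv, hf, ht, rfl⟩
    simp [Expr.eval, hv, hf, h16]
  · refine ⟨Function.update σ.var 12 0, σ.time + 2, by simp, fun x hx => by simp [hx], le_rfl, ?_⟩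
    simp [Atom.step, Expr.eval, Expr.cost]
  · rintro _ ⟨v, t, hv, hf, ht, rfl⟩
    refine ⟨v, t + 4, hf, by omega, ?_⟩
    rw [List.take_length]
    rfl

/-- The effect of `output e`, where `sel i` tells whether `e` is not zero in round `i`. -/
theorem runs_output {σ : State n} {q : List Node} {e : Expr} {sel : ℕ → Prop}
    (hq : Holds σ.arr q) (h16 : σ.var 16 = q.length) (hcost : e.cost ≤ 10)
    (he : ∀ v t o i, i < q.length → v 12 = i → (∀ x, x ≠ 12 → v x = σ.var x) →
      (e.eval W (T σ.table) { σ with var := v, time := t, out := o } ≠ 0 ↔ sel i))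
    (hW : q.length + 2 < W) :
    Runs S₁ S₂ T W (output e) σ fun τ => ∃ v t o,
      (∀ b y, y ∈ o b ↔ y ∈ σ.out b ∨ ∃ i, ∃ h : i < q.length, sel i ∧ q[i].x = y.val ∧
        (b = true ↔ q[i].b ≠ 0)) ∧
      t ≤ σ.time + 50 * q.length + 10 ∧
      τ = { σ with
        var := v
        out := o
        time := t } := by
  have e1 : 1 % W = 1 := Nat.mod_eq_of_lt (by omega)
  have hitem : ∀ (x : ℕ) (y : Fin n), y ∈ itemSet n x ↔ x = y.val := by
    intro x y
    unfold itemSet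
    split_ifs with hx
    · simp only [Finset.mem_singleton, Fin.ext_iff, eq_comm]
    · simp only [Finset.notMem_empty, false_iff]
      rintro rfl
      exact hx y.isLt
  refine .step ?_
  refine Runs.rounds (fun i τ => ∃ v t o, v 12 = i ∧
      (∀ b y, y ∈ o b ↔ y ∈ σ.out b ∨ ∃ j, ∃ h : j < q.length, j < i ∧ sel j ∧ q[j].x = y.val ∧
        (b = true ↔ q[j].b ≠ 0)) ∧
      (∀ x, x ≠ 12 → v x = σ.var x) ∧ t ≤ σ.time + 50 * i + 2 ∧
      τ = { σ with
        var := v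
        out := o
        time := t }) q.length ?_ ?_ ?_ ?_
  · rintro i hi _ ⟨v, t, o, hv, ho, hf, ht, rfl⟩
    have h16 : v 16 = q.length := by rw [hf 16 (by decide), h16]
    have a1 : (i + 1) % W = i + 1 := Nat.mod_eq_of_lt (by omega)
    obtain ⟨hax, -, -, hab⟩ := hq i hi
    refine ⟨by simp [Expr.eval, hv, h16, hi], ?_⟩
    have hstep : ∀ (b : Bool) (y : Fin n), (∃ j, ∃ h : j < q.length, j < i + 1 ∧ sel j ∧
        q[j].x = y.val ∧ (b = true ↔ q[j].b ≠ 0)) ↔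
        (∃ j, ∃ h : j < q.length, j < i ∧ sel j ∧ q[j].x = y.val ∧ (b = true ↔ q[j].b ≠ 0)) ∨
        (sel i ∧ q[i].x = y.val ∧ (b = true ↔ q[i].b ≠ 0)) := by
      intro b y
      constructor
      · rintro ⟨j, h, hj, h'⟩
        rcases Nat.lt_succ_iff_lt_or_eq.1 hj with hj | rfl
        · exact .inl ⟨j, h, hj, h'⟩
        · exact .inr h'
      · rintro (⟨j, h, hj, h'⟩ | h')
        · exact ⟨j, h, by omega, h'⟩
        · exact ⟨i, hi, by omega, h'⟩
    refine .seq <| .ite (fun h => ?_) (fun h => ?_)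
    · have hs := (he _ _ _ i hi hv hf).1 h
      refine .ite (fun h => ?_) (fun h => ?_)
      · have hb : q[i].b ≠ 0 := by simpa [Expr.eval, State.charge, hv, hab] using h
        refine .atom <| .atom ⟨Function.update v 12 (i + 1), t + e.cost + 15,
          Function.update o true (o true ∪ itemSet n q[i].x), by simp, ?_,
          fun x hx => by simp [hx, hf x hx], ?_, ?_⟩
        rotate_right
        · simp [Atom.step, State.charge, Expr.eval, hv, hax, e1, a1, Expr.cost]
          omega
        · intro b y
          rw [hstep]
          cases b <;> simp [ho, hb, hs, hitem, or_assoc]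
        · omega
      · have hb : q[i].b = 0 := by simpa [Expr.eval, State.charge, hv, hab] using h
        refine .atom <| .atom ⟨Function.update v 12 (i + 1), t + e.cost + 15,
          Function.update o false (o false ∪ itemSet n q[i].x), by simp, ?_,
          fun x hx => by simp [hx, hf x hx], ?_, ?_⟩
        rotate_right
        · simp [Atom.step, State.charge, Expr.eval, hv, hax, e1, a1, Expr.cost]
          omega
        · intro b y
          rw [hstep]
          cases b <;> simp [ho, hb, hs, hitem, or_assoc]
        · omega
    · have hs := mt (he _ _ _ i hi hv hf).2 (not_not.2 h)
      refine runs_skip <| .atom ⟨Function.update v 12 (i + 1), t + e.cost + 11, o, by simp, ?_,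
          fun x hx => by simp [hx, hf x hx], ?_, ?_⟩
      rotate_right
      · simp [Atom.step, State.charge, Expr.eval, hv, e1, a1, Expr.cost]
        omega
      · intro b y
        rw [hstep]
        simp [ho, hs]
      · omega
  · rintro _ ⟨v, t, o, hv, ho, hf, ht, rfl⟩
    simp [Expr.eval, hv, hf, h16]
  · refine ⟨Function.update σ.var 12 0, σ.time + 2, σ.out, by simp, by simp,
      fun x hx => by simp [hx], le_rfl, ?_⟩
    simp [Atom.step, Expr.eval, Expr.cost]
  · rintro _ ⟨v, t, o, hv, ho, hf, ht, rfl⟩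
    refine ⟨v, _, o, ?_, ?_, rfl⟩
    · intro b y
      rw [ho]
      refine or_congr_right (exists_congr fun j => exists_congr fun h => ?_)
      simp [h]
    · simp [Expr.cost]; omega

end Specs

/-! ### Parameters -/

/-- The least `L` with `n ≤ 2 ^ L * s`. -/
noncomputable def doublings (s n : ℕ) : ℕ := sInf {L | n ≤ 2 ^ L * s}

theorem le_doublings {s : ℕ} (hs : 1 ≤ s) (n : ℕ) : n ≤ 2 ^ doublings s n * s :=
  Nat.sInf_mem (s := {L | n ≤ 2 ^ L * s})
    ⟨n, n.lt_two_pow_self.le.trans (Nat.le_mul_of_pos_right _ hs)⟩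

theorem lt_of_lt_doublings {s n i : ℕ} (h : i < doublings s n) : 2 ^ i * s < n :=
  not_le.1 (Nat.notMem_of_lt_sInf (s := {L | n ≤ 2 ^ L * s}) h)

theorem two_pow_doublings_mul_le {s n i : ℕ} (hsn : s ≤ n) (h : i ≤ doublings s n) :
    2 ^ i * s ≤ 2 * n := by
  rcases Nat.eq_zero_or_pos i with rfl | hi
  · omega
  · have := lt_of_lt_doublings (s := s) (n := n) (i := i - 1) (by omega)
    obtain ⟨j, rfl⟩ : ∃ j, i = j + 1 := ⟨i - 1, by omega⟩
    rw [Nat.add_sub_cancel] at this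
    rw [pow_succ]
    linarith

theorem doublings_le {s n : ℕ} (hs : 1 ≤ s) : doublings s n ≤ n :=
  Nat.sInf_le (s := {L | n ≤ 2 ^ L * s})
    (n.lt_two_pow_self.le.trans (Nat.le_mul_of_pos_right _ hs))

/-- The number of levels of the splitting tree: blocks are halved until they are single items, and
then tested on as many further levels as there are doublings from `1` to `γ * n`. -/
noncomputable def levels (γ n s : ℕ) : ℕ := doublings s n + doublings 1 (γ * n)

/-- The number of splitting pools: `4 * s` on each level. -/
noncomputable def splitPools (γ n s : ℕ) : ℕ := levels γ n s * (4 * s)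

/-- The number of trials: each succeeds with probability at least `min s₁ s₂ / (128 * max s₁ s₂)`,
so that `ρ` controls the probability that all of them fail. -/
def trials (ρ s₁ s₂ : ℕ) : ℕ := ρ * (max s₁ s₂ / min s₁ s₂ + 1)

/-- Compute the parameters: the block length on level zero, by doubling, the number of levels, and
the numbers of splitting pools and of trials. -/
def setup (ρ γ : ℕ) : Program :=
  .ite (.lt (.var 1) (.var 2)) (set 3 (.var 2) ;; set 20 (.var 1))
    (set 3 (.var 1) ;; set 20 (.var 2)) ;;
  set 4 (.mul (.lit 4) (.var 3)) ;;
  set 7 (.lit 1) ;;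
  .loop (.lt (.mul (.var 7) (.var 3)) (.var 0)) (
    set 7 (.mul (.var 7) (.lit 2)) ;; set 5 (.add (.var 5) (.lit 1))) ;;
  set 19 (.lit 1) ;;
  .loop (.lt (.var 19) (.mul (.lit γ) (.var 0))) (
    set 19 (.mul (.var 19) (.lit 2)) ;; set 5 (.add (.var 5) (.lit 1))) ;;
  set 8 (.mul (.var 5) (.var 4)) ;;
  set 6 (.mul (.lit ρ) (.add (.div (.var 3) (.var 20)) (.lit 1)))

section Specs

variable {n N : ℕ} {S₁ S₂ : Finset (Fin n)} {T : ℕ → PoolTable n N} {W : ℕ}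

theorem runs_setup {ρ γ s₁ s₂ : ℕ} (h1 : 1 ≤ s₁) (h2 : 1 ≤ s₂) (hn : s₁ + s₂ ≤ n)
    (hW1 : 4 * n + 5 < W) (hW2 : 2 * (γ * n) + γ + 5 < W) (hρ : ρ < W)
    (hΛ : levels γ n (max s₁ s₂) + 1 < W) (hV : splitPools γ n (max s₁ s₂) < W)
    (hR : trials ρ s₁ s₂ < W) :
    Runs S₁ S₂ T W (setup ρ γ) (State.init n s₁ s₂) fun τ => ∃ v t,
      v 0 = n ∧ v 3 = max s₁ s₂ ∧ v 5 = levels γ n (max s₁ s₂) ∧ v 6 = trials ρ s₁ s₂ ∧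
      v 7 = 2 ^ doublings (max s₁ s₂) n ∧ v 8 = splitPools γ n (max s₁ s₂) ∧ v 10 = 0 ∧
      t ≤ 50 * levels γ n (max s₁ s₂) + 100 ∧
      τ = { State.init n s₁ s₂ with
        var := v
        time := t } := by
  set s := max s₁ s₂ with hs
  set m := min s₁ s₂ with hm
  have hs1 : 1 ≤ s := le_max_of_le_left h1
  have hsn : s ≤ n := by omega
  have e1 : 1 % W = 1 := Nat.mod_eq_of_lt (by omega)
  have e2 : 2 % W = 2 := Nat.mod_eq_of_lt (by omega)
  have e4 : 4 % W = 4 := Nat.mod_eq_of_lt (by omega)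
  have eγ : γ % W = γ := Nat.mod_eq_of_lt (by omega)
  have eρ : ρ % W = ρ := Nat.mod_eq_of_lt (by omega)
  have eγn : (γ * n) % W = γ * n := Nat.mod_eq_of_lt (by omega)
  have e4s : (4 * s) % W = 4 * s := Nat.mod_eq_of_lt (by omega)
  -- the state after the first branching
  suffices H : ∀ σ : State n, (∃ v t, v 0 = n ∧ v 3 = s ∧ v 20 = m ∧ v 5 = 0 ∧ v 10 = 0 ∧ t ≤ 20 ∧
      σ = { State.init n s₁ s₂ with
        var := v
        time := t }) →
      Runs S₁ S₂ T W (set 4 (.mul (.lit 4) (.var 3)) ;;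
        set 7 (.lit 1) ;;
        .loop (.lt (.mul (.var 7) (.var 3)) (.var 0)) (
          set 7 (.mul (.var 7) (.lit 2)) ;; set 5 (.add (.var 5) (.lit 1))) ;;
        set 19 (.lit 1) ;;
        .loop (.lt (.var 19) (.mul (.lit γ) (.var 0))) (
          set 19 (.mul (.var 19) (.lit 2)) ;; set 5 (.add (.var 5) (.lit 1))) ;;
        set 8 (.mul (.var 5) (.var 4)) ;;
        set 6 (.mul (.lit ρ) (.add (.div (.var 3) (.var 20)) (.lit 1)))) σ fun τ => ∃ v t,
      v 0 = n ∧ v 3 = max s₁ s₂ ∧ v 5 = levels γ n (max s₁ s₂) ∧ v 6 = trials ρ s₁ s₂ ∧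
      v 7 = 2 ^ doublings (max s₁ s₂) n ∧ v 8 = splitPools γ n (max s₁ s₂) ∧ v 10 = 0 ∧
      t ≤ 50 * levels γ n (max s₁ s₂) + 100 ∧
      τ = { State.init n s₁ s₂ with
        var := v
        time := t } by
    refine .seq <| .ite (fun h => ?_) (fun h => ?_)
    · have hlt : s₁ < s₂ := by
        by_contra hc
        simp [Expr.eval, State.init, hc] at h
      refine .step <| .atom <| H _ ⟨_, _, ?_, ?_, ?_, ?_, ?_, ?_, rfl⟩ <;>
        simp [Atom.step, State.charge, State.init, Expr.eval, Expr.cost, hs, hm, hlt.le]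
    · have hlt : s₂ ≤ s₁ := by
        by_contra hc
        simp [Expr.eval, State.init, not_le.1 hc] at h
      refine .step <| .atom <| H _ ⟨_, _, ?_, ?_, ?_, ?_, ?_, ?_, rfl⟩ <;>
        simp [Atom.step, State.charge, State.init, Expr.eval, Expr.cost, hs, hm, hlt]
  rintro _ ⟨v₀, t₀, v0, v3, v20, v5, v10, ht₀, rfl⟩
  refine .step <| .step <| .seq ?_
  refine Runs.rounds (fun i τ => ∃ v t, v 0 = n ∧ v 3 = s ∧ v 4 = 4 * s ∧ v 20 = m ∧ v 10 = 0 ∧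
      v 5 = i ∧ v 7 = 2 ^ i ∧ t ≤ 40 + 30 * i ∧
      τ = { State.init n s₁ s₂ with
        var := v
        time := t }) (doublings s n) ?_ ?_ ?_ ?_
  · rintro i hi _ ⟨v, t, v0, v3, v4, v20, v10, v5, v7, ht, rfl⟩
    have hlt := lt_of_lt_doublings hi
    have hle : 2 ^ i ≤ 2 ^ i * s := Nat.le_mul_of_pos_right _ hs1
    have a1 : (2 ^ i * s) % W = 2 ^ i * s := Nat.mod_eq_of_lt (by omega)
    have a2 : (2 ^ i * 2) % W = 2 ^ i * 2 := Nat.mod_eq_of_lt (by omega)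
    have hi' : i < 2 ^ i := i.lt_two_pow_self
    have a3 : (i + 1) % W = i + 1 := Nat.mod_eq_of_lt (by omega)
    refine ⟨by simp [Expr.eval, v7, v3, v0, a1, hlt], ?_⟩
    refine .step <| .atom ⟨_, _, ?_, ?_, ?_, ?_, ?_, ?_, ?_, ?_, rfl⟩ <;>
      simp [Atom.step, State.charge, Expr.eval, v0, v3, v4, v20, v10, v5, v7, e1, e2, a2, a3,
        Expr.cost, pow_succ]
    omega
  · rintro _ ⟨v, t, v0, v3, v4, v20, v10, v5, v7, ht, rfl⟩
    have hle := two_pow_doublings_mul_le hsn le_rfl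
    have a1 : (2 ^ doublings s n * s) % W = 2 ^ doublings s n * s := Nat.mod_eq_of_lt (by omega)
    simp [Expr.eval, v7, v3, v0, a1, le_doublings hs1 n]
  · refine ⟨_, _, ?_, ?_, ?_, ?_, ?_, ?_, ?_, ?_, rfl⟩ <;>
      simp [Atom.step, Expr.eval, v0, v3, v20, v10, v5, e1, e4, e4s, Expr.cost]
    omega
  clear! v₀ t₀
  rintro _ ⟨v₀, t₀, v0, v3, v4, v20, v10, v5, v7, ht₀, rfl⟩
  refine .step <| .seq ?_
  refine Runs.rounds (fun i τ => ∃ v t, v 0 = n ∧ v 3 = s ∧ v 4 = 4 * s ∧ v 20 = m ∧ v 10 = 0 ∧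
      v 5 = doublings s n + i ∧ v 7 = 2 ^ doublings s n ∧ v 19 = 2 ^ i ∧
      t ≤ 50 + 30 * (doublings s n + i) ∧
      τ = { State.init n s₁ s₂ with
        var := v
        time := t }) (doublings 1 (γ * n)) ?_ ?_ ?_ ?_
  · rintro i hi _ ⟨v, t, v0, v3, v4, v20, v10, v5, v7, v19, ht, rfl⟩
    have hlt := lt_of_lt_doublings hi
    rw [mul_one] at hlt
    have a2 : (2 ^ i * 2) % W = 2 ^ i * 2 := Nat.mod_eq_of_lt (by omega)
    unfold levels at hΛ
    have a3 : (doublings s n + i + 1) % W = doublings s n + i + 1 := Nat.mod_eq_of_lt (by omega)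
    refine ⟨by simp [Expr.eval, v19, v0, eγ, eγn, hlt], ?_⟩
    refine .step <| .atom ⟨_, _, ?_, ?_, ?_, ?_, ?_, ?_, ?_, ?_, ?_, rfl⟩ <;>
      simp [Atom.step, State.charge, Expr.eval, v0, v3, v4, v20, v10, v5, v7, v19, e1, e2, a2, a3,
        Expr.cost, pow_succ] <;> omega
  · rintro _ ⟨v, t, v0, v3, v4, v20, v10, v5, v7, v19, ht, rfl⟩
    have := le_doublings le_rfl (γ * n)
    rw [mul_one] at this
    simp [Expr.eval, v19, v0, eγ, eγn, this]
  · refine ⟨_, _, ?_, ?_, ?_, ?_, ?_, ?_, ?_, ?_, ?_, rfl⟩ <;>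
      simp [State.charge, Expr.eval, v0, v3, v4, v20, v10, v5, v7, e1, Expr.cost]
    omega
  clear! v₀ t₀
  rintro _ ⟨v, t, v0, v3, v4, v20, v10, v5, v7, v19, ht, rfl⟩
  have a1 : (levels γ n s * (4 * s)) % W = levels γ n s * (4 * s) := Nat.mod_eq_of_lt hV
  have hdiv := Nat.div_le_self s m
  have a2 : (s / m + 1) % W = s / m + 1 := Nat.mod_eq_of_lt (by omega)
  have a3 : (ρ * (s / m + 1)) % W = ρ * (s / m + 1) := Nat.mod_eq_of_lt hR
  change v 5 = levels γ n s at v5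
  change t ≤ 50 + 30 * levels γ n s at ht
  refine .step <| .atom ⟨_, _, ?_, ?_, ?_, ?_, ?_, ?_, ?_, ?_, rfl⟩ <;>
    simp [Atom.step, State.charge, Expr.eval, v0, v3, v4, v20, v10, v5, v7, e1, eρ, a1, a2, a3,
      Expr.cost, trials, splitPools, ← hs, ← hm]
  omega

end Specs

/-! ### Random tables -/

/-- The length of the blocks on level `l`, for blocks of length `2 ^ k` on level zero. -/
def blk (k l : ℕ) : ℕ := 2 ^ (k - l)

theorem blk_pos (k l : ℕ) : 0 < blk k l := by unfold blk; positivity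

/-- The first item in the block of `x` on level `l`. -/
def blockStart {n : ℕ} (k l : ℕ) (x : Fin n) : Fin n :=
  ⟨x / blk k l * blk k l, (Nat.div_mul_le_self _ _).trans_lt x.isLt⟩

/-- The random choices: on each of `Λ` levels a random function to `M` pools, and in each of `R`
trials a random function to `m` values. -/
abbrev Seed (n Λ M R m : ℕ) : Type := (Fin Λ → Fin n → Fin M) × (Fin R → Fin n → Fin m)

/-- The pool table: the first `Λ * M` pools consist of the blocks of the respective level with the
respective value, the others, two for each trial, of the items with the values `0` and `1`. -/
def tableOf {n Λ M R m : ℕ} (k : ℕ) (ω : Seed n Λ M R m) : PoolTable n (Λ * M + 2 * R) := fun p =>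
  Finset.univ.filter fun x =>
    if h : p.val < Λ * M then
      (ω.1 ⟨p / M, Nat.div_lt_of_lt_mul (h.trans_eq (mul_comm _ _))⟩ (blockStart k (p / M + 1) x)).val
        = p % M
    else (ω.2 ⟨(p - Λ * M) / 2, by have := p.isLt; omega⟩ x).val = (p - Λ * M) % 2

section Table

variable {n Λ M R m k : ℕ} {ω : Seed n Λ M R m}

theorem mem_row_split {l : ℕ} (hl : l < Λ) {b : ℕ} (hb : b < M) (x : Fin n) :
    x ∈ (tableOf k ω).row (l * M + b) ↔ (ω.1 ⟨l, hl⟩ (blockStart k (l + 1) x)).val = b := by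
  have h : l * M + b < Λ * M := by
    calc l * M + b < l * M + M := by omega
      _ = (l + 1) * M := by ring
      _ ≤ Λ * M := Nat.mul_le_mul_right _ hl
  have hd : (l * M + b) / M = l := by
    rw [mul_comm, Nat.mul_add_div (by omega), Nat.div_eq_of_lt hb, add_zero]
  have hm : (l * M + b) % M = b := by
    rw [mul_comm, Nat.mul_add_mod, Nat.mod_eq_of_lt hb]
  rw [PoolTable.row, dif_pos (by omega)]
  simp only [tableOf, Finset.mem_filter, Finset.mem_univ, true_and, dif_pos h, hm]
  simp only [hd]

theorem mem_row_trial {r : ℕ} (hr : r < R) {b : ℕ} (hb : b < 2) (x : Fin n) :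
    x ∈ (tableOf k ω).row (Λ * M + 2 * r + b) ↔ (ω.2 ⟨r, hr⟩ x).val = b := by
  have hd : (Λ * M + 2 * r + b - Λ * M) / 2 = r := by omega
  have hm : (Λ * M + 2 * r + b - Λ * M) % 2 = b := by omega
  rw [PoolTable.row, dif_pos (by omega)]
  simp only [tableOf, Finset.mem_filter, Finset.mem_univ, true_and,
    dif_neg (show ¬ (Λ * M + 2 * r + b < Λ * M) by omega), hm]
  simp only [hd]

theorem has_iff_mem_row {N : ℕ} (L : PoolTable n N) (p : ℕ) (x : Fin n) :
    L.Has p x ↔ x ∈ L.row p := by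
  unfold PoolTable.Has PoolTable.row
  constructor
  · rintro ⟨hp, hx, h⟩
    rwa [dif_pos hp]
  · intro h
    split_ifs at h with hp
    · exact ⟨hp, x.isLt, h⟩
    · simp at h

open Classical in
/-- On each level, an item is contained in exactly one pool, so its pools enumerate the levels. -/
theorem nth_has {l : ℕ} (hl : l < Λ) (x : Fin n) :
    Nat.nth (fun p => (tableOf k ω).Has p x) l =
      l * M + ω.1 ⟨l, hl⟩ (blockStart k (l + 1) x) := by
  set P := fun p => (tableOf k ω).Has p x with hP
  have hiff : ∀ {l : ℕ} (hl : l < Λ) {b : ℕ}, b < M →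
      (P (l * M + b) ↔ b = ω.1 ⟨l, hl⟩ (blockStart k (l + 1) x)) := by
    intro l hl b hb
    change (tableOf k ω).Has _ x ↔ _
    rw [has_iff_mem_row, mem_row_split hl hb, eq_comm]
  have hlt : ∀ {l : ℕ} (hl : l < Λ) {j : ℕ}, j ≤ M →
      Nat.count (fun b => P (l * M + b)) j =
        if (ω.1 ⟨l, hl⟩ (blockStart k (l + 1) x)).val < j then 1 else 0 := by
    intro l hl j
    induction j with
    | zero => simp
    | succ j ih =>
      intro hj
      rw [Nat.count_succ, ih (by omega)]
      have := hiff hl (b := j) (by omega)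
      simp only [this]
      split_ifs <;> omega
  have hcount : ∀ l ≤ Λ, Nat.count P (l * M) = l := by
    intro l
    induction l with
    | zero => simp
    | succ l ih =>
      intro hl
      rw [Nat.succ_mul, Nat.count_add, ih (by omega), hlt (by omega) le_rfl, if_pos (Fin.isLt _)]
  have h1 : Nat.count P (l * M + ω.1 ⟨l, hl⟩ (blockStart k (l + 1) x)) = l := by
    rw [Nat.count_add, hcount l hl.le, hlt hl (Fin.isLt _).le, if_neg (lt_irrefl _), add_zero]
  have h2 : P (l * M + ω.1 ⟨l, hl⟩ (blockStart k (l + 1) x)) := (hiff hl (Fin.isLt _)).2 rfl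
  have := Nat.nth_count h2
  rwa [h1] at this

end Table

/-- A table whose first `V` pools serve for splitting: the `l`-th pool of an item is one of them and
contains its whole block on level `l + 1`. -/
structure Splits {n N : ℕ} (L : PoolTable n N) (k Λ V : ℕ) : Prop where
  nth_lt : ∀ (x : Fin n) (l : ℕ), l < Λ → Nat.nth (fun p => L.Has p x) l < V
  mem : ∀ (x d : Fin n) (l : ℕ), l < Λ → d.val / blk k (l + 1) = x.val / blk k (l + 1) →
    d ∈ L.row (Nat.nth (fun p => L.Has p x) l)

theorem splits_tableOf {n Λ M R m : ℕ} (k : ℕ) (ω : Seed n Λ M R m) :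
    Splits (tableOf k ω) k Λ (Λ * M) where
  nth_lt x l hl := by
    rw [nth_has hl]
    calc l * M + _ < l * M + M := Nat.add_lt_add_left (Fin.isLt _) _
      _ = (l + 1) * M := by ring
      _ ≤ Λ * M := Nat.mul_le_mul_right _ hl
  mem x d l hl h := by
    rw [nth_has hl, mem_row_split hl (Fin.isLt _)]
    have : blockStart k (l + 1) d = blockStart k (l + 1) x := Fin.ext (by simp [blockStart, h])
    rw [this]

/-! ### From test outcomes to the hidden sets -/

/-- The hidden sets in the order of the tags. -/
def tagged {n : ℕ} (A B : Finset (Fin n)) (b : ℕ) : Finset (Fin n) := if b = 0 then A else B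

/-- If two sets test negative and their union tests positive, then each of them meets exactly one of
the two hidden sets, and so a test of any set `X` united with one of them tells whether `X` meets
the other hidden set. -/
theorem exists_tagged {n : ℕ} {S₁ S₂ : Finset (Fin n)} {A : ℕ → Finset (Fin n)}
    (h0 : testOutcome S₁ S₂ (A 0) = false) (h1 : testOutcome S₁ S₂ (A 1) = false)
    (h : testOutcome S₁ S₂ (A 0 ∪ A 1) = true) :
    ∃ D, (D = tagged S₁ S₂ ∨ D = tagged S₂ S₁) ∧
      ∀ b ≤ 1, ∀ X, testOutcome S₁ S₂ (X ∪ A b) = decide ((X ∩ D b).Nonempty) := by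
  simp only [testOutcome, decide_eq_false_iff_not, decide_eq_true_eq, Finset.union_inter_distrib_right,
    Finset.union_nonempty, not_and_or] at h0 h1 h
  have key : ((A 0 ∩ S₁).Nonempty ∧ ¬ (A 0 ∩ S₂).Nonempty ∧ ¬ (A 1 ∩ S₁).Nonempty ∧
      (A 1 ∩ S₂).Nonempty) ∨ ((A 0 ∩ S₂).Nonempty ∧ ¬ (A 0 ∩ S₁).Nonempty ∧
      ¬ (A 1 ∩ S₂).Nonempty ∧ (A 1 ∩ S₁).Nonempty) := by tauto
  rcases key with ⟨a, b, c, d⟩ | ⟨a, b, c, d⟩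
  · refine ⟨tagged S₂ S₁, .inr rfl, fun t ht X => ?_⟩
    rcases Nat.le_one_iff_eq_zero_or_eq_one.1 ht with rfl | rfl <;>
      simp [testOutcome, Finset.union_inter_distrib_right, Finset.union_nonempty, tagged, a, b, c, d]
  · refine ⟨tagged S₁ S₂, .inl rfl, fun t ht X => ?_⟩
    rcases Nat.le_one_iff_eq_zero_or_eq_one.1 ht with rfl | rfl <;>
      simp [testOutcome, Finset.union_inter_distrib_right, Finset.union_nonempty, tagged, a, b, c, d]

/-- Whether the `l`-th pool of `x` meets the hidden set with tag `b`. -/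
noncomputable def hit {n N : ℕ} (L : PoolTable n N) (D : ℕ → Finset (Fin n)) (x l b : ℕ) : Bool :=
  decide ((L.row (Nat.nth (fun p => L.Has p x) l) ∩ D b).Nonempty)

theorem cand_congr {n Λ w : ℕ} {pos pos' : ℕ → ℕ → ℕ → Bool}
    (h : ∀ x < n, ∀ l < Λ, ∀ b ≤ 1, pos x l b = pos' x l b) (l : ℕ) :
    cand pos n Λ w l = cand pos' n Λ w l := by
  induction l with
  | zero => rfl
  | succ l ih =>
    rw [cand, cand, ← ih]
    refine List.flatMap_congr fun u hu => ?_
    obtain ⟨hx, hw, hb⟩ := bounds_of_mem_cand hu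
    unfold Node.children
    by_cases h1 : u.l < Λ
    · by_cases h2 : 0 < u.w / 2 ∧ u.x + u.w / 2 < n
      · rw [h _ hx _ h1 _ hb, h _ h2.2 _ h1 _ hb]
      · rw [h _ hx _ h1 _ hb, if_neg h2, if_neg h2]
    · rw [if_neg h1, if_neg h1]

theorem allCand_congr {n Λ w : ℕ} {pos pos' : ℕ → ℕ → ℕ → Bool}
    (h : ∀ x < n, ∀ l < Λ, ∀ b ≤ 1, pos x l b = pos' x l b) :
    allCand pos n Λ w = allCand pos' n Λ w :=
  List.flatMap_congr fun l _ => cand_congr h l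

theorem posOf_eq_hit {n N : ℕ} {L : PoolTable n N} {D : ℕ → Finset (Fin n)} {k Λ V W base : ℕ}
    {res : List Bool} (hL : Splits L k Λ V)
    (hres : ∀ b ≤ 1, ∀ p < V,
      res.getD (base + (b * V + p)) false = decide ((L.row p ∩ D b).Nonempty))
    (hW : base + 2 * V < W) (x : ℕ) (hx : x < n) (l : ℕ) (hl : l < Λ) (b : ℕ) (hb : b ≤ 1) :
    posOf L res W V base x l b = hit L D x l b := by
  have h1 := hL.nth_lt ⟨x, hx⟩ l hl
  have h2 : b * V ≤ V := by
    rcases Nat.le_one_iff_eq_zero_or_eq_one.1 hb with rfl | rfl <;> simp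
  simp only [posOf, hit]
  simp only [] at h1
  rw [Nat.mod_eq_of_lt (show b * V < W by omega),
    Nat.mod_eq_of_lt (show Nat.nth (fun p => L.Has p x) l < W by omega),
    Nat.mod_eq_of_lt (show b * V + Nat.nth (fun p => L.Has p x) l < W by omega),
    Nat.mod_eq_of_lt (by omega), hres b hb _ h1]

/-! ### The search tree contains the hidden sets -/

theorem blk_eq {k l : ℕ} (h : l < k) : blk k l = 2 * blk k (l + 1) := by
  unfold blk
  rw [← pow_succ']
  congr 1
  omega

theorem blk_of_le {k l : ℕ} (h : k ≤ l) : blk k l = 1 := by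
  unfold blk
  rw [Nat.sub_eq_zero_of_le h, pow_zero]

theorem two_pow_div_of_le {k l : ℕ} (h : l ≤ k) : 2 ^ k / 2 ^ l = blk k l := by
  rw [Nat.pow_div h (by norm_num), blk]

theorem two_pow_div_of_lt {k l : ℕ} (h : k < l) : 2 ^ k / 2 ^ l = 0 :=
  Nat.div_eq_of_lt (Nat.pow_lt_pow_right (by norm_num) h)

/-- Nodes are aligned blocks whose length is determined by the level. -/
theorem shape_of_mem_cand {pos : ℕ → ℕ → ℕ → Bool} {n Λ k l : ℕ} :
    ∀ {u : Node}, u ∈ cand pos n Λ (2 ^ k) l → u.w = 2 ^ k / 2 ^ l ∧ blk k l ∣ u.x := by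
  induction l with
  | zero =>
    intro u hu
    obtain ⟨j, hj, hu⟩ := List.mem_flatMap.1 hu
    simp only [rootPair, List.mem_cons, List.not_mem_nil, or_false] at hu
    rcases hu with rfl | rfl <;> simp [blk]
  | succ l ih =>
    intro u hu
    obtain ⟨u', h₁, h₂⟩ := List.mem_flatMap.1 hu
    obtain ⟨hw, hx⟩ := ih h₁
    have hw' : u'.w / 2 = 2 ^ k / 2 ^ (l + 1) := by
      rw [hw, pow_succ, Nat.div_div_eq_div_mul]
    have hx' : blk k (l + 1) ∣ u'.x := by
      rcases lt_or_ge l k with h | h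
      · rw [blk_eq h] at hx
        exact (dvd_mul_left _ _).trans hx
      · rw [blk_of_le (by omega)]
        exact one_dvd _
    have hx'' : blk k (l + 1) ∣ u'.x + u'.w / 2 := by
      refine dvd_add hx' ?_
      rw [hw']
      rcases lt_or_ge l k with h | h
      · rw [two_pow_div_of_le h]
      · rw [two_pow_div_of_lt (by omega)]
        exact dvd_zero _
    unfold Node.children at h₂
    split_ifs at h₂ <;> simp at h₂ <;> try rcases h₂ with rfl | rfl
    all_goals first | exact ⟨hw', hx'⟩ | exact ⟨hw', hx''⟩

/-- Every hidden item lies in the block of a candidate on each level: there are no false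
negatives. -/
theorem exists_cand {n N : ℕ} {L : PoolTable n N} {D : ℕ → Finset (Fin n)} {k Λ V : ℕ}
    (hL : Splits L k Λ V) {b : ℕ} (hb : b ≤ 1) {d : Fin n} (hd : d ∈ D b) {l : ℕ} (hl : l ≤ Λ) :
    ∃ u ∈ cand (hit L D) n Λ (2 ^ k) l, u.b = b ∧ u.x / blk k l = d.val / blk k l := by
  induction l with
  | zero =>
    have hw : 0 < 2 ^ k := by positivity
    refine ⟨⟨d / 2 ^ k * 2 ^ k, 0, 2 ^ k, b⟩, ?_, rfl, ?_⟩
    · refine List.mem_flatMap.2 ⟨d / 2 ^ k, List.mem_range.2 ?_, ?_⟩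
      · exact (lt_ceil_iff hw).2 ((Nat.div_mul_le_self _ _).trans_lt d.isLt)
      · rcases Nat.le_one_iff_eq_zero_or_eq_one.1 hb with rfl | rfl <;> simp [rootPair]
    · simp [blk, Nat.mul_div_cancel _ hw]
  | succ l ih =>
    obtain ⟨u, hu, hub, hux⟩ := ih (by omega)
    obtain ⟨hw, c, hc⟩ := shape_of_mem_cand hu
    have hul := l_of_mem_cand hu
    obtain ⟨hxn, -, -⟩ := bounds_of_mem_cand hu
    have hw' : u.w / 2 = 2 ^ k / 2 ^ (l + 1) := by
      rw [hw, pow_succ, Nat.div_div_eq_div_mul]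
    have hhit : ∀ y (hy : y < n), y / blk k (l + 1) = d.val / blk k (l + 1) →
        hit L D y l b = true := by
      intro y hy h
      simp only [hit, decide_eq_true_eq]
      exact ⟨d, Finset.mem_inter.2 ⟨hL.mem ⟨y, hy⟩ d l (by omega) h.symm, hd⟩⟩
    rw [cand]
    rcases lt_or_ge l k with h | h
    · rw [two_pow_div_of_le h] at hw'
      have hB := blk_pos k (l + 1)
      have hBe := blk_eq h
      have hmul : 2 * blk k (l + 1) * c = blk k (l + 1) * (2 * c) := by ring
      have hd1 : d.val / blk k (l + 1) / 2 = c := by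
        rw [Nat.div_div_eq_div_mul, mul_comm, ← hBe, ← hux, hc, Nat.mul_div_cancel_left _ (blk_pos _ _)]
      rw [hBe, hmul] at hc
      rcases Nat.mod_two_eq_zero_or_one (d.val / blk k (l + 1)) with h0 | h1
      · have hx : u.x / blk k (l + 1) = d.val / blk k (l + 1) := by
          rw [hc, Nat.mul_div_cancel_left _ hB]; omega
        refine ⟨⟨u.x, l + 1, u.w / 2, u.b⟩, List.mem_flatMap.2 ⟨u, hu, ?_⟩, hub, hx⟩
        unfold Node.children
        rw [if_pos (by omega), hul, hub, hhit _ hxn hx]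
        simp
      · have hx : (u.x + u.w / 2) / blk k (l + 1) = d.val / blk k (l + 1) := by
          rw [hc, hw', ← Nat.mul_succ, Nat.mul_div_cancel_left _ hB]; omega
        have hlt : u.x + u.w / 2 < n := by
          have : u.x + u.w / 2 = blk k (l + 1) * (d.val / blk k (l + 1)) := by
            rw [← hx, hc, hw', ← Nat.mul_succ, Nat.mul_div_cancel_left _ hB]
          rw [this]
          exact (Nat.mul_div_le _ _).trans_lt d.isLt
        refine ⟨⟨u.x + u.w / 2, l + 1, u.w / 2, u.b⟩, List.mem_flatMap.2 ⟨u, hu, ?_⟩, hub, hx⟩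
        unfold Node.children
        have hw'' : 0 < u.w / 2 := hB.trans_eq hw'.symm
        rw [if_pos (show u.l < Λ by omega), if_pos (And.intro hw'' hlt), hul, hub, hhit _ hlt hx]
        simp
    · have hx : u.x / blk k (l + 1) = d.val / blk k (l + 1) := by
        rw [blk_of_le h] at hux
        rw [blk_of_le (by omega), hux]
      refine ⟨⟨u.x, l + 1, u.w / 2, u.b⟩, List.mem_flatMap.2 ⟨u, hu, ?_⟩, hub, hx⟩
      unfold Node.children
      rw [if_pos (by omega), hul, hub, hhit _ hxn hx]
      simp

/-- Every hidden item is a candidate on the last level. -/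
theorem exists_leaf {n N : ℕ} {L : PoolTable n N} {D : ℕ → Finset (Fin n)} {k Λ V : ℕ}
    (hL : Splits L k Λ V) (hk : k ≤ Λ) {b : ℕ} (hb : b ≤ 1) {d : Fin n} (hd : d ∈ D b) :
    ∃ u ∈ allCand (hit L D) n Λ (2 ^ k), u.l = Λ ∧ u.b = b ∧ u.x = d.val := by
  obtain ⟨u, hu, hub, hux⟩ := exists_cand hL hb hd le_rfl
  rw [blk_of_le hk, Nat.div_one, Nat.div_one] at hux
  exact ⟨u, List.mem_flatMap.2 ⟨Λ, List.mem_range.2 (by omega), hu⟩, l_of_mem_cand hu, hub, hux⟩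

/-! ### Stages of the algorithms -/

/-- Compute the parameters and the budget `e` for the queue. -/
def prepare (ρ γ : ℕ) (e : Expr) : Program := setup ρ γ ;; set 9 e

/-- A stage that looks for a successful trial. -/
def attempt : Program := reqCheck ;; .atom .runStage ;; scan

/-- A stage that tests the splitting pools with the pools of the successful trial, and the search
for candidates. -/
def search : Program :=
  set 13 (.mul (.lit 2) (.var 8)) ;; reqSplit ;; .atom .runStage ;; set 14 (.lit 0) ;; decode

/-- A stage that tests the candidates one by one, and the output of the positive ones. -/
def verify : Program := reqItems ;; .atom .runStage ;; output (.result (.var 12))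

/-- Output of the candidates on the last level, without further tests. -/
def report : Program := output (.sub (.lit 1) (.lt (.read 1 (.var 12)) (.var 5)))

/-- The variables that hold the parameters have the right values. -/
structure Env (v : ℕ → ℕ) (n Λ w R V bud : ℕ) : Prop where
  h0 : v 0 = n
  h5 : v 5 = Λ
  h6 : v 6 = R
  h7 : v 7 = w
  h8 : v 8 = V
  h9 : v 9 = bud

theorem Env.congr {v v' : ℕ → ℕ} {n Λ w R V bud : ℕ} (h : Env v n Λ w R V bud)
    (hv : ∀ x, x < 10 → v' x = v x) : Env v' n Λ w R V bud :=
  ⟨(hv 0 (by decide)).trans h.h0, (hv 5 (by decide)).trans h.h5, (hv 6 (by decide)).trans h.h6,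
    (hv 7 (by decide)).trans h.h7, (hv 8 (by decide)).trans h.h8, (hv 9 (by decide)).trans h.h9⟩

/-- The parameters of an instance with `s₁`, `s₂` hidden items among `n` ones: blocks of length
`2 ^ k` on level zero, `Λ` levels, `V` splitting pools, `R` trials. -/
structure Params (ρ γ n s₁ s₂ s k Λ V R : ℕ) : Prop where
  one_le₁ : 1 ≤ s₁
  one_le₂ : 1 ≤ s₂
  add_le : s₁ + s₂ ≤ n
  max_eq : max s₁ s₂ = s
  doublings_eq : doublings s n = k
  levels_eq : levels γ n s = Λ
  splitPools_eq : splitPools γ n s = V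
  trials_eq : trials ρ s₁ s₂ = R

/-- All numbers that occur fit into words. -/
structure Fits (ρ γ n s Λ V R bud W : ℕ) : Prop where
  n_lt : 5 * n + 5 < W
  γ_lt : 2 * (γ * n) + γ + 5 < W
  ρ_lt : ρ < W
  levels_lt : Λ + 1 < W
  sum_lt : V + 3 * R + 2 * R * V + 2 * V + bud + 2 * s + n + 10 < W

theorem roots_length_le {s : ℕ} (hs : 1 ≤ s) (n : ℕ) :
    (roots n (2 ^ doublings s n)).length ≤ 2 * s := by
  have hw : 0 < 2 ^ doublings s n := by positivity
  have h : (n + 2 ^ doublings s n - 1) / 2 ^ doublings s n ≤ s := by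
    by_contra hc
    have := (lt_ceil_iff hw).1 (not_le.1 hc)
    have := le_doublings hs n
    rw [mul_comm] at this
    omega
  have hlen : ∀ k, ((List.range k).flatMap (rootPair (2 ^ doublings s n))).length = 2 * k := by
    intro k
    induction k with
    | zero => simp
    | succ k ih => rw [List.range_succ, List.flatMap_append]; simp [ih, rootPair]; omega
  rw [roots, hlen]
  omega

section

variable {ρ γ n s₁ s₂ s k Λ V R : ℕ}

theorem Params.one_le (hP : Params ρ γ n s₁ s₂ s k Λ V R) : 1 ≤ s :=
  hP.max_eq ▸ le_max_of_le_left hP.one_le₁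

theorem Params.le_n (hP : Params ρ γ n s₁ s₂ s k Λ V R) : s ≤ n := by
  have h1 := hP.one_le₁
  have h2 := hP.one_le₂
  have h3 := hP.add_le
  have h4 := hP.max_eq
  omega

theorem Params.k_le (hP : Params ρ γ n s₁ s₂ s k Λ V R) : k ≤ Λ := by
  rw [← hP.levels_eq, ← hP.doublings_eq]
  exact Nat.le_add_right _ _

theorem Params.roots_le (hP : Params ρ γ n s₁ s₂ s k Λ V R) : (roots n (2 ^ k)).length ≤ 2 * s :=
  hP.doublings_eq ▸ roots_length_le hP.one_le n

theorem Params.two_pow_le (hP : Params ρ γ n s₁ s₂ s k Λ V R) : 2 ^ k ≤ 2 * n := by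
  have h := two_pow_doublings_mul_le hP.le_n le_rfl
  rw [hP.doublings_eq] at h
  exact (Nat.le_mul_of_pos_right _ hP.one_le).trans h

end

/-- Trial `k` with its two pools is successful: it tells the hidden sets apart. -/
def GoodTrial {n N : ℕ} (S₁ S₂ : Finset (Fin n)) (L : PoolTable n N) (V k : ℕ) : Prop :=
  testOutcome S₁ S₂ (L.row (V + 2 * k)) = false ∧
  testOutcome S₁ S₂ (L.row (V + 2 * k + 1)) = false ∧
  testOutcome S₁ S₂ (L.row (V + 2 * k) ∪ L.row (V + 2 * k + 1)) = true

section Specs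

variable {n N : ℕ} {S₁ S₂ : Finset (Fin n)} {T : ℕ → PoolTable n N} {W : ℕ}

theorem runs_prepare {ρ γ s₁ s₂ s k Λ V R bud : ℕ} {e : Expr}
    (hP : Params ρ γ n s₁ s₂ s k Λ V R) (hW : Fits ρ γ n s Λ V R bud W) (hcost : e.cost ≤ 10)
    (he : ∀ v t, v 0 = n → v 3 = s → v 5 = Λ →
      e.eval W (T 0) { State.init n s₁ s₂ with var := v, time := t } = bud) :
    Runs S₁ S₂ T W (prepare ρ γ e) (State.init n s₁ s₂) fun τ => ∃ v t,
      Env v n Λ (2 ^ k) R V bud ∧ v 10 = 0 ∧ t ≤ 50 * Λ + 120 ∧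
      τ = { State.init n s₁ s₂ with
        var := v
        time := t } := by
  have a1 := hW.n_lt
  have a2 := hW.γ_lt
  have a3 := hW.sum_lt
  have a4 := hW.levels_lt
  have a5 := hW.ρ_lt
  obtain ⟨h1, h2, hn, rfl, rfl, rfl, rfl, rfl⟩ := hP
  refine .seq <| (runs_setup h1 h2 hn (by omega) a2 a5 a4 (by omega) (by omega)).mono ?_
  rintro _ ⟨v, t, v0, v3, v5, v6, v7, v8, v10, ht, rfl⟩
  have hev := he v t v0 v3 v5
  refine .atom ⟨_, _, ⟨?_, ?_, ?_, ?_, ?_, ?_⟩, ?_, ?_, rfl⟩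
  · simp [v0]
  · simp [v5]
  · simp [v6]
  · simp [v7]
  · simp [v8]
  · simp only [Function.update_self]
    exact hev
  · simp [v10]
  · simp only []
    omega

theorem getD_checkTests (L : PoolTable n N) (V : ℕ) (f : Finset (Fin n) → Bool) (r : List Bool)
    {R k : ℕ} (hk : k < R) :
    ((checkTests L V R).map f ++ r).getD (3 * k) false = f (L.row (V + 2 * k)) ∧
    ((checkTests L V R).map f ++ r).getD (3 * k + 1) false = f (L.row (V + 2 * k + 1)) ∧
    ((checkTests L V R).map f ++ r).getD (3 * k + 2) false =
      f (L.row (V + 2 * k) ∪ L.row (V + 2 * k + 1)) := by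
  induction R generalizing r with
  | zero => omega
  | succ R ih =>
    rw [checkTests_succ, List.map_append, List.append_assoc]
    rcases Nat.lt_succ_iff_lt_or_eq.1 hk with hk | rfl
    · exact ih _ hk
    · have h : ((checkTests L V k).map f).length = 3 * k := by
        rw [List.length_map, checkTests_length]
      refine ⟨?_, ?_, ?_⟩ <;> rw [List.getD_append_right _ _ _ _ (by omega), h] <;> simp

theorem passed_iff {L : PoolTable n N} {V R k : ℕ} (hk : k < R) (r : List Bool) :
    Passed ((checkTests L V R).map (testOutcome S₁ S₂) ++ r) k ↔ GoodTrial S₁ S₂ L V k := by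
  obtain ⟨h1, h2, h3⟩ := getD_checkTests L V (testOutcome S₁ S₂) r hk
  rw [Passed, h1, h2, h3, GoodTrial]

theorem runs_attempt {σ : State n} {Λ w R V bud : ℕ} (hv : Env σ.var n Λ w R V bud)
    (hc : σ.cur = ∅) (hp : σ.pending = []) (hW : V + 3 * R + 3 < W) :
    Runs S₁ S₂ T W attempt σ fun τ => ∃ v t,
      ((v 10 = 1 ∧ ∃ k < R, GoodTrial S₁ S₂ (T σ.table) V k ∧ v 11 = V + 2 * k) ∨
        (v 10 = 0 ∧ ∀ k < R, ¬ GoodTrial S₁ S₂ (T σ.table) V k)) ∧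
      (∀ x, x < 10 → v x = σ.var x) ∧ t ≤ σ.time + 100 * R + 21 ∧
      τ = { σ with
        var := v
        results := (checkTests (T σ.table) V R).map (testOutcome S₁ S₂)
        tests := σ.tests + 3 * R
        stages := σ.stages + 1
        time := t } := by
  refine .seq <| (runs_reqCheck hv.h8 hv.h6 hc (by omega) (by omega)).mono ?_
  rintro _ ⟨v, t, hf, ht, rfl⟩
  refine .step <| (runs_scan (V := V) (R := R) ?_ ?_ hW).mono ?_
  · simp [Atom.step, hf, hv.h8]
  · simp [Atom.step, hf, hv.h6]
  rintro _ ⟨v', t', hk, hf', ht', rfl⟩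
  simp only [Atom.step, hp, List.nil_append] at hk
  refine ⟨v', t', ?_, ?_, ?_, ?_⟩
  · have hiff : ∀ k < R, (Passed ((checkTests (T σ.table) V R).map (testOutcome S₁ S₂)) k ↔
        GoodTrial S₁ S₂ (T σ.table) V k) := fun k hk => by
      simpa using passed_iff (S₁ := S₁) (S₂ := S₂) (L := T σ.table) (V := V) hk []
    refine hk.imp (fun ⟨h, k, hk, hp, h'⟩ => ⟨h, k, hk, (hiff k hk).1 hp, h'⟩)
      (fun ⟨h, h'⟩ => ⟨h, fun k hk hg => h' k hk ((hiff k hk).2 hg)⟩)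
  · intro x hx
    rw [hf' x (by omega) (by omega) (by omega)]
    simp [Atom.step, hf x (by omega)]
  · simp [Atom.step] at ht'
    omega
  · simp [Atom.step, hp]

/-- The outcomes of the splitting tests, where `g` is the first trial pool used. -/
def splitResults (S₁ S₂ : Finset (Fin n)) (L : PoolTable n N) (V g k : ℕ) : List Bool :=
  (List.range k).map fun i => testOutcome S₁ S₂ (L.row (i - i / V * V) ∪ L.row (g + i / V))

/-- What the search for candidates achieves. -/
def Found (pos : ℕ → ℕ → ℕ → Bool) (n Λ w bud : ℕ) (q : List Node) : Prop :=
  (bud ≤ q.length ∨ q = allCand pos n Λ w) ∧ q.length ≤ bud + (roots n w).length + 2 ∧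
    q <+: allCand pos n Λ w

theorem runs_search {σ : State n} {Λ w R V bud g : ℕ} (hv : Env σ.var n Λ w R V bud)
    (hg : σ.var 11 = g) (hc : σ.cur = ∅) (hp : σ.pending = []) (hw : 0 < w)
    (hW : bud + (roots n w).length + 5 < W) (hW2 : g + 2 * V < W)
    (hnw : n + w < W) (hΛ : Λ + 1 < W) :
    Runs S₁ S₂ T W search σ fun τ => ∃ q a v t,
      Holds a q ∧ v 16 = q.length ∧
      Found (posOf (T σ.table) (splitResults S₁ S₂ (T σ.table) V g (2 * V)) W V 0) n Λ w bud q ∧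
      (∀ x, x < 12 → v x = σ.var x) ∧ t ≤ σ.time + 60 * V + 200 * q.length + 100 ∧
      τ = { σ with
        var := v
        arr := a
        results := splitResults S₁ S₂ (T σ.table) V g (2 * V)
        tests := σ.tests + 2 * V
        stages := σ.stages + 1
        time := t } := by
  have e2 : 2 % W = 2 := Nat.mod_eq_of_lt (by omega)
  have e2V : (2 * V) % W = 2 * V := Nat.mod_eq_of_lt (by omega)
  refine .step <| .seq <|
    (runs_reqSplit (V := V) (k := 2 * V) (g := g) ?_ ?_ ?_ ?_ ?_ (by omega)).mono ?_
  · simp [Atom.step, hv.h8]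
  · simp [Atom.step, Expr.eval, hv.h8, e2, e2V]
  · simp [Atom.step, hg]
  · simp [Atom.step, hc]
  · omega
  rintro _ ⟨v, t, hf, ht, rfl⟩
  have hfr : ∀ x, x < 12 → v x = σ.var x := by
    intro x hx
    rw [hf x (by omega)]
    simp [Atom.step, show x ≠ 13 by omega]
  have hv' := hv.congr (v' := v) fun x hx => hfr x (by omega)
  have hres : ((List.range (2 * V)).map fun i =>
      (T σ.table).row (i - i / V * V) ∪ (T σ.table).row (g + i / V)).map (testOutcome S₁ S₂) =
      splitResults S₁ S₂ (T σ.table) V g (2 * V) := by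
    simp [splitResults]
  refine .step <| .step <| (runs_decode (w := w) (Λ := Λ) (V := V) (base := 0) (bud := bud)
    (pos := posOf (T σ.table) (splitResults S₁ S₂ (T σ.table) V g (2 * V)) W V 0)
    ?_ ?_ ?_ ?_ ?_ ?_ ?_ hw hW hnw hΛ (by omega)).mono ?_
  · simp [Atom.step, hv'.h0]
  · simp [Atom.step, hv'.h5]
  · simp [Atom.step, hv'.h7]
  · simp [Atom.step, hv'.h8]
  · simp [Atom.step, hv'.h9]
  · simp [Atom.step, Expr.eval]
  · simp only [Atom.step, hp, List.nil_append, hres]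
  rintro _ ⟨q, a, v', t', ha, h16, h1, h2, h3, hf', ht', rfl⟩
  refine ⟨q, a, v', t', ha, h16, ⟨h1, h2, h3⟩, ?_, ?_, ?_⟩
  · intro x hx
    rw [hf' x (by omega)]
    simp [Atom.step, show x ≠ 14 by omega, hfr x hx]
  · simp [Atom.step, Expr.cost] at ht ht'
    omega
  · simp only [Atom.step, hp, List.nil_append, hres]

theorem runs_verify {σ : State n} {q : List Node} {g : ℕ} (hq : Holds σ.arr q)
    (h16 : σ.var 16 = q.length) (hg : σ.var 11 = g) (hc : σ.cur = ∅) (hp : σ.pending = [])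
    (hb : ∀ u ∈ q, u.b ≤ 1) (hW : g + q.length + 2 < W) :
    Runs S₁ S₂ T W verify σ fun τ =>
      (∀ b y, y ∈ τ.out b ↔ y ∈ σ.out b ∨ ∃ u ∈ q,
        testOutcome S₁ S₂ (itemSet n u.x ∪ (T σ.table).row (g + u.b)) = true ∧ u.x = y.val ∧
        (b = true ↔ u.b ≠ 0)) ∧
      τ.tests = σ.tests + q.length ∧ τ.stages = σ.stages + 1 ∧
      τ.time ≤ σ.time + 100 * q.length + 30 := by
  refine .seq <| (runs_reqItems hq h16 hg hc hb hW).mono ?_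
  rintro _ ⟨v, t, hf, ht, rfl⟩
  refine .step <| (runs_output (q := q)
    (sel := fun i => (q.map fun u => testOutcome S₁ S₂
      (itemSet n u.x ∪ (T σ.table).row (g + u.b))).getD i false = true) ?_ ?_ ?_ ?_ ?_).mono ?_
  · simpa [Atom.step] using hq
  · simp [Atom.step, hf, h16]
  · simp [Expr.cost]
  · intro v' t' o' i hi h12 _
    simp [Atom.step, Expr.eval, h12, hp, Function.comp_def]
  · omega
  rintro _ ⟨v', t', o', ho, ht', rfl⟩
  refine ⟨fun b y => ?_, ?_, ?_, ?_⟩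
  · rw [ho]
    refine or_congr (by simp [Atom.step]) ?_
    constructor
    · rintro ⟨i, h, hs, hx, hb⟩
      refine ⟨q[i], List.getElem_mem h, ?_, hx, hb⟩
      simpa [List.getD_eq_getElem, h] using hs
    · rintro ⟨u, hu, hs, hx, hb⟩
      obtain ⟨i, h, rfl⟩ := List.getElem_of_mem hu
      refine ⟨i, h, ?_, hx, hb⟩
      simpa [List.getD_eq_getElem, h] using hs
  · simp [Atom.step]
  · simp [Atom.step]
  · simp [Atom.step] at ht' ⊢
    omega

theorem runs_report {σ : State n} {q : List Node} {Λ : ℕ} (hq : Holds σ.arr q)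
    (h16 : σ.var 16 = q.length) (h5 : σ.var 5 = Λ) (hW : q.length + 2 < W) :
    Runs S₁ S₂ T W report σ fun τ =>
      (∀ b y, y ∈ τ.out b ↔ y ∈ σ.out b ∨ ∃ u ∈ q, Λ ≤ u.l ∧ u.x = y.val ∧
        (b = true ↔ u.b ≠ 0)) ∧
      τ.tests = σ.tests ∧ τ.stages = σ.stages ∧ τ.time ≤ σ.time + 50 * q.length + 10 := by
  have e1 : 1 % W = 1 := Nat.mod_eq_of_lt (by omega)
  refine (runs_output (q := q) (sel := fun i => ∀ h : i < q.length, Λ ≤ q[i].l)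
    hq h16 (by simp [Expr.cost]) ?_ hW).mono ?_
  · intro v t o i hi h12 hf
    have hl := (hq i hi).2.1
    have h5' : v 5 = Λ := by rw [hf 5 (by decide), h5]
    by_cases h : q[i].l < Λ
    · simp [Expr.eval, h12, hl, h5', e1, h, hi]
    · simp [Expr.eval, h12, hl, h5', e1, h, hi, not_lt.1 h]
  rintro _ ⟨v, t, o, ho, ht, rfl⟩
  refine ⟨fun b y => ?_, rfl, rfl, ht⟩
  rw [ho]
  refine or_congr_right ?_
  constructor
  · rintro ⟨i, h, hs, hx, hb⟩
    exact ⟨q[i], List.getElem_mem h, hs h, hx, hb⟩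
  · rintro ⟨u, hu, hs, hx, hb⟩
    obtain ⟨i, h, rfl⟩ := List.getElem_of_mem hu
    exact ⟨i, h, fun _ => hs, hx, hb⟩

end Specs

/-! ### The algorithms -/

/-- The two final stages: candidates, and then single items. -/
def finish : Program := search ;; verify

/-- The budget for the queue of the Monte Carlo algorithms. -/
def budExpr : Expr := .mul (.lit 4000) (.mul (.var 3) (.add (.var 5) (.lit 1)))

/-- A non-adaptive algorithm: the splitting tests are made for the pools of all trials, and those
for a successful one are decoded. -/
def oneStage (ρ γ : ℕ) : Program :=
  prepare ρ γ budExpr ;; set 11 (.var 8) ;; set 13 (.mul (.mul (.lit 2) (.var 6)) (.var 8)) ;;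
  reqCheck ;; reqSplit ;; .atom .runStage ;; scan ;;
  .ite (.var 10) (
    set 14 (.add (.mul (.lit 3) (.var 6)) (.mul (.sub (.var 11) (.var 8)) (.var 8))) ;;
    decode ;; report) skip

/-- A two-stage algorithm: after a stage of trials, the splitting tests are made for one successful
trial, and the candidates on the last level are reported. -/
def twoStage (ρ γ : ℕ) : Program :=
  prepare ρ γ budExpr ;; attempt ;; .ite (.var 10) (search ;; report) skip

/-- A three-stage algorithm: there are no further levels of single items, but the candidates are
tested one by one in the last stage. -/
def threeStage (ρ : ℕ) : Program :=
  prepare ρ 0 budExpr ;; attempt ;; .ite (.var 10) finish skip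

/-- A Las Vegas algorithm: the first stage is repeated, with new pools, until some trial succeeds;
the budget exceeds the number of nodes of the complete tree. -/
def untilSuccess (ρ : ℕ) : Program :=
  prepare ρ 0 (.mul (.lit 16) (.var 0)) ;;
  .loop (.sub (.lit 1) (.var 10)) (attempt ;; .ite (.var 10) skip (.atom .nextTable)) ;;
  finish

/-- The pair of hidden sets in one of the two orders. -/
def IsOrder {n : ℕ} (S₁ S₂ : Finset (Fin n)) (D : ℕ → Finset (Fin n)) : Prop :=
  D = tagged S₁ S₂ ∨ D = tagged S₂ S₁

theorem identifies_of_isOrder {n : ℕ} {S₁ S₂ : Finset (Fin n)} {D : ℕ → Finset (Fin n)}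
    (hD : IsOrder S₁ S₂ D) {σ : State n} (h : ∀ b y, y ∈ σ.out b ↔ y ∈ D b.toNat) :
    σ.Identifies S₁ S₂ := by
  have h0 : σ.out false = D 0 := Finset.ext fun y => h false y
  have h1 : σ.out true = D 1 := Finset.ext fun y => h true y
  rcases hD with rfl | rfl
  · exact .inl ⟨by simpa [tagged] using h0, by simpa [tagged] using h1⟩
  · exact .inr ⟨by simpa [tagged] using h0, by simpa [tagged] using h1⟩

theorem toNat_eq_of_iff {b : Bool} {c : ℕ} (hc : c ≤ 1) (h : b = true ↔ c ≠ 0) : b.toNat = c := by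
  cases b <;> simp at h ⊢ <;> omega

theorem iff_of_toNat_eq {b : Bool} {c : ℕ} (h : b.toNat = c) : b = true ↔ c ≠ 0 := by
  cases b <;> simp at h ⊢ <;> omega

/-- All candidates on the last level are hidden items. -/
def NoFalseLeaf {n N : ℕ} (L : PoolTable n N) (D : ℕ → Finset (Fin n)) (k Λ : ℕ) : Prop :=
  ∀ u ∈ cand (hit L D) n Λ (2 ^ k) Λ, ∃ d ∈ D u.b, d.val = u.x

section Semantics

variable {n N : ℕ} {S₁ S₂ : Finset (Fin n)} {L : PoolTable n N} {D : ℕ → Finset (Fin n)}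
  {k Λ V : ℕ}

theorem mem_iff_leaf (hL : Splits L k Λ V) (hk : k ≤ Λ) (hf : NoFalseLeaf L D k Λ) (b : Bool)
    (y : Fin n) :
    (∃ u ∈ allCand (hit L D) n Λ (2 ^ k), Λ ≤ u.l ∧ u.x = y.val ∧ (b = true ↔ u.b ≠ 0)) ↔
      y ∈ D b.toNat := by
  constructor
  · rintro ⟨u, hu, hl, hx, hb⟩
    obtain ⟨l, hl', hu'⟩ := List.mem_flatMap.1 hu
    have hll : l = Λ := by
      have := l_of_mem_cand hu'
      have := List.mem_range.1 hl'
      omega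
    subst hll
    obtain ⟨d, hd, hdx⟩ := hf u hu'
    have := toNat_eq_of_iff (bounds_of_mem_allCand hu).2.2 hb
    rw [this]
    have hy : d = y := Fin.ext (hdx.trans hx)
    exact hy ▸ hd
  · intro hy
    obtain ⟨u, hu, hl, hb, hx⟩ := exists_leaf hL hk (b.toNat_le) hy
    exact ⟨u, hu, hl.ge, hx, iff_of_toNat_eq hb.symm⟩

theorem mem_itemSet {x : ℕ} {y : Fin n} : y ∈ itemSet n x ↔ x = y.val := by
  unfold itemSet
  split_ifs with hx
  · simp only [Finset.mem_singleton, Fin.ext_iff, eq_comm]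
  · simp only [Finset.notMem_empty, false_iff]
    rintro rfl
    exact hx y.isLt

theorem mem_iff_verified (hL : Splits L k Λ V) (hk : k ≤ Λ) {g : ℕ}
    (hD : ∀ b ≤ 1, ∀ X, testOutcome S₁ S₂ (X ∪ L.row (g + b)) = decide ((X ∩ D b).Nonempty))
    (b : Bool) (y : Fin n) :
    (∃ u ∈ allCand (hit L D) n Λ (2 ^ k),
      testOutcome S₁ S₂ (itemSet n u.x ∪ L.row (g + u.b)) = true ∧ u.x = y.val ∧
        (b = true ↔ u.b ≠ 0)) ↔ y ∈ D b.toNat := by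
  have hone : ∀ x : ℕ, x = y.val → itemSet n x = {y} := by
    rintro _ rfl
    ext z
    rw [mem_itemSet, Finset.mem_singleton, Fin.ext_iff, eq_comm]
  constructor
  · rintro ⟨u, hu, ht, hx, hb⟩
    have hub := (bounds_of_mem_allCand hu).2.2
    rw [hD _ hub, decide_eq_true_eq, hone _ hx] at ht
    rw [toNat_eq_of_iff hub hb]
    obtain ⟨z, hz⟩ := ht
    obtain ⟨hz, hzD⟩ := Finset.mem_inter.1 hz
    rwa [Finset.mem_singleton.1 hz] at hzD
  · intro hy
    obtain ⟨u, hu, hl, hb, hx⟩ := exists_leaf hL hk (b.toNat_le) hy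
    refine ⟨u, hu, ?_, hx, iff_of_toNat_eq hb.symm⟩
    rw [hD _ (bounds_of_mem_allCand hu).2.2, decide_eq_true_eq, hone _ hx, hb]
    exact ⟨y, by simp [hy]⟩

theorem exists_order {r : ℕ} (h : GoodTrial S₁ S₂ L V r) :
    ∃ D, IsOrder S₁ S₂ D ∧ ∀ b ≤ 1, ∀ X,
      testOutcome S₁ S₂ (X ∪ L.row (V + 2 * r + b)) = decide ((X ∩ D b).Nonempty) :=
  exists_tagged (A := fun b => L.row (V + 2 * r + b)) h.1 h.2.1 h.2.2

theorem getD_splitResults {V g k i : ℕ} (hi : i < k) :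
    (splitResults S₁ S₂ L V g k).getD i false =
      testOutcome S₁ S₂ (L.row (i - i / V * V) ∪ L.row (g + i / V)) := by
  simp [splitResults, hi]

/-- With the outcomes for a successful trial, the search sees the hidden sets. -/
theorem allCand_splitResults {W w g t base r : ℕ} {res : List Bool} (hL : Splits L k Λ V)
    (hD : ∀ b ≤ 1, ∀ X,
      testOutcome S₁ S₂ (X ∪ L.row (g + t + b)) = decide ((X ∩ D b).Nonempty))
    (ht : t + 2 ≤ r)
    (hres : ∀ i < r * V,
      res.getD (base + i) false = (splitResults S₁ S₂ L V g (r * V)).getD i false)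
    (hW : base + t * V + 2 * V < W) :
    allCand (posOf L res W V (base + t * V)) n Λ w = allCand (hit L D) n Λ w := by
  refine allCand_congr fun x hx l hl b hb => posOf_eq_hit hL (fun b hb p hp => ?_) hW x hx l hl b hb
  have h1 : (t + b) * V + p < r * V := by
    calc (t + b) * V + p < (t + b) * V + V := by omega
      _ = (t + b + 1) * V := by ring
      _ ≤ r * V := Nat.mul_le_mul_right _ (by omega)
  have h2 : base + t * V + (b * V + p) = base + ((t + b) * V + p) := by ring
  have hd : ((t + b) * V + p) / V = t + b := by
    rw [mul_comm, Nat.mul_add_div (by omega), Nat.div_eq_of_lt hp, add_zero]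
  rw [h2, hres _ h1, getD_splitResults h1, hd, Nat.add_sub_cancel_left, ← add_assoc, hD b hb]

theorem found_hit {W w bud r : ℕ} {q : List Node} (hL : Splits L k Λ V)
    (hD : ∀ b ≤ 1, ∀ X,
      testOutcome S₁ S₂ (X ∪ L.row (V + 2 * r + b)) = decide ((X ∩ D b).Nonempty))
    (hW : 2 * V < W)
    (hq : Found (posOf L (splitResults S₁ S₂ L V (V + 2 * r) (2 * V)) W V 0) n Λ w bud q) :
    Found (hit L D) n Λ w bud q := by
  have hall := allCand_splitResults (g := V + 2 * r) (t := 0) (base := 0) (r := 2)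
    (W := W) (w := w) (res := splitResults S₁ S₂ L V (V + 2 * r) (2 * V)) hL
    (by simpa using hD) le_rfl (fun i _ => by simp) (by omega)
  rw [zero_mul, add_zero] at hall
  rwa [Found, hall, ← Found] at hq

end Semantics

/-- The good event for the Monte Carlo algorithms: some trial is successful, the number of
candidates stays within the budget, and, if `leaf` holds, there are no false candidates on the last
level. The algorithms that report the last level need the case that `leaf` is true. -/
structure Success {n N : ℕ} (S₁ S₂ : Finset (Fin n)) (L : PoolTable n N) (k Λ V R bud : ℕ)
    (leaf : Prop) : Prop where
  splits : Splits L k Λ V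
  trial : ∃ r < R, GoodTrial S₁ S₂ L V r
  budget : ∀ D, IsOrder S₁ S₂ D → (allCand (hit L D) n Λ (2 ^ k)).length < bud
  noFalseLeaf : leaf → ∀ D, IsOrder S₁ S₂ D → NoFalseLeaf L D k Λ

section Algorithms

variable {n N : ℕ} {S₁ S₂ : Finset (Fin n)} {T : ℕ → PoolTable n N} {W : ℕ}

theorem eval_budExpr {s₁ s₂ s Λ bud : ℕ} (hbud : bud = 4000 * (s * (Λ + 1))) (hs : 1 ≤ s)
    (hW : bud < W) (v : ℕ → ℕ) (t : ℕ) (h3 : v 3 = s) (h5 : v 5 = Λ) :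
    budExpr.eval W (T 0) { State.init n s₁ s₂ with var := v, time := t } = bud := by
  have h4 : s * (Λ + 1) < W := by omega
  have h6 : Λ + 1 ≤ s * (Λ + 1) := Nat.le_mul_of_pos_left _ hs
  have e1 : 1 % W = 1 := Nat.mod_eq_of_lt (by omega)
  have e4 : 4000 % W = 4000 := Nat.mod_eq_of_lt (by omega)
  simp only [budExpr, Expr.eval, h3, h5, e1, e4]
  rw [Nat.mod_eq_of_lt (show Λ + 1 < W by omega), Nat.mod_eq_of_lt h4, Nat.mod_eq_of_lt
    (hbud ▸ hW), hbud]

theorem runs_twoStage {ρ γ s k Λ V R bud : ℕ} (hP : Params ρ γ n S₁.card S₂.card s k Λ V R)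
    (hW : Fits ρ γ n s Λ V R bud W) (hbud : bud = 4000 * (s * (Λ + 1))) :
    Runs S₁ S₂ T W (twoStage ρ γ) (State.init n S₁.card S₂.card) fun τ =>
      τ.stages ≤ 2 ∧ τ.tests ≤ 3 * R + 2 * V ∧
      τ.time ≤ 50 * Λ + 100 * R + 60 * V + 500 * bud + 3000 ∧
      (Success S₁ S₂ (T 0) k Λ V R bud True → τ.Identifies S₁ S₂) := by
  have hs1 := hP.one_le
  have hroots := hP.roots_le
  have hw := hP.two_pow_le
  have b1 := hW.n_lt
  have b2 := hW.sum_lt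
  have b3 := hW.levels_lt
  have b4 : s ≤ s * (Λ + 1) := Nat.le_mul_of_pos_right _ (by omega)
  refine .seq <| (runs_prepare hP hW (by simp [budExpr, Expr.cost])
    fun v t _ h3 h5 => eval_budExpr hbud hs1 (by omega) v t h3 h5).mono ?_
  rintro _ ⟨v, t, hv, v10, ht, rfl⟩
  refine .seq <| (runs_attempt hv rfl rfl (by omega)).mono ?_
  rintro _ ⟨v', t', hcase, hf', ht', rfl⟩
  simp only [State.init] at ht' hcase hf'
  have hv' := hv.congr hf'
  refine .ite (fun h => ?_) (fun h => ?_)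
  · change v' 10 ≠ 0 at h
    obtain ⟨-, r, hr, hg, h11⟩ := hcase.resolve_right fun h' => h h'.1
    refine .seq <| (runs_search (g := V + 2 * r) hv' h11 rfl rfl (by positivity)
      (by omega) (by omega) (by omega) (by omega)).mono ?_
    rintro _ ⟨q, a, v'', t'', ha, h16, hq, hf'', ht'', rfl⟩
    have hqlen := hq.2.1
    refine (runs_report (q := q) (Λ := Λ) ha h16 ?_ (by omega)).mono ?_
    · change v'' 5 = Λ
      rw [hf'' 5 (by decide)]
      exact hv'.h5
    rintro τ ⟨ho, hte, hst, hti⟩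
    simp only [State.init, State.charge, Expr.cost] at ho hte hst hti ht''
    refine ⟨by omega, by omega, by omega, fun hS => ?_⟩
    obtain ⟨D, hD, hDt⟩ := exists_order hg
    obtain ⟨hq1, hq2, hq3⟩ := found_hit hS.splits hDt (by omega) hq
    have hqall : q = allCand (hit (T 0) D) n Λ (2 ^ k) :=
      hq1.resolve_left (not_le.2 (hq3.length_le.trans_lt (hS.budget D hD)))
    change ∀ b y, y ∈ τ.out b ↔ _ at ho
    refine identifies_of_isOrder hD fun b y => ?_
    rw [ho, hqall, ← mem_iff_leaf hS.splits hP.k_le (hS.noFalseLeaf trivial D hD) b y]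
    simp
  · change v' 10 = 0 at h
    refine runs_skip ⟨?_, ?_, ?_, fun hS => ?_⟩
    · simp [State.charge, State.init]
    · simp [State.charge, State.init]
    · simp [State.charge, Expr.cost]; omega
    · obtain ⟨r, hr, hg⟩ := hS.trial
      rcases hcase with hcase | hcase
      · omega
      · exact absurd hg (hcase.2 r hr)

theorem runs_finish {σ : State n} {k Λ R V bud r : ℕ} (hv : Env σ.var n Λ (2 ^ k) R V bud)
    (h11 : σ.var 11 = V + 2 * r) (hc : σ.cur = ∅) (hp : σ.pending = [])
    (ho : ∀ b, σ.out b = ∅) (hg : GoodTrial S₁ S₂ (T σ.table) V r)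
    (hW : V + 2 * r + 2 * V + bud + (roots n (2 ^ k)).length + 10 < W)
    (hnw : n + 2 ^ k < W) (hΛ : Λ + 1 < W) (hk : k ≤ Λ) :
    Runs S₁ S₂ T W finish σ fun τ => ∃ m, m ≤ bud + (roots n (2 ^ k)).length + 2 ∧
      τ.tests = σ.tests + 2 * V + m ∧ τ.stages = σ.stages + 2 ∧
      τ.time ≤ σ.time + 60 * V + 300 * m + 200 ∧
      (Splits (T σ.table) k Λ V → ∃ D, IsOrder S₁ S₂ D ∧
        m ≤ (allCand (hit (T σ.table) D) n Λ (2 ^ k)).length ∧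
        ((allCand (hit (T σ.table) D) n Λ (2 ^ k)).length < bud → τ.Identifies S₁ S₂)) := by
  refine .seq <| (runs_search (g := V + 2 * r) hv h11 hc hp (by positivity)
    (by omega) (by omega) hnw hΛ).mono ?_
  rintro _ ⟨q, a, v, t, ha, h16, hq, hf, ht, rfl⟩
  have hqlen := hq.2.1
  refine (runs_verify (W := W) (q := q) (g := V + 2 * r) ?_ ?_ ?_ ?_ ?_
    (fun u hu => (bounds_of_mem_allCand (hq.2.2.mem hu)).2.2) (by omega)).mono ?_
  · exact ha
  · exact h16
  · exact (hf 11 (by decide)).trans h11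
  · exact hc
  · exact hp
  rintro τ ⟨hout, hte, hst, hti⟩
  change τ.tests = σ.tests + 2 * V + q.length at hte
  change τ.stages = σ.stages + 1 + 1 at hst
  change τ.time ≤ t + _ + _ at hti
  refine ⟨q.length, hqlen, hte, hst, by omega, fun hS => ?_⟩
  obtain ⟨D, hD, hDt⟩ := exists_order hg
  obtain ⟨hq1, hq2, hq3⟩ := found_hit hS hDt (by omega) hq
  refine ⟨D, hD, hq3.length_le, fun hlt => identifies_of_isOrder hD fun b y => ?_⟩
  have hqall := hq1.resolve_left (not_le.2 (hq3.length_le.trans_lt hlt))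
  change ∀ b y, y ∈ τ.out b ↔ y ∈ σ.out b ∨ _ at hout
  rw [hout, hqall, ← mem_iff_verified hS hk hDt b y, ho]
  simp

theorem runs_threeStage {ρ s k Λ V R bud : ℕ} (hP : Params ρ 0 n S₁.card S₂.card s k Λ V R)
    (hW : Fits ρ 0 n s Λ V R bud W) (hbud : bud = 4000 * (s * (Λ + 1))) :
    Runs S₁ S₂ T W (threeStage ρ) (State.init n S₁.card S₂.card) fun τ =>
      τ.stages ≤ 3 ∧ τ.tests ≤ 3 * R + 2 * V + 2 * bud + 2 ∧
      τ.time ≤ 50 * Λ + 100 * R + 60 * V + 600 * bud + 3000 ∧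
      (Success S₁ S₂ (T 0) k Λ V R bud False → τ.Identifies S₁ S₂) := by
  have hs1 := hP.one_le
  have hroots := hP.roots_le
  have hw := hP.two_pow_le
  have b1 := hW.n_lt
  have b2 := hW.sum_lt
  have b3 := hW.levels_lt
  have b4 : s ≤ s * (Λ + 1) := Nat.le_mul_of_pos_right _ (by omega)
  refine .seq <| (runs_prepare hP hW (by simp [budExpr, Expr.cost])
    fun v t _ h3 h5 => eval_budExpr hbud hs1 (by omega) v t h3 h5).mono ?_
  rintro _ ⟨v, t, hv, v10, ht, rfl⟩
  refine .seq <| (runs_attempt hv rfl rfl (by omega)).mono ?_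
  rintro _ ⟨v', t', hcase, hf', ht', rfl⟩
  simp only [State.init] at ht' hcase hf'
  have hv' := hv.congr hf'
  refine .ite (fun h => ?_) (fun h => ?_)
  · change v' 10 ≠ 0 at h
    obtain ⟨-, r, hr, hg, h11⟩ := hcase.resolve_right fun h' => h h'.1
    refine (runs_finish (r := r) hv' h11 rfl rfl (fun _ => rfl) hg (by omega) (by omega) (by omega)
      hP.k_le).mono ?_
    rintro τ ⟨m, hm, hte, hst, hti, hS⟩
    simp only [State.init, State.charge, Expr.cost] at hte hst hti
    refine ⟨by omega, by omega, by omega, fun hS' => ?_⟩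
    obtain ⟨D, hD, -, hid⟩ := hS hS'.splits
    exact hid (hS'.budget D hD)
  · change v' 10 = 0 at h
    refine runs_skip ⟨?_, ?_, ?_, fun hS => ?_⟩
    · simp [State.charge, State.init]
    · simp [State.charge, State.init]; omega
    · simp [State.charge, Expr.cost]; omega
    · obtain ⟨r, hr, hg⟩ := hS.trial
      rcases hcase with hcase | hcase
      · omega
      · exact absurd hg (hcase.2 r hr)

/-- If the first `j` tables contain no successful trial and the next one does, then the Las Vegas
algorithm makes `j + 1` attempts. -/
theorem runs_untilSuccess {ρ s k Λ V R bud j : ℕ} (hP : Params ρ 0 n S₁.card S₂.card s k Λ V R)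
    (hW : Fits ρ 0 n s Λ V R bud W) (hbud : bud = 16 * n)
    (hj : ∀ i < j, ∀ r < R, ¬ GoodTrial S₁ S₂ (T i) V r)
    (hj' : ∃ r < R, GoodTrial S₁ S₂ (T j) V r) (hS : Splits (T j) k Λ V)
    (hlt : ∀ D, IsOrder S₁ S₂ D → (allCand (hit (T j) D) n Λ (2 ^ k)).length < bud) :
    Runs S₁ S₂ T W (untilSuccess ρ) (State.init n S₁.card S₂.card) fun τ =>
      ∃ D, IsOrder S₁ S₂ D ∧ ∃ m ≤ (allCand (hit (T j) D) n Λ (2 ^ k)).length,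
      τ.stages = j + 3 ∧ τ.tests = 3 * R * (j + 1) + 2 * V + m ∧
      τ.time ≤ 50 * Λ + (100 * R + 30) * (j + 1) + 60 * V + 300 * m + 400 ∧
      τ.Identifies S₁ S₂ := by
  have hs1 := hP.one_le
  have hroots := hP.roots_le
  have hw := hP.two_pow_le
  have b1 := hW.n_lt
  have b2 := hW.sum_lt
  have b3 := hW.levels_lt
  have hn := hP.le_n
  have e1 : 1 % W = 1 := Nat.mod_eq_of_lt (by omega)
  refine .seq <| (runs_prepare hP hW (by simp [Expr.cost]) ?_).mono ?_
  · intro v t h0 _ _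
    simp only [Expr.eval, h0]
    rw [Nat.mod_eq_of_lt (show 16 < W by omega), Nat.mod_eq_of_lt (by omega), hbud]
  rintro _ ⟨v, t, hv, v10, ht, rfl⟩
  refine .seq <| Runs.rounds (fun i τ => ∃ v t l, Env v n Λ (2 ^ k) R V bud ∧
      ((i ≤ j ∧ v 10 = 0 ∧ l = i) ∨ (i = j + 1 ∧ l = j ∧ v 10 = 1 ∧
        ∃ r < R, GoodTrial S₁ S₂ (T j) V r ∧ v 11 = V + 2 * r)) ∧
      t ≤ 50 * Λ + (100 * R + 30) * i + 120 ∧ ∃ res,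
      τ = { State.init n S₁.card S₂.card with
        var := v
        results := res
        tests := 3 * R * i
        stages := i
        table := l
        time := t }) (j + 1) ?_ ?_ ?_ ?_
  · rintro i hi _ ⟨v, t, l, hv, hcase, ht, res, rfl⟩
    obtain ⟨-, v10, rfl⟩ := hcase.resolve_right fun h => by omega
    refine ⟨by simp [Expr.eval, v10, e1], ?_⟩
    refine .seq <| (runs_attempt hv rfl rfl (by omega)).mono ?_
    rintro _ ⟨v', t', hcase', hf', ht', rfl⟩
    change _ ≤ t + 4 + _ + _ at ht'
    change (v' 10 = 1 ∧ ∃ k < R, GoodTrial S₁ S₂ (T l) V k ∧ v' 11 = V + 2 * k) ∨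
      v' 10 = 0 ∧ ∀ k < R, ¬ GoodTrial S₁ S₂ (T l) V k at hcase'
    have hv' := hv.congr hf'
    have htime : (100 * R + 30) * (l + 1) = (100 * R + 30) * l + (100 * R + 30) := by ring
    have htests : 3 * R * (l + 1) = 3 * R * l + 3 * R := by ring
    refine .ite (fun h => ?_) (fun h => ?_)
    · change v' 10 ≠ 0 at h
      obtain ⟨h10, r, hr, hg, h11⟩ := hcase'.resolve_right fun h' => h h'.1
      have hlj : l = j := by
        by_contra hne
        exact hj l (by omega) r hr hg
      subst hlj
      refine runs_skip ⟨v', t' + 4, l, hv', .inr ⟨rfl, rfl, h10, r, hr, hg, h11⟩, by omega,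
        (checkTests (T l) V R).map (testOutcome S₁ S₂), ?_⟩
      rw [htests]
      rfl
    · change v' 10 = 0 at h
      obtain ⟨h10, hno⟩ := hcase'.resolve_left fun h' => by omega
      have hlj : l ≠ j := by
        rintro rfl
        obtain ⟨r, hr, hg⟩ := hj'
        exact hno r hr hg
      refine .atom ⟨v', t' + 3, l + 1, hv', .inl ⟨by omega, h10, rfl⟩, by omega,
        (checkTests (T l) V R).map (testOutcome S₁ S₂), ?_⟩
      rw [htests]
      rfl
  · rintro _ ⟨v, t, l, hv, hcase, ht, res, rfl⟩
    obtain ⟨-, -, v10, -⟩ := hcase.resolve_left fun h => by omega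
    simp [Expr.eval, v10, e1]
  · exact ⟨v, t, 0, hv, .inl ⟨Nat.zero_le _, v10, rfl⟩, by omega, [], rfl⟩
  clear! v t
  rintro _ ⟨v, t, l, hv, hcase, ht, res, rfl⟩
  obtain ⟨-, rfl, v10, r, hr, hg, h11⟩ := hcase.resolve_left fun h => by omega
  refine (runs_finish (r := r) hv h11 rfl rfl (fun _ => rfl) hg (by omega) (by omega) (by omega)
    hP.k_le).mono ?_
  rintro τ ⟨m, hm, hte, hst, hti, hfin⟩
  obtain ⟨D, hD, hmD, hid⟩ := hfin hS
  change τ.stages = l + 1 + 2 at hst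
  change τ.tests = 3 * R * (l + 1) + 2 * V + m at hte
  change τ.time ≤ t + 4 + _ + _ + _ at hti
  exact ⟨D, hD, m, hmD, hst, hte, by omega, hid (hlt D hD)⟩

end Algorithms

section Algorithms

variable {n N : ℕ} {S₁ S₂ : Finset (Fin n)} {T : ℕ → PoolTable n N} {W : ℕ}

theorem runs_oneStage {ρ γ s k Λ V R bud : ℕ} (hP : Params ρ γ n S₁.card S₂.card s k Λ V R)
    (hW : Fits ρ γ n s Λ V R bud W) (hbud : bud = 4000 * (s * (Λ + 1))) :
    Runs S₁ S₂ T W (oneStage ρ γ) (State.init n S₁.card S₂.card) fun τ =>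
      τ.stages ≤ 1 ∧ τ.tests ≤ 3 * R + 2 * R * V ∧
      τ.time ≤ 50 * Λ + 200 * R + 60 * (R * V) + 600 * bud + 3000 ∧
      (Success S₁ S₂ (T 0) k Λ V R bud True → τ.Identifies S₁ S₂) := by
  have hs1 := hP.one_le
  have hroots := hP.roots_le
  have hw := hP.two_pow_le
  have b1 := hW.n_lt
  have b2 := hW.sum_lt
  have b3 := hW.levels_lt
  have b4 : s ≤ s * (Λ + 1) := Nat.le_mul_of_pos_right _ (by omega)
  have b5 : 2 * R * V = 2 * (R * V) := mul_assoc _ _ _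
  have e2 : 2 % W = 2 := Nat.mod_eq_of_lt (by omega)
  have e3 : 3 % W = 3 := Nat.mod_eq_of_lt (by omega)
  refine .seq <| (runs_prepare hP hW (by simp [budExpr, Expr.cost])
    fun v t _ h3 h5 => eval_budExpr hbud hs1 (by omega) v t h3 h5).mono ?_
  rintro _ ⟨v₀, t₀, hv₀, v10, ht₀, rfl⟩
  set v₁ := Function.update (Function.update v₀ 11 V) 13 (2 * R * V) with hv₁
  refine .step <| .step ?_
  have hsteps : ∀ σ : State n, σ = { State.init n S₁.card S₂.card with var := v₀, time := t₀ } →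
      (Atom.step S₁ S₂ T W (Atom.step S₁ S₂ T W σ (.assign 11 (.var 8)))
        (.assign 13 (.mul (.mul (.lit 2) (.var 6)) (.var 8)))) =
      { State.init n S₁.card S₂.card with var := v₁, time := t₀ + 8 } := by
    rintro _ rfl
    have a1 : (2 * R) % W = 2 * R := Nat.mod_eq_of_lt (by omega)
    have a2 : (2 * R * V) % W = 2 * R * V := Nat.mod_eq_of_lt (by omega)
    simp [Atom.step, Expr.eval, hv₀.h8, hv₀.h6, e2, a1, a2, hv₁, Expr.cost]
  rw [hsteps _ rfl]
  have hE₁ : Env v₁ n Λ (2 ^ k) R V bud := hv₀.congr fun x hx => by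
    rw [hv₁, Function.update_of_ne (by omega), Function.update_of_ne (by omega)]
  have h11₁ : v₁ 11 = V := by rw [hv₁]; simp
  have h13₁ : v₁ 13 = 2 * R * V := by rw [hv₁]; simp
  clear_value v₁
  refine .seq <| (runs_reqCheck hE₁.h8 hE₁.h6 rfl (by omega) (by omega)).mono ?_
  rintro _ ⟨v₂, t₂, hf₂, ht₂, rfl⟩
  refine .seq <| (runs_reqSplit (V := V) (k := 2 * R * V) (g := V) ?_ ?_ ?_ rfl (by omega)
    (by omega)).mono ?_
  · exact (hf₂ 8 (by decide)).trans hE₁.h8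
  · exact (hf₂ 13 (by decide)).trans h13₁
  · exact (hf₂ 11 (by decide)).trans h11₁
  rintro _ ⟨v₃, t₃, hf₃, ht₃, rfl⟩
  have hE₃ : Env v₃ n Λ (2 ^ k) R V bud := hE₁.congr fun x hx =>
    (hf₃ x (by omega)).trans (hf₂ x (by omega))
  refine .step <| .seq <| (runs_scan (V := V) (R := R) hE₃.h8 hE₃.h6 (by omega)).mono ?_
  rintro _ ⟨v, t, hcase, hf, ht, rfl⟩
  have hE : Env v n Λ (2 ^ k) R V bud := hE₃.congr fun x hx =>
    hf x (by omega) (by omega) (by omega)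
  set L := T 0 with hL
  have hres : ((State.init n S₁.card S₂.card).pending ++ checkTests L V R ++
      (List.range (2 * R * V)).map fun i => L.row (i - i / V * V) ∪ L.row (V + i / V)).map
      (testOutcome S₁ S₂) = (checkTests L V R).map (testOutcome S₁ S₂) ++
        splitResults S₁ S₂ L V V (2 * R * V) := by
    simp [State.init, splitResults]
  change (v 10 = 1 ∧ ∃ k < R, Passed (((State.init n S₁.card S₂.card).pending ++
      checkTests L V R ++ (List.range (2 * R * V)).map fun i =>
        L.row (i - i / V * V) ∪ L.row (V + i / V)).map (testOutcome S₁ S₂)) k ∧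
      v 11 = V + 2 * k) ∨ (v 10 = 0 ∧ ∀ k < R, ¬ Passed (((State.init n S₁.card S₂.card).pending ++
      checkTests L V R ++ (List.range (2 * R * V)).map fun i =>
        L.row (i - i / V * V) ∪ L.row (V + i / V)).map (testOutcome S₁ S₂)) k) at hcase
  rw [hres] at hcase
  change t₂ ≤ t₀ + 8 + _ + _ at ht₂
  change t ≤ t₃ + 1 + _ + _ at ht
  replace ht₃ : t₃ ≤ t₂ + 30 * (2 * R * V) + 10 := ht₃
  refine .ite (fun h => ?_) (fun h => ?_)
  · change v 10 ≠ 0 at h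
    obtain ⟨-, r, hr, hp, h11⟩ := hcase.resolve_right fun h' => h h'.1
    have hg := (passed_iff hr _).1 hp
    have hrV : 2 * r * V + 2 * V ≤ 2 * R * V := by
      rw [← add_mul]
      exact Nat.mul_le_mul_right _ (by omega)
    refine .step <| .seq <| (runs_decode (w := 2 ^ k) (Λ := Λ) (V := V) (base := 3 * R + 2 * r * V)
      (bud := bud) (pos := posOf L ((checkTests L V R).map (testOutcome S₁ S₂) ++
        splitResults S₁ S₂ L V V (2 * R * V)) W V (3 * R + 2 * r * V))
      ?_ ?_ ?_ ?_ ?_ ?_ ?_ (by positivity) (by omega) (by omega) (by omega) (by omega)).mono ?_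
    · exact hE.h0
    · exact hE.h5
    · exact hE.h7
    · exact hE.h8
    · exact hE.h9
    · have a1 : (3 * R) % W = 3 * R := Nat.mod_eq_of_lt (by omega)
      have a2 : (2 * r * V) % W = 2 * r * V := Nat.mod_eq_of_lt (by omega)
      have a3 : (3 * R + 2 * r * V) % W = 3 * R + 2 * r * V := Nat.mod_eq_of_lt (by omega)
      simp [Atom.step, State.charge, Expr.eval, hE.h6, hE.h8, h11, e3, a1, a2, a3]
    · rw [← hres]
      rfl
    rintro _ ⟨q, a, v', t', ha, h16, hq1, hq2, hq3, hf', ht', rfl⟩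
    refine (runs_report (q := q) (Λ := Λ) ha h16 ?_ (by omega)).mono ?_
    · exact (hf' 5 (by decide)).trans hE.h5
    rintro τ ⟨ho, hte, hst, hti⟩
    change τ.tests = 0 + 3 * R + 2 * R * V at hte
    change τ.stages = 0 + 1 at hst
    change τ.time ≤ t' + _ + _ at hti
    replace ht' : t' ≤ t + 2 + 10 + 200 * q.length + 50 := ht'
    refine ⟨by omega, by omega, by omega, fun hS => ?_⟩
    obtain ⟨D, hD, hDt⟩ := exists_order hg
    have hall := allCand_splitResults (D := D) (g := V) (t := 2 * r) (base := 3 * R) (r := 2 * R)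
      (W := W) (w := 2 ^ k) (res := (checkTests L V R).map (testOutcome S₁ S₂) ++
        splitResults S₁ S₂ L V V (2 * R * V)) hS.splits hDt (by omega)
      (fun i _ => by
        have h1 : ((checkTests L V R).map (testOutcome S₁ S₂)).length = 3 * R := by
          rw [List.length_map, checkTests_length]
        rw [List.getD_append_right _ _ _ _ (by omega), h1, Nat.add_sub_cancel_left]) (by omega)
    rw [hall] at hq1 hq3
    have hqall : q = allCand (hit L D) n Λ (2 ^ k) :=
      hq1.resolve_left (not_le.2 (hq3.length_le.trans_lt (hS.budget D hD)))
    change ∀ b y, y ∈ τ.out b ↔ _ at ho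
    refine identifies_of_isOrder hD fun b y => ?_
    rw [ho, hqall, ← mem_iff_leaf hS.splits hP.k_le (hS.noFalseLeaf trivial D hD) b y]
    simp [State.charge, Atom.step, State.init]
  · change v 10 = 0 at h
    refine runs_skip ⟨?_, ?_, ?_, fun hS => ?_⟩
    · simp [State.charge, State.init, Atom.step]
    · simp [State.charge, State.init, Atom.step]
    · simp [State.charge, Expr.cost]; omega
    · obtain ⟨r, hr, hg⟩ := hS.trial
      rcases hcase with hcase | hcase
      · omega
      · exact absurd ((passed_iff hr _).2 hg) (hcase.2 r hr)

end Algorithms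

/-! ### Averages over random functions -/

/-- Resampling one coordinate of a uniformly random function does not change its distribution. -/
theorem card_mul_sum_eq_sum_update {ι K : Type*} [Fintype ι] [DecidableEq ι] [Fintype K] (i : ι)
    (F : (ι → K) → ℕ) :
    Fintype.card K * ∑ h, F h = ∑ h, ∑ c, F (Function.update h i c) := by
  let e : (ι → K) × K → (ι → K) × K := fun p => (Function.update p.1 i p.2, p.1 i)
  have he : Function.Involutive e := fun p => by simp [e]
  have h1 : ∑ p : (ι → K) × K, F (e p).1 = ∑ p : (ι → K) × K, F p.1 :=
    Fintype.sum_equiv he.toPerm _ _ fun _ => rfl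
  rw [Fintype.sum_prod_type, Fintype.sum_prod_type] at h1
  simp only [e] at h1
  rw [h1, Finset.mul_sum]
  simp

/-- Two items get the same value with probability `1 / M`. -/
theorem mul_card_eq_at {n M : ℕ} {a b : Fin n} (hab : a ≠ b) :
    M * (Finset.univ.filter fun g : Fin n → Fin M => g a = g b).card = M ^ n := by
  have := card_mul_sum_eq_sum_update (K := Fin M) a fun g : Fin n → Fin M =>
    if g a = g b then 1 else 0
  simp only [Fintype.card_fin, Function.update_self, Function.update_of_ne hab.symm,
    Finset.sum_ite_eq', Finset.mem_univ, if_true] at this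
  rw [Finset.card_filter, this]
  simp

/-- A given item shares its value with one of the items of `D` with probability at most
`|D| / M`. -/
theorem mul_card_collision_le {n M : ℕ} (D : Finset (Fin n)) (f : Fin n → Fin n) (y : Fin n)
    (hf : ∀ d ∈ D, f d ≠ y) :
    M * (Finset.univ.filter fun g : Fin n → Fin M => ∃ d ∈ D, g (f d) = g y).card ≤
      D.card * M ^ n := by
  have h : (Finset.univ.filter fun g : Fin n → Fin M => ∃ d ∈ D, g (f d) = g y) ⊆
      D.biUnion fun d => Finset.univ.filter fun g : Fin n → Fin M => g (f d) = g y := by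
    intro g hg
    simpa using hg
  calc _ ≤ M * ∑ d ∈ D, (Finset.univ.filter fun g : Fin n → Fin M => g (f d) = g y).card :=
        Nat.mul_le_mul_left _ ((Finset.card_le_card h).trans Finset.card_biUnion_le)
    _ = ∑ d ∈ D, M ^ n := by
        rw [Finset.mul_sum]
        exact Finset.sum_congr rfl fun d hd => mul_card_eq_at (hf d hd)
    _ = _ := by simp

/-! ### The expected number of candidates -/

/-- The nodes that can become children of a node. -/
def Node.offspring (n : ℕ) (u : Node) : List Node :=
  ⟨u.x, u.l + 1, u.w / 2, u.b⟩ ::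
    if 0 < u.w / 2 ∧ u.x + u.w / 2 < n then [⟨u.x + u.w / 2, u.l + 1, u.w / 2, u.b⟩] else []

theorem Node.children_eq_filter {pos : ℕ → ℕ → ℕ → Bool} {n Λ : ℕ} {u : Node} (h : u.l < Λ) :
    u.children pos n Λ = (u.offspring n).filter fun v => pos v.x u.l v.b := by
  rw [Node.children, if_pos h, Node.offspring, List.filter_cons]
  split_ifs <;> simp_all

/-- The number of hidden items in the block of a node. -/
def load {n : ℕ} (D : ℕ → Finset (Fin n)) (k : ℕ) (u : Node) : ℕ :=
  ((D u.b).filter fun d => d.val / blk k u.l = u.x / blk k u.l).card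

/-- On level `l + 1`, the function `g`, evaluated at the first items of blocks, has the same value
for the block of `x` as for that of some item of `D b`: the pool of the block of `x` meets `D b`. -/
noncomputable def collide {n M : ℕ} (D : ℕ → Finset (Fin n)) (k l : ℕ) (g : Fin n → Fin M)
    (x b : ℕ) : Bool :=
  decide (∃ hx : x < n, ∃ d ∈ D b, g (blockStart k (l + 1) d) = g (blockStart k (l + 1) ⟨x, hx⟩))

section Expectation

variable {n M Λ R m k s : ℕ} {D : ℕ → Finset (Fin n)}

theorem sum_load_offspring_le {u : Node} (hw : u.w = 2 ^ k / 2 ^ u.l) (hx : blk k u.l ∣ u.x) :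
    ((u.offspring n).map (load D k)).sum ≤ load D k u := by
  have hw' : u.w / 2 = 2 ^ k / 2 ^ (u.l + 1) := by
    rw [hw, pow_succ, Nat.div_div_eq_div_mul]
  rcases lt_or_ge u.l k with h | h
  · rw [two_pow_div_of_le h] at hw'
    obtain ⟨c, hc⟩ := hx
    have hB := blk_pos k (u.l + 1)
    have hBe := blk_eq h
    set B := blk k (u.l + 1) with hBdef
    have h0 : u.x / B = 2 * c := by
      rw [hc, hBe, mul_comm 2 B, mul_assoc, Nat.mul_div_cancel_left _ hB]
    have h1 : (u.x + B) / B = 2 * c + 1 := by rw [Nat.add_div_right _ hB, h0]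
    have h2 : u.x / (2 * B) = c := by rw [hc, hBe, Nat.mul_div_cancel_left _ (by omega)]
    have key : ((D u.b).filter fun d => d.val / B = 2 * c).card +
        ((D u.b).filter fun d => d.val / B = 2 * c + 1).card ≤
        ((D u.b).filter fun d => d.val / (2 * B) = c).card := by
      rw [← Finset.card_union_of_disjoint]
      · refine Finset.card_le_card fun d hd => ?_
        simp only [Finset.mem_union, Finset.mem_filter] at hd ⊢
        rw [mul_comm, ← Nat.div_div_eq_div_mul]
        refine ⟨by tauto, ?_⟩
        rcases hd with hd | hd <;> omega
      · refine Finset.disjoint_left.2 fun d hd hd' => ?_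
        simp only [Finset.mem_filter] at hd hd'
        omega
    unfold Node.offspring load
    rw [hBe, h2]
    split_ifs
    · simpa [← hBdef, hw', h0, h1] using key
    · have := key
      simp only [List.map_cons, List.map_nil, List.sum_cons, List.sum_nil, ← hBdef, h0]
      omega
  · have h0 : u.w / 2 = 0 := by rw [hw', two_pow_div_of_lt (by omega)]
    simp [Node.offspring, load, h0, blk_of_le h, blk_of_le (show k ≤ u.l + 1 by omega)]

theorem sum_filter_le (q : List Node) (p : Node → Bool) (f : Node → ℕ) :
    ((q.filter p).map f).sum ≤ (q.map f).sum :=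
  (List.filter_sublist.map f).sum_le_sum fun _ _ => Nat.zero_le _

theorem sum_load_roots_le : ((roots n (2 ^ k)).map (load D k)).sum ≤ (D 0).card + (D 1).card := by
  have h : ∀ b J, ∑ j ∈ Finset.range J, ((D b).filter fun d => d.val / 2 ^ k = j).card
      ≤ (D b).card := fun b J => by
    rw [← Finset.card_biUnion]
    · exact Finset.card_le_card fun d hd => by
        simp only [Finset.mem_biUnion, Finset.mem_filter] at hd
        exact hd.choose_spec.2.1
    · intro i _ j _ hij
      refine Finset.disjoint_left.2 fun d hd hd' => hij ?_
      simp only [Finset.mem_filter] at hd hd'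
      exact hd.2.symm.trans hd'.2
  have hw : 0 < 2 ^ k := by positivity
  have h' : ∀ J, (((List.range J).flatMap (rootPair (2 ^ k))).map (load D k)).sum =
      ∑ j ∈ Finset.range J, ((D 0).filter fun d => d.val / 2 ^ k = j).card +
      ∑ j ∈ Finset.range J, ((D 1).filter fun d => d.val / 2 ^ k = j).card := by
    intro J
    induction J with
    | zero => simp
    | succ J ih =>
      rw [List.range_succ, List.flatMap_append, List.map_append, List.sum_append, ih,
        Finset.sum_range_succ, Finset.sum_range_succ]
      simp only [rootPair, load, List.flatMap_cons, List.flatMap_nil, List.append_nil, List.map_cons,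
        List.map_nil, List.sum_cons, List.sum_nil, blk, Nat.sub_zero, Nat.mul_div_cancel _ hw]
      omega
  rw [roots, h']
  exact add_le_add (h 0 _) (h 1 _)

/-- The candidates of a level are distinct blocks, so that they contain each hidden item at most
once. -/
theorem sum_load_cand_le {pos : ℕ → ℕ → ℕ → Bool} (l : ℕ) (hl : l ≤ Λ) :
    ((cand pos n Λ (2 ^ k) l).map (load D k)).sum ≤ (D 0).card + (D 1).card := by
  induction l with
  | zero => exact sum_load_roots_le
  | succ l ih =>
    refine le_trans ?_ (ih (by omega))
    have : ∀ q : List Node, (∀ u ∈ q, u ∈ cand pos n Λ (2 ^ k) l) →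
        ((q.flatMap (Node.children pos n Λ)).map (load D k)).sum ≤ (q.map (load D k)).sum := by
      intro q
      induction q with
      | nil => simp
      | cons u q ihq =>
        intro hq
        have hu := hq u (by simp)
        have hul := l_of_mem_cand hu
        obtain ⟨hw, hx⟩ := shape_of_mem_cand hu
        rw [List.flatMap_cons, List.map_append, List.sum_append, List.map_cons, List.sum_cons]
        refine add_le_add ?_ (ihq fun v hv => hq v (by simp [hv]))
        rw [Node.children_eq_filter (by omega)]
        exact (sum_filter_le _ _ _).trans
          (sum_load_offspring_le (by rw [hw, hul]) (by rwa [hul]))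
    exact this _ fun u hu => hu

/-- Apart from the case that the block contains a hidden item, a test of its pool is positive with
probability at most `1 / 4`. -/
theorem four_mul_sum_collide_le (hM : ∀ b ≤ 1, 4 * (D b).card ≤ M) {l x b : ℕ} (hb : b ≤ 1)
    (hx : ∀ d ∈ D b, d.val / blk k (l + 1) ≠ x / blk k (l + 1)) :
    4 * (Finset.univ.filter fun g : Fin n → Fin M => collide D k l g x b = true).card ≤ M ^ n := by
  by_cases hxn : x < n
  · have hne : ∀ d ∈ D b, blockStart k (l + 1) d ≠ blockStart k (l + 1) ⟨x, hxn⟩ := by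
      intro d hd h
      have h := congrArg Fin.val h
      simp only [blockStart] at h
      exact hx d hd (Nat.eq_of_mul_eq_mul_right (blk_pos _ _) h)
    have h := mul_card_collision_le (M := M) (D b) (blockStart k (l + 1)) _ hne
    have e : (Finset.univ.filter fun g : Fin n → Fin M => collide D k l g x b = true) =
        Finset.univ.filter fun g : Fin n → Fin M =>
          ∃ d ∈ D b, g (blockStart k (l + 1) d) = g (blockStart k (l + 1) ⟨x, hxn⟩) :=
      Finset.filter_congr fun g _ => by simp [collide, hxn]
    rw [e]
    rcases Nat.eq_zero_or_pos (D b).card with h0 | hpos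
    · rw [Finset.card_eq_zero] at h0
      simp [h0]
    · set C := (Finset.univ.filter fun g : Fin n → Fin M =>
          ∃ d ∈ D b, g (blockStart k (l + 1) d) = g (blockStart k (l + 1) ⟨x, hxn⟩)).card
      refine Nat.le_of_mul_le_mul_left ?_ hpos
      calc (D b).card * (4 * C) = 4 * (D b).card * C := by ring
        _ ≤ M * C := Nat.mul_le_mul_right _ (hM b hb)
        _ ≤ _ := h
  · have e : (Finset.univ.filter fun g : Fin n → Fin M => collide D k l g x b = true) = ∅ :=
      Finset.filter_eq_empty_iff.2 fun g _ => by simp [collide, hxn]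
    simp [e]

/-- The outcomes that determine the candidates, in terms of the random functions on the levels. -/
noncomputable def collisions (D : ℕ → Finset (Fin n)) (k : ℕ) (h : Fin Λ → Fin n → Fin M)
    (x l b : ℕ) : Bool :=
  if hl : l < Λ then collide D k l (h ⟨l, hl⟩) x b else false

theorem cand_hit_tableOf (ω : Seed n Λ M R m) (l : ℕ) :
    cand (hit (tableOf k ω) D) n Λ (2 ^ k) l = cand (collisions D k ω.1) n Λ (2 ^ k) l := by
  refine cand_congr (fun x hx l hl b _ => ?_) l
  simp only [hit, collisions, collide, dif_pos hl]
  refine decide_eq_decide.2 ?_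
  have h := nth_has (k := k) (ω := ω) hl ⟨x, hx⟩
  simp only [] at h
  simp only [h, Finset.Nonempty, Finset.mem_inter, mem_row_split hl (Fin.isLt _), Fin.ext_iff, hx,
    exists_true_left]
  exact ⟨fun ⟨d, h1, h2⟩ => ⟨d, h2, h1⟩, fun ⟨d, h1, h2⟩ => ⟨d, h2, h1⟩⟩

/-- The candidates of a level only depend on the random functions of the previous levels. -/
theorem cand_collisions_update (h : Fin Λ → Fin n → Fin M) (i : Fin Λ) (g : Fin n → Fin M) (l : ℕ)
    (hl : l ≤ i) :
    cand (collisions D k (Function.update h i g)) n Λ (2 ^ k) l =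
      cand (collisions D k h) n Λ (2 ^ k) l := by
  induction l with
  | zero => rfl
  | succ l ih =>
    rw [cand, cand, ih (by omega)]
    refine List.flatMap_congr fun u hu => ?_
    have hul := l_of_mem_cand hu
    have hi := i.isLt
    rw [Node.children_eq_filter (by omega), Node.children_eq_filter (by omega)]
    refine List.filter_congr fun v _ => ?_
    have hne : (⟨l, by omega⟩ : Fin Λ) ≠ i := fun h => by
      have := congrArg Fin.val h
      simp only [] at this
      omega
    simp only [collisions, hul, dif_pos (show l < Λ by omega), Function.update_of_ne hne]

/-- The candidates of the next level, for the random function `g` on it. -/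
noncomputable def nextLevel (D : ℕ → Finset (Fin n)) (k l : ℕ) (g : Fin n → Fin M)
    (q : List Node) : List Node :=
  q.flatMap fun u => (u.offspring n).filter fun v => collide D k l g v.x v.b

theorem cand_collisions_succ (h : Fin Λ → Fin n → Fin M) (i : Fin Λ) (g : Fin n → Fin M) :
    cand (collisions D k (Function.update h i g)) n Λ (2 ^ k) (i + 1) =
      nextLevel D k i g (cand (collisions D k h) n Λ (2 ^ k) i) := by
  rw [cand, cand_collisions_update h i g i le_rfl, nextLevel]
  refine List.flatMap_congr fun u hu => ?_
  have hul := l_of_mem_cand hu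
  rw [Node.children_eq_filter (by omega)]
  refine List.filter_congr fun v _ => ?_
  simp [collisions, hul]

theorem four_mul_sum_filter_le (hM : ∀ b ≤ 1, 4 * (D b).card ≤ M) {l : ℕ} (q : List Node)
    (hq : ∀ v ∈ q, v.b ≤ 1 ∧ v.l = l + 1) :
    4 * ∑ g : Fin n → Fin M, (q.filter fun v => collide D k l g v.x v.b).length ≤
      (4 * (q.map (load D k)).sum + q.length) * M ^ n := by
  induction q with
  | nil => simp
  | cons v q ih =>
    have ih := ih fun u hu => hq u (by simp [hu])
    obtain ⟨hb, hl⟩ := hq v (by simp)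
    have h1 : ∀ g : Fin n → Fin M, ((v :: q).filter fun v => collide D k l g v.x v.b).length =
        (if collide D k l g v.x v.b = true then 1 else 0) +
          (q.filter fun v => collide D k l g v.x v.b).length := by
      intro g
      rw [List.filter_cons]
      split_ifs <;> simp [add_comm]
    have h2 : 4 * (Finset.univ.filter fun g : Fin n → Fin M => collide D k l g v.x v.b = true).card
        ≤ (4 * load D k v + 1) * M ^ n := by
      rcases Nat.eq_zero_or_pos (load D k v) with h0 | hpos
      · rw [h0]
        simp only [mul_zero, zero_add, one_mul]
        refine four_mul_sum_collide_le hM hb fun d hd h => ?_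
        rw [load, Finset.card_eq_zero, Finset.filter_eq_empty_iff] at h0
        exact h0 hd (by rw [hl]; exact h)
      · have : (Finset.univ.filter fun g : Fin n → Fin M => collide D k l g v.x v.b = true).card
            ≤ M ^ n := (Finset.card_le_univ _).trans (by simp)
        calc _ ≤ 4 * M ^ n := Nat.mul_le_mul_left _ this
          _ ≤ _ := Nat.mul_le_mul_right _ (by omega)
    simp only [h1, Finset.sum_add_distrib, ← Finset.card_filter, List.map_cons, List.sum_cons,
      List.length_cons, mul_add, add_mul] at *
    linarith

theorem mem_offspring {u v : Node} (h : v ∈ u.offspring n) : v.b = u.b ∧ v.l = u.l + 1 := by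
  unfold Node.offspring at h
  split_ifs at h <;> simp at h <;> rcases h with rfl | rfl <;> simp

theorem offspring_length_le (u : Node) : (u.offspring n).length ≤ 2 := by
  unfold Node.offspring
  split_ifs <;> simp

/-- Offspring whose blocks contain hidden items number at most the total load of the level, since
each hidden item is in at most one of them. All other offspring, at most two per node, survive with
probability at most `1 / 4`. -/
theorem four_mul_sum_nextLevel_le (hM : ∀ b ≤ 1, 4 * (D b).card ≤ M) {l : ℕ} (q : List Node)
    (hq : ∀ u ∈ q, u.b ≤ 1 ∧ u.l = l ∧ u.w = 2 ^ k / 2 ^ l ∧ blk k l ∣ u.x) :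
    4 * ∑ g : Fin n → Fin M, (nextLevel D k l g q).length ≤
      (4 * (q.map (load D k)).sum + 2 * q.length) * M ^ n := by
  induction q with
  | nil => simp [nextLevel]
  | cons u q ih =>
    have ih := ih fun v hv => hq v (by simp [hv])
    obtain ⟨hb, hl, hw, hx⟩ := hq u (by simp)
    have h1 := four_mul_sum_filter_le (k := k) hM (l := l) (u.offspring n) fun v hv => by
      obtain ⟨h1, h2⟩ := mem_offspring hv
      omega
    have h2 := offspring_length_le (n := n) u
    have h3 := sum_load_offspring_le (n := n) (D := D) (by rw [hw, hl]) (by rwa [hl])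
    have h4 : (4 * ((u.offspring n).map (load D k)).sum + (u.offspring n).length) * M ^ n ≤
        (4 * load D k u + 2) * M ^ n := Nat.mul_le_mul_right _ (by omega)
    simp only [nextLevel, List.flatMap_cons, List.length_append, Finset.sum_add_distrib,
      List.map_cons, List.sum_cons, List.length_cons, mul_add, add_mul, mul_one] at *
    linarith

/-- On each level, the expected number of candidates is at most `4 s`. -/
theorem sum_length_cand_le (hM : ∀ b ≤ 1, 4 * (D b).card ≤ M) (hD : (D 0).card + (D 1).card ≤ 2 * s)
    (hroots : (roots n (2 ^ k)).length ≤ 2 * s) (l : ℕ) (hl : l ≤ Λ) :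
    ∑ h : Fin Λ → Fin n → Fin M, (cand (collisions D k h) n Λ (2 ^ k) l).length ≤
      4 * s * Fintype.card (Fin Λ → Fin n → Fin M) := by
  induction l with
  | zero =>
    calc _ ≤ ∑ h : Fin Λ → Fin n → Fin M, 4 * s :=
          Finset.sum_le_sum fun _ _ => hroots.trans (by omega)
      _ = _ := by rw [Finset.sum_const, smul_eq_mul, mul_comm]; rfl
  | succ l ih =>
    have ih := ih (by omega)
    rcases Nat.eq_zero_or_pos (M ^ n) with h0 | hpos
    · have : IsEmpty (Fin n → Fin M) := by
        rw [← Fintype.card_eq_zero_iff]; simpa using h0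
      have : IsEmpty (Fin Λ → Fin n → Fin M) := ⟨fun h => IsEmpty.false (h ⟨l, by omega⟩)⟩
      simp
    · have hu := card_mul_sum_eq_sum_update (⟨l, by omega⟩ : Fin Λ)
        fun h : Fin Λ → Fin n → Fin M => (cand (collisions D k h) n Λ (2 ^ k) (l + 1)).length
      have hc : Fintype.card (Fin n → Fin M) = M ^ n := by simp
      have he : ∀ (h : Fin Λ → Fin n → Fin M) (g : Fin n → Fin M), cand (collisions D k
          (Function.update h (⟨l, by omega⟩ : Fin Λ) g)) n Λ (2 ^ k) (l + 1) =
          nextLevel D k l g (cand (collisions D k h) n Λ (2 ^ k) l) :=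
        fun h g => cand_collisions_succ h ⟨l, by omega⟩ g
      simp only [he, hc] at hu
      refine Nat.le_of_mul_le_mul_left ?_ (show 0 < 4 * M ^ n by omega)
      calc _ = ∑ h : Fin Λ → Fin n → Fin M, 4 * ∑ g : Fin n → Fin M,
            (nextLevel D k l g (cand (collisions D k h) n Λ (2 ^ k) l)).length := by
            rw [mul_assoc, hu, Finset.mul_sum]
        _ ≤ ∑ h : Fin Λ → Fin n → Fin M,
            (8 * s + 2 * (cand (collisions D k h) n Λ (2 ^ k) l).length) * M ^ n := by
            refine Finset.sum_le_sum fun h _ => (four_mul_sum_nextLevel_le hM _ fun u hu => ?_).trans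
              (Nat.mul_le_mul_right _ ?_)
            · have h1 := shape_of_mem_cand hu
              exact ⟨(bounds_of_mem_cand hu).2.2, l_of_mem_cand hu, h1.1, h1.2⟩
            · have := sum_load_cand_le (n := n) (Λ := Λ) (D := D) (k := k)
                (pos := collisions D k h) l (by omega)
              omega
        _ = (8 * s * Fintype.card (Fin Λ → Fin n → Fin M) + 2 *
            ∑ h : Fin Λ → Fin n → Fin M, (cand (collisions D k h) n Λ (2 ^ k) l).length) * M ^ n := by
            rw [← Finset.sum_mul, Finset.sum_add_distrib, Finset.mul_sum, Finset.sum_const,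
              Finset.card_univ, smul_eq_mul, mul_comm (8 * s)]
        _ ≤ (8 * s * Fintype.card (Fin Λ → Fin n → Fin M) + 2 *
            (4 * s * Fintype.card (Fin Λ → Fin n → Fin M))) * M ^ n :=
            Nat.mul_le_mul_right _ (by omega)
        _ = _ := by ring

theorem length_flatMap_range {α : Type*} (f : ℕ → List α) (J : ℕ) :
    ((List.range J).flatMap f).length = ∑ j ∈ Finset.range J, (f j).length := by
  induction J with
  | zero => simp
  | succ J ih => simp [List.range_succ, ih, Finset.sum_range_succ]

theorem sum_length_allCand_le (hM : ∀ b ≤ 1, 4 * (D b).card ≤ M)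
    (hD : (D 0).card + (D 1).card ≤ 2 * s) (hroots : (roots n (2 ^ k)).length ≤ 2 * s) :
    ∑ h : Fin Λ → Fin n → Fin M, (allCand (collisions D k h) n Λ (2 ^ k)).length ≤
      4 * s * (Λ + 1) * Fintype.card (Fin Λ → Fin n → Fin M) := by
  have h1 : ∀ h : Fin Λ → Fin n → Fin M, (allCand (collisions D k h) n Λ (2 ^ k)).length =
      ∑ l ∈ Finset.range (Λ + 1), (cand (collisions D k h) n Λ (2 ^ k) l).length := by
    exact fun h => length_flatMap_range _ _
  simp only [h1]
  rw [Finset.sum_comm]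
  calc _ ≤ ∑ l ∈ Finset.range (Λ + 1), 4 * s * Fintype.card (Fin Λ → Fin n → Fin M) :=
        Finset.sum_le_sum fun l hl =>
          sum_length_cand_le hM hD hroots l (by have := Finset.mem_range.1 hl; omega)
    _ = _ := by rw [Finset.sum_const, Finset.card_range, smul_eq_mul]; ring

end Expectation

/-! ### False leaves, the worst case, and trials -/

section Leaves

variable {n M Λ R m k s : ℕ} {D : ℕ → Finset (Fin n)}

/-- The nodes without hidden items. -/
noncomputable def falseNodes (D : ℕ → Finset (Fin n)) (k : ℕ) (q : List Node) : List Node :=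
  q.filter fun u => load D k u = 0

theorem four_mul_sum_falseNodes_nextLevel_le (hM : ∀ b ≤ 1, 4 * (D b).card ≤ M) {l : ℕ}
    (hk : k ≤ l) (q : List Node) (hq : ∀ u ∈ q, u.b ≤ 1 ∧ u.l = l ∧ u.w = 2 ^ k / 2 ^ l) :
    4 * ∑ g : Fin n → Fin M, (falseNodes D k (nextLevel D k l g q)).length ≤
      (falseNodes D k q).length * M ^ n := by
  induction q with
  | nil => simp [nextLevel, falseNodes]
  | cons u q ih =>
    have ih := ih fun v hv => hq v (by simp [hv])
    obtain ⟨hb, hl, hw⟩ := hq u (by simp)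
    have hw0 : u.w / 2 = 0 := by
      rw [hw, Nat.div_div_eq_div_mul, ← pow_succ, two_pow_div_of_lt (by omega)]
    have ho : u.offspring n = [⟨u.x, u.l + 1, u.w / 2, u.b⟩] := by
      rw [Node.offspring, if_neg (by omega)]
    have hload : load D k ⟨u.x, u.l + 1, u.w / 2, u.b⟩ = load D k u := by
      simp [load, hl, blk_of_le hk, blk_of_le (show k ≤ l + 1 by omega)]
    have h1 : ∀ g : Fin n → Fin M, (falseNodes D k (nextLevel D k l g (u :: q))).length =
        (if load D k u = 0 ∧ collide D k l g u.x u.b = true then 1 else 0) +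
          (falseNodes D k (nextLevel D k l g q)).length := by
      intro g
      rw [nextLevel, List.flatMap_cons, ho, falseNodes, List.filter_append, List.length_append,
        List.filter_cons, List.filter_nil]
      by_cases hc : collide D k l g u.x u.b = true
      · by_cases h0 : load D k u = 0 <;> simp [hc, hload, h0, falseNodes, nextLevel]
      · simp [hc, falseNodes, nextLevel]
    have h2 : (falseNodes D k (u :: q)).length =
        (if load D k u = 0 then 1 else 0) + (falseNodes D k q).length := by
      rw [falseNodes, List.filter_cons]
      by_cases h0 : load D k u = 0 <;> simp [h0, falseNodes, add_comm]
    simp only [h1, h2, Finset.sum_add_distrib, mul_add, add_mul]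
    refine add_le_add ?_ ih
    by_cases h0 : load D k u = 0
    · simp only [h0, true_and, if_true, one_mul, ← Finset.card_filter]
      refine four_mul_sum_collide_le hM hb fun d hd h => ?_
      rw [load, Finset.card_eq_zero, Finset.filter_eq_empty_iff] at h0
      refine h0 hd ?_
      rw [blk_of_le (by omega)] at h ⊢
      exact h
    · simp [h0]

/-- On the levels with single items, each level divides the expected number of false candidates
by `4`. -/
theorem four_pow_mul_sum_falseNodes_le (hM : ∀ b ≤ 1, 4 * (D b).card ≤ M)
    (hD : (D 0).card + (D 1).card ≤ 2 * s)
    (hroots : (roots n (2 ^ k)).length ≤ 2 * s) (j : ℕ) (hj : k + j ≤ Λ) :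
    4 ^ j * ∑ h : Fin Λ → Fin n → Fin M,
        (falseNodes D k (cand (collisions D k h) n Λ (2 ^ k) (k + j))).length ≤
      4 * s * Fintype.card (Fin Λ → Fin n → Fin M) := by
  induction j with
  | zero =>
    rw [pow_zero, one_mul]
    exact (Finset.sum_le_sum fun _ _ => List.length_filter_le _ _).trans
      (sum_length_cand_le hM hD hroots k (by omega))
  | succ j ih =>
    have ih := ih (by omega)
    rcases Nat.eq_zero_or_pos (M ^ n) with h0 | hpos
    · have : IsEmpty (Fin n → Fin M) := by
        rw [← Fintype.card_eq_zero_iff]; simpa using h0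
      have : IsEmpty (Fin Λ → Fin n → Fin M) := ⟨fun h => IsEmpty.false (h ⟨k + j, by omega⟩)⟩
      simp
    · have hu := card_mul_sum_eq_sum_update (⟨k + j, by omega⟩ : Fin Λ)
        fun h : Fin Λ → Fin n → Fin M =>
          (falseNodes D k (cand (collisions D k h) n Λ (2 ^ k) (k + j + 1))).length
      have hc : Fintype.card (Fin n → Fin M) = M ^ n := by simp
      have he : ∀ (h : Fin Λ → Fin n → Fin M) (g : Fin n → Fin M), cand (collisions D k
          (Function.update h (⟨k + j, by omega⟩ : Fin Λ) g)) n Λ (2 ^ k) (k + j + 1) =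
          nextLevel D k (k + j) g (cand (collisions D k h) n Λ (2 ^ k) (k + j)) :=
        fun h g => cand_collisions_succ h ⟨k + j, by omega⟩ g
      simp only [he, hc] at hu
      refine Nat.le_of_mul_le_mul_left (le_trans ?_ (Nat.mul_le_mul_left (M ^ n) ih)) hpos
      calc _ = 4 ^ j * ∑ h : Fin Λ → Fin n → Fin M, 4 * ∑ g : Fin n → Fin M,
            (falseNodes D k (nextLevel D k (k + j) g
              (cand (collisions D k h) n Λ (2 ^ k) (k + j)))).length := by
            rw [← Finset.mul_sum, ← hu, ← add_assoc]; ring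
        _ ≤ 4 ^ j * ∑ h : Fin Λ → Fin n → Fin M,
            (falseNodes D k (cand (collisions D k h) n Λ (2 ^ k) (k + j))).length * M ^ n := by
            refine Nat.mul_le_mul_left _ (Finset.sum_le_sum fun h _ =>
              four_mul_sum_falseNodes_nextLevel_le hM (by omega) _ fun u hu => ?_)
            exact ⟨(bounds_of_mem_cand hu).2.2, l_of_mem_cand hu, (shape_of_mem_cand hu).1⟩
        _ = _ := by rw [← Finset.sum_mul]; ring

theorem noFalseLeaf_of_falseNodes_eq_nil {ω : Seed n Λ M R m} (hk : k ≤ Λ)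
    (h : (falseNodes D k (cand (collisions D k ω.1) n Λ (2 ^ k) Λ)).length = 0) :
    NoFalseLeaf (tableOf k ω) D k Λ := by
  intro u hu
  rw [cand_hit_tableOf] at hu
  rw [List.length_eq_zero_iff, falseNodes, List.filter_eq_nil_iff] at h
  have h := h u hu
  rw [decide_eq_true_eq, load, Finset.card_eq_zero, ← ne_eq, ← Finset.nonempty_iff_ne_empty] at h
  obtain ⟨d, hd⟩ := h
  rw [Finset.mem_filter, l_of_mem_cand hu, blk_of_le hk, Nat.div_one, Nat.div_one] at hd
  exact ⟨d, hd⟩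

/-- The number of candidates never exceeds that of the nodes of the complete tree. -/
theorem length_cand_le {pos : ℕ → ℕ → ℕ → Bool} (hroots : (roots n (2 ^ k)).length ≤ 2 * s) (l : ℕ)
    (hl : l ≤ Λ) : (cand pos n Λ (2 ^ k) l).length ≤ 2 ^ l * (2 * s) := by
  induction l with
  | zero =>
    rw [pow_zero, one_mul]
    exact hroots
  | succ l ih =>
    have : ∀ q : List Node, (∀ u ∈ q, u ∈ cand pos n Λ (2 ^ k) l) →
        (q.flatMap (Node.children pos n Λ)).length ≤ 2 * q.length := by
      intro q
      induction q with
      | nil => simp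
      | cons u q ihq =>
        intro hq
        have h1 := ihq fun v hv => hq v (by simp [hv])
        have h2 : (u.children pos n Λ).length ≤ 2 := by
          rw [Node.children_eq_filter (by rw [l_of_mem_cand (hq u (by simp))]; omega)]
          exact (List.length_filter_le _ _).trans (offspring_length_le u)
        rw [List.flatMap_cons, List.length_append, List.length_cons]
        omega
    have h1 := this _ fun u hu => hu
    have h2 := ih (by omega)
    rw [cand, pow_succ]
    linarith

/-- The complete tree without further levels of single items has fewer than `2 ^ k * (4 * s)` nodes.
-/
theorem length_allCand_lt {pos : ℕ → ℕ → ℕ → Bool} (hs : 1 ≤ s)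
    (hroots : (roots n (2 ^ k)).length ≤ 2 * s) :
    (allCand pos n k (2 ^ k)).length < 2 ^ k * (4 * s) := by
  rw [allCand, length_flatMap_range]
  calc _ ≤ ∑ l ∈ Finset.range (k + 1), 2 ^ l * (2 * s) := Finset.sum_le_sum fun l hl =>
        length_cand_le hroots l (by have := Finset.mem_range.1 hl; omega)
    _ = (∑ l ∈ Finset.range (k + 1), 2 ^ l) * (2 * s) := by rw [Finset.sum_mul]
    _ < 2 ^ (k + 1) * (2 * s) := by
        refine Nat.mul_lt_mul_of_pos_right ?_ (by omega)
        have := Nat.geomSum_lt (m := 2) le_rfl (n := k + 1) (s := Finset.range (k + 1))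
          (fun i hi => Finset.mem_range.1 hi)
        exact this
    _ = _ := by ring

end Leaves

section Trials

variable {n m s : ℕ} {S₁ S₂ : Finset (Fin n)}

/-- The value `0` is taken by items of the first hidden set only, and the value `1` by items of the
second one only. -/
def Separates (S₁ S₂ : Finset (Fin n)) (κ : Fin n → Fin m) : Prop :=
  (∃ a ∈ S₁, (κ a).val = 0) ∧ (∃ b ∈ S₂, (κ b).val = 1) ∧
    (∀ a ∈ S₁, (κ a).val ≠ 1) ∧ (∀ b ∈ S₂, (κ b).val ≠ 0)

theorem goodTrial_of_separates {Λ M R k r : ℕ} {ω : Seed n Λ M R m} (hr : r < R)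
    (h : Separates S₁ S₂ (ω.2 ⟨r, hr⟩)) : GoodTrial S₁ S₂ (tableOf k ω) (Λ * M) r := by
  obtain ⟨⟨a, ha, ha0⟩, ⟨b, hb, hb1⟩, h1, h2⟩ := h
  have e0 : ∀ x, x ∈ (tableOf k ω).row (Λ * M + 2 * r) ↔ (ω.2 ⟨r, hr⟩ x).val = 0 :=
    mem_row_trial hr (b := 0) (by norm_num)
  have e1 : ∀ x, x ∈ (tableOf k ω).row (Λ * M + 2 * r + 1) ↔ (ω.2 ⟨r, hr⟩ x).val = 1 :=
    mem_row_trial hr (b := 1) (by norm_num)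
  refine ⟨?_, ?_, ?_⟩
  · simp only [testOutcome, decide_eq_false_iff_not, not_and_or]
    refine .inr ?_
    rintro ⟨x, hx⟩
    rw [Finset.mem_inter, e0] at hx
    exact h2 x hx.2 hx.1
  · simp only [testOutcome, decide_eq_false_iff_not, not_and_or]
    refine .inl ?_
    rintro ⟨x, hx⟩
    rw [Finset.mem_inter, e1] at hx
    exact h1 x hx.2 hx.1
  · simp only [testOutcome, decide_eq_true_eq]
    exact ⟨⟨a, by simp [e0, ha, ha0]⟩, ⟨b, by simp [e1, hb, hb1]⟩⟩

/-- If `j ≤ m / 4`, then `j` independent random values out of `m` ones avoid two given values with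
probability at least `1 / 2`. -/
theorem pow_le_two_mul_sub_pow {j : ℕ} (hm : 2 ≤ m) (h : 4 * j ≤ m) : m ^ j ≤ 2 * (m - 2) ^ j := by
  have hm0 : (0 : ℝ) < m := by exact_mod_cast (by omega : 0 < m)
  have hm2 : (2 : ℝ) ≤ m := by exact_mod_cast hm
  have h4 : (4 : ℝ) * j ≤ m := by exact_mod_cast h
  have hle : (-2 : ℝ) ≤ -(2 / m) := by
    rw [neg_le_neg_iff, div_le_iff₀ hm0]; linarith
  have hb := one_add_mul_le_pow hle j
  have h2 : (1 : ℝ) / 2 ≤ 1 + j * -(2 / m) := by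
    have : (j : ℝ) * (2 / m) ≤ 1 / 2 := by
      rw [mul_div_assoc', div_le_iff₀ hm0]; linarith
    linarith
  have h3 : (m : ℝ) ^ j ≤ 2 * (m - 2) ^ j := by
    have : ((m : ℝ) - 2) ^ j = m ^ j * (1 + -(2 / m)) ^ j := by
      rw [← mul_pow]; congr 1; field_simp; ring
    rw [this]
    have := mul_le_mul_of_nonneg_left (h2.trans hb) (pow_nonneg hm0.le j)
    linarith
  have : ((m ^ j : ℕ) : ℝ) ≤ ((2 * (m - 2) ^ j : ℕ) : ℝ) := by
    push_cast [Nat.cast_sub hm]; exact h3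
  exact_mod_cast this

open Classical in
/-- A random function to `m` values separates the hidden sets with probability at least
`s₁ s₂ / (2 m ^ 2)`, which is `s₁ s₂ / (128 s ^ 2)` for `m = 8 s`: for each pair of items, one of
each set, the probability that these have the values `0` and `1` and that no other hidden item has
such a value is at least `1 / (2 m ^ 2)`. -/
theorem card_separates_ge (hdisj : Disjoint S₁ S₂) (hm : 2 ≤ m)
    (h : 4 * (S₁.card + S₂.card) ≤ m) :
    S₁.card * S₂.card * m ^ n ≤
      2 * m ^ 2 * (Finset.univ.filter fun κ : Fin n → Fin m => Separates S₁ S₂ κ).card := by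
  let t : Fin n × Fin n → Fin n → Finset (Fin m) := fun p x =>
    if x = p.1 then {⟨0, by omega⟩} else if x = p.2 then {⟨1, by omega⟩}
    else if x ∈ S₁ ∪ S₂ then Finset.univ \ {⟨0, by omega⟩, ⟨1, by omega⟩} else Finset.univ
  let E : Fin n × Fin n → Finset (Fin n → Fin m) := fun p => Fintype.piFinset (t p)
  have hmem : ∀ p ∈ S₁ ×ˢ S₂, ∀ κ ∈ E p, (κ p.1).val = 0 ∧ (κ p.2).val = 1 ∧
      ∀ x ∈ S₁ ∪ S₂, x ≠ p.1 → x ≠ p.2 → (κ x).val ≠ 0 ∧ (κ x).val ≠ 1 := by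
    intro p hp κ hκ
    rw [Finset.mem_product] at hp
    have hne : p.2 ≠ p.1 := fun h => Finset.disjoint_left.1 hdisj hp.1 (h ▸ hp.2)
    have hκ := fun x => Fintype.mem_piFinset.1 hκ x
    refine ⟨?_, ?_, fun x hx h1 h2 => ?_⟩
    · have := hκ p.1
      simp only [t, if_true, Finset.mem_singleton] at this
      rw [this]
    · have := hκ p.2
      simp only [t, if_neg hne, if_true, Finset.mem_singleton] at this
      rw [this]
    · have := hκ x
      simp only [t, if_neg h1, if_neg h2, if_pos hx] at this
      simpa [Fin.ext_iff] using this
  have hsub : (S₁ ×ˢ S₂).biUnion E ⊆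
      Finset.univ.filter fun κ : Fin n → Fin m => Separates S₁ S₂ κ := by
    intro κ hκ
    obtain ⟨p, hp, hκ⟩ := Finset.mem_biUnion.1 hκ
    obtain ⟨h0, h1, h2⟩ := hmem p hp κ hκ
    rw [Finset.mem_product] at hp
    refine Finset.mem_filter.2 ⟨Finset.mem_univ _, ⟨p.1, hp.1, h0⟩, ⟨p.2, hp.2, h1⟩, ?_, ?_⟩
    · intro a ha
      by_cases ha1 : a = p.1
      · rw [ha1, h0]; norm_num
      · exact (h2 a (by simp [ha]) ha1 fun h =>
          Finset.disjoint_left.1 hdisj ha (h ▸ hp.2)).2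
    · intro b hb
      by_cases hb1 : b = p.2
      · rw [hb1, h1]; norm_num
      · exact (h2 b (by simp [hb]) (fun h =>
          Finset.disjoint_left.1 hdisj hp.1 (h ▸ hb)) hb1).1
  have hdis : ∀ p ∈ S₁ ×ˢ S₂, ∀ p' ∈ S₁ ×ˢ S₂, p ≠ p' → Disjoint (E p) (E p') := by
    intro p hp p' hp' hne
    refine Finset.disjoint_left.2 fun κ hκ hκ' => hne ?_
    obtain ⟨h0, h1, h2⟩ := hmem p hp κ hκ
    obtain ⟨h0', h1', -⟩ := hmem p' hp' κ hκ'
    rw [Finset.mem_product] at hp hp'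
    refine Prod.ext ?_ ?_
    · by_contra hc
      exact (h2 p'.1 (by simp [hp'.1]) (Ne.symm hc) fun h =>
        Finset.disjoint_left.1 hdisj hp'.1 (h ▸ hp.2)).1 h0'
    · by_contra hc
      exact (h2 p'.2 (by simp [hp'.2]) (fun h =>
        Finset.disjoint_left.1 hdisj hp.1 (h ▸ hp'.2)) (Ne.symm hc)).2 h1'
  have hcard : ∀ p ∈ S₁ ×ˢ S₂, m ^ n ≤ 2 * m ^ 2 * (E p).card := by
    intro p hp
    rw [Finset.mem_product] at hp
    have hne : p.1 ≠ p.2 := fun h => Finset.disjoint_left.1 hdisj hp.1 (h ▸ hp.2)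
    set U := ((S₁ ∪ S₂).erase p.1).erase p.2 with hU
    have h1 : (E p).card = (m - 2) ^ U.card * m ^ (n - 2 - U.card) := by
      have hco : (((Finset.univ.erase p.1).erase p.2) \ U).card = n - 2 - U.card := by
        rw [Finset.card_sdiff_of_subset]
        · rw [Finset.card_erase_of_mem (by simp [hne.symm]), Finset.card_erase_of_mem (by simp),
            Finset.card_univ, Fintype.card_fin]
          omega
        · exact Finset.erase_subset_erase _ (Finset.erase_subset_erase _ (Finset.subset_univ _))
      simp only [E, Fintype.card_piFinset]
      rw [← Finset.mul_prod_erase _ _ (Finset.mem_univ p.1),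
        ← Finset.mul_prod_erase (Finset.univ.erase p.1) _ (a := p.2) (by simp [hne.symm]),
        ← Finset.prod_sdiff (s₁ := U) (s₂ := (Finset.univ.erase p.1).erase p.2)
          (Finset.erase_subset_erase _ (Finset.erase_subset_erase _ (Finset.subset_univ _)))]
      have a1 : (t p p.1).card = 1 := by simp [t]
      have a2 : (t p p.2).card = 1 := by simp [t, hne.symm]
      have a3 : ∀ x ∈ U, (t p x).card = m - 2 := by
        intro x hx
        simp only [hU, Finset.mem_erase] at hx
        simp only [t, if_neg hx.1, if_neg hx.2.1, if_pos hx.2.2]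
        rw [Finset.card_sdiff_of_subset (Finset.subset_univ _), Finset.card_pair (by simp)]
        simp
      have a4 : ∀ x ∈ ((Finset.univ.erase p.1).erase p.2) \ U, (t p x).card = m := by
        intro x hx
        simp only [hU, Finset.mem_sdiff, Finset.mem_erase, Finset.mem_univ, not_and, and_true] at hx
        simp only [t, if_neg hx.1.1, if_neg hx.1.2, if_neg (hx.2 hx.1.1 hx.1.2)]
        simp
      rw [a1, a2, Finset.prod_congr rfl a3, Finset.prod_congr rfl a4, Finset.prod_const,
        Finset.prod_const, hco]
      ring
    have h2 : U.card + 2 ≤ n := by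
      have := Finset.card_le_univ (insert p.1 (insert p.2 U))
      rw [Finset.card_insert_of_notMem (by simp [hU, hne]),
        Finset.card_insert_of_notMem (by simp [hU]), Fintype.card_fin] at this
      omega
    have h3 : U.card ≤ S₁.card + S₂.card :=
      (Finset.card_le_card ((Finset.erase_subset _ _).trans (Finset.erase_subset _ _))).trans
        (Finset.card_union_le _ _)
    have h4 := pow_le_two_mul_sub_pow (j := U.card) hm (by omega)
    calc m ^ n = m ^ 2 * m ^ (n - 2 - U.card) * m ^ U.card := by
          rw [← pow_add, ← pow_add]; congr 1; omega
      _ ≤ m ^ 2 * m ^ (n - 2 - U.card) * (2 * (m - 2) ^ U.card) := Nat.mul_le_mul_left _ h4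
      _ = _ := by rw [h1]; ring
  calc S₁.card * S₂.card * m ^ n = ∑ p ∈ S₁ ×ˢ S₂, m ^ n := by
        rw [Finset.sum_const, Finset.card_product, smul_eq_mul]
    _ ≤ ∑ p ∈ S₁ ×ˢ S₂, 2 * m ^ 2 * (E p).card := Finset.sum_le_sum hcard
    _ = 2 * m ^ 2 * ((S₁ ×ˢ S₂).biUnion E).card := by
        rw [Finset.card_biUnion hdis, Finset.mul_sum]
    _ ≤ _ := Nat.mul_le_mul_left _ (Finset.card_le_card hsub)

open Classical in
/-- All of `R` independent trials fail with probability at most `exp (-q R)`, if each of them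
succeeds with probability at least `q`. -/
theorem card_forall_not_le {Ω : Type*} [Fintype Ω] [DecidableEq Ω] (p : Ω → Prop) {q : ℝ}
    (h : q * Fintype.card Ω ≤ (Finset.univ.filter p).card) (R : ℕ) :
    ((Finset.univ.filter fun κ : Fin R → Ω => ∀ r, ¬ p (κ r)).card : ℝ) ≤
      Real.exp (-(q * R)) * Fintype.card (Fin R → Ω) := by
  have h1 : (Finset.univ.filter fun κ : Fin R → Ω => ∀ r, ¬ p (κ r)) =
      Fintype.piFinset fun _ => Finset.univ.filter fun x => ¬ p x := by
    ext κ; simp [Fintype.mem_piFinset]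
  have h2 : ((Finset.univ.filter fun x => ¬ p x).card : ℝ) ≤ Real.exp (-q) * Fintype.card Ω := by
    have h3 := Finset.card_filter_add_card_filter_not (s := (Finset.univ : Finset Ω)) p
    rw [Finset.card_univ] at h3
    have h3 : ((Finset.univ.filter p).card : ℝ) + (Finset.univ.filter fun x => ¬ p x).card =
      Fintype.card Ω := by exact_mod_cast h3
    have h4 := mul_le_mul_of_nonneg_right (Real.add_one_le_exp (-q))
      (Nat.cast_nonneg (Fintype.card Ω) : (0 : ℝ) ≤ _)
    linarith
  rw [h1, Fintype.card_piFinset, Finset.prod_const, Finset.card_univ, Fintype.card_fin,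
    Fintype.card_fun, Fintype.card_fin]
  push_cast
  calc _ ≤ (Real.exp (-q) * Fintype.card Ω) ^ R := pow_le_pow_left₀ (by positivity) h2 R
    _ = _ := by rw [mul_pow, ← Real.exp_nat_mul]; congr 2; ring

end Trials

/-! ### Failure probabilities -/

section Failure

variable {n M Λ R m k s ρ γ : ℕ} {S₁ S₂ : Finset (Fin n)} {D : ℕ → Finset (Fin n)}

theorem sum_seed_fst (f : (Fin Λ → Fin n → Fin M) → ℕ) :
    ∑ ω : Seed n Λ M R m, f ω.1 = Fintype.card (Fin R → Fin n → Fin m) * ∑ h, f h := by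
  rw [Fintype.sum_prod_type, Finset.mul_sum]
  simp only [Finset.sum_const, Finset.card_univ, smul_eq_mul]

theorem card_seed : Fintype.card (Seed n Λ M R m) =
    Fintype.card (Fin Λ → Fin n → Fin M) * Fintype.card (Fin R → Fin n → Fin m) :=
  Fintype.card_prod _ _

theorem IsOrder.card_le (h : IsOrder S₁ S₂ D) (h₁ : S₁.card ≤ s) (h₂ : S₂.card ≤ s) (b : ℕ) :
    (D b).card ≤ s := by
  rcases h with rfl | rfl <;> unfold tagged <;> split_ifs <;> assumption

theorem sum_length_allCand_tableOf_le (h : ∀ b, (D b).card ≤ s)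
    (hroots : (roots n (2 ^ k)).length ≤ 2 * s) :
    ∑ ω : Seed n Λ (4 * s) R m, (allCand (hit (tableOf k ω) D) n Λ (2 ^ k)).length ≤
      4 * s * (Λ + 1) * Fintype.card (Seed n Λ (4 * s) R m) := by
  have e : ∀ ω : Seed n Λ (4 * s) R m, allCand (hit (tableOf k ω) D) n Λ (2 ^ k) =
      allCand (collisions D k ω.1) n Λ (2 ^ k) := fun ω =>
    List.flatMap_congr fun l _ => cand_hit_tableOf ω l
  simp only [e]
  rw [sum_seed_fst fun f => (allCand (collisions D k f) n Λ (2 ^ k)).length, card_seed]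
  have h1 := sum_length_allCand_le (Λ := Λ) (M := 4 * s) (D := D) (k := k) (s := s)
    (fun b _ => by have := h b; omega) (by have := h 0; have := h 1; omega) hroots
  calc _ ≤ Fintype.card (Fin R → Fin n → Fin m) *
        (4 * s * (Λ + 1) * Fintype.card (Fin Λ → Fin n → Fin (4 * s))) := Nat.mul_le_mul_left _ h1
    _ = _ := by ring

open Classical in
/-- Markov's inequality for the number of candidates. -/
theorem card_overBudget_le (h : ∀ b, (D b).card ≤ s) (hs : 1 ≤ s)
    (hroots : (roots n (2 ^ k)).length ≤ 2 * s) :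
    1000 * (Finset.univ.filter fun ω : Seed n Λ (4 * s) R m =>
      4000 * (s * (Λ + 1)) ≤ (allCand (hit (tableOf k ω) D) n Λ (2 ^ k)).length).card ≤
      Fintype.card (Seed n Λ (4 * s) R m) := by
  set A := Finset.univ.filter fun ω : Seed n Λ (4 * s) R m =>
      4000 * (s * (Λ + 1)) ≤ (allCand (hit (tableOf k ω) D) n Λ (2 ^ k)).length with hA
  have hpos : 0 < 4 * s * (Λ + 1) := by positivity
  refine Nat.le_of_mul_le_mul_left ?_ hpos
  calc 4 * s * (Λ + 1) * (1000 * A.card) = ∑ ω ∈ A, 4000 * (s * (Λ + 1)) := by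
        rw [Finset.sum_const, smul_eq_mul]; ring
    _ ≤ ∑ ω ∈ A, (allCand (hit (tableOf k ω) D) n Λ (2 ^ k)).length :=
        Finset.sum_le_sum fun ω hω => (Finset.mem_filter.1 hω).2
    _ ≤ ∑ ω : Seed n Λ (4 * s) R m, (allCand (hit (tableOf k ω) D) n Λ (2 ^ k)).length :=
        Finset.sum_le_sum_of_subset (Finset.subset_univ _)
    _ ≤ _ := sum_length_allCand_tableOf_le h hroots

open Classical in
/-- With `G` further levels of single items, where `γ n ≤ 2 ^ G`, there is a false candidate on the
last level with probability at most `4 / γ`. -/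
theorem card_falseLeaf_le (h : ∀ b, (D b).card ≤ s) (hsn : s ≤ n) (hn : 0 < n)
    (hroots : (roots n (2 ^ k)).length ≤ 2 * s) {G : ℕ} (hΛ : Λ = k + G) (hG : γ * n ≤ 2 ^ G) :
    γ * (Finset.univ.filter fun ω : Seed n Λ (4 * s) R m =>
      ¬ NoFalseLeaf (tableOf k ω) D k Λ).card ≤ 4 * Fintype.card (Seed n Λ (4 * s) R m) := by
  subst hΛ
  set A := Finset.univ.filter fun ω : Seed n (k + G) (4 * s) R m =>
      ¬ NoFalseLeaf (tableOf k ω) D k (k + G) with hA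
  have h1 := four_pow_mul_sum_falseNodes_le (Λ := k + G) (M := 4 * s) (D := D) (k := k) (s := s)
    (fun b _ => by have := h b; omega) (by have := h 0; have := h 1; omega) hroots G le_rfl
  have h2 : A.card ≤ ∑ ω : Seed n (k + G) (4 * s) R m,
      (falseNodes D k (cand (collisions D k ω.1) n (k + G) (2 ^ k) (k + G))).length := by
    rw [Finset.card_eq_sum_ones]
    refine (Finset.sum_le_sum fun ω hω => ?_).trans
      (Finset.sum_le_sum_of_subset (Finset.subset_univ A))
    refine Nat.one_le_iff_ne_zero.2 fun h0 => (Finset.mem_filter.1 hω).2 ?_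
    exact noFalseLeaf_of_falseNodes_eq_nil (by omega) h0
  rw [sum_seed_fst fun f => (falseNodes D k (cand (collisions D k f) n _ (2 ^ k) _)).length] at h2
  have h3 : γ * n ≤ 4 ^ G := hG.trans (Nat.pow_le_pow_left (by norm_num) _)
  refine Nat.le_of_mul_le_mul_left ?_ hn
  rw [card_seed]
  calc n * (γ * A.card) = γ * n * A.card := by ring
    _ ≤ 4 ^ G * _ := Nat.mul_le_mul h3 h2
    _ = Fintype.card (Fin R → Fin n → Fin m) * (4 ^ G * _) := by ring
    _ ≤ Fintype.card (Fin R → Fin n → Fin m) *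
        (4 * n * Fintype.card (Fin (k + G) → Fin n → Fin (4 * s))) :=
        Nat.mul_le_mul_left _ (h1.trans (Nat.mul_le_mul_right _ (by omega)))
    _ = _ := by ring

theorem mul_trials_ge {s₁ s₂ : ℕ} (h₁ : 1 ≤ s₁) (h₂ : 1 ≤ s₂) (hs : max s₁ s₂ = s) :
    (ρ : ℝ) / 128 ≤ (s₁ * s₂ : ℝ) / (128 * s ^ 2) * trials ρ s₁ s₂ := by
  have hm : 1 ≤ min s₁ s₂ := le_min h₁ h₂
  have hs1 : 1 ≤ s := hs ▸ h₁.trans (le_max_left _ _)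
  have e : s₁ * s₂ = min s₁ s₂ * s := by rw [← hs, min_mul_max]
  have e' : (s₁ * s₂ : ℝ) = (min s₁ s₂ : ℕ) * s := by exact_mod_cast e
  have h3 : s ≤ min s₁ s₂ * (s / min s₁ s₂ + 1) := (Nat.lt_mul_div_succ _ hm).le
  have h4 : ρ * s ≤ min s₁ s₂ * trials ρ s₁ s₂ := by
    rw [trials, hs]
    calc ρ * s ≤ ρ * (min s₁ s₂ * (s / min s₁ s₂ + 1)) := Nat.mul_le_mul_left _ h3
      _ = _ := by ring
  have h4' : (ρ * s : ℝ) ≤ (min s₁ s₂ : ℕ) * (trials ρ s₁ s₂ : ℕ) := by exact_mod_cast h4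
  have hs0 : (0 : ℝ) < s := by exact_mod_cast hs1
  rw [e', div_mul_eq_mul_div, div_le_div_iff₀ (by norm_num) (by positivity)]
  nlinarith [mul_le_mul_of_nonneg_left h4' hs0.le]

open Classical in
/-- The probability that no trial succeeds. -/
theorem card_noTrial_le (hdisj : Disjoint S₁ S₂) (h₁ : 1 ≤ S₁.card) (h₂ : 1 ≤ S₂.card)
    (hs : max S₁.card S₂.card = s) (hR : trials ρ S₁.card S₂.card = R) :
    ((Finset.univ.filter fun ω : Seed n Λ M R (8 * s) =>
      ∀ r < R, ¬ GoodTrial S₁ S₂ (tableOf k ω) (Λ * M) r).card : ℝ) ≤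
      Real.exp (-((ρ : ℝ) / 128)) * Fintype.card (Seed n Λ M R (8 * s)) := by
  have hs1 : 1 ≤ s := hs ▸ h₁.trans (le_max_left _ _)
  have hs1' : S₁.card ≤ s := hs ▸ le_max_left _ _
  have hs2' : S₂.card ≤ s := hs ▸ le_max_right _ _
  have hs0 : (0 : ℝ) < s := by exact_mod_cast hs1
  have hsub : (Finset.univ.filter fun ω : Seed n Λ M R (8 * s) =>
      ∀ r < R, ¬ GoodTrial S₁ S₂ (tableOf k ω) (Λ * M) r) ⊆
      Finset.univ ×ˢ Finset.univ.filter fun κ : Fin R → Fin n → Fin (8 * s) =>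
        ∀ r, ¬ Separates S₁ S₂ (κ r) := by
    intro ω hω
    rw [Finset.mem_filter] at hω
    refine Finset.mem_product.2 ⟨Finset.mem_univ _, Finset.mem_filter.2 ⟨Finset.mem_univ _, ?_⟩⟩
    exact fun r hr => hω.2 r r.isLt (goodTrial_of_separates r.isLt hr)
  have h1 := card_separates_ge (m := 8 * s) hdisj (by omega) (by omega)
  have hq : ((S₁.card * S₂.card : ℝ) / (128 * s ^ 2)) * Fintype.card (Fin n → Fin (8 * s)) ≤
      (Finset.univ.filter fun κ : Fin n → Fin (8 * s) => Separates S₁ S₂ κ).card := by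
    have h1' : ((S₁.card * S₂.card * (8 * s) ^ n : ℕ) : ℝ) ≤ ((2 * (8 * s) ^ 2 *
      (Finset.univ.filter fun κ : Fin n → Fin (8 * s) => Separates S₁ S₂ κ).card : ℕ) : ℝ) := by
      exact_mod_cast h1
    have hc : (Fintype.card (Fin n → Fin (8 * s)) : ℝ) = (8 * s) ^ n := by simp
    push_cast at h1'
    rw [hc, div_mul_eq_mul_div, div_le_iff₀ (by positivity)]
    linarith
  have h2 := card_forall_not_le (fun κ : Fin n → Fin (8 * s) => Separates S₁ S₂ κ) hq R
  have h3 : Real.exp (-((S₁.card * S₂.card : ℝ) / (128 * s ^ 2) * R)) ≤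
      Real.exp (-((ρ : ℝ) / 128)) := by
    rw [Real.exp_le_exp, neg_le_neg_iff, ← hR]
    exact mul_trials_ge h₁ h₂ hs
  calc _ ≤ ((Fintype.card (Fin Λ → Fin n → Fin M) *
        (Finset.univ.filter fun κ : Fin R → Fin n → Fin (8 * s) =>
          ∀ r, ¬ Separates S₁ S₂ (κ r)).card : ℕ) : ℝ) := by
        refine Nat.cast_le.2 ((Finset.card_le_card hsub).trans ?_)
        rw [Finset.card_product, Finset.card_univ]
    _ ≤ Fintype.card (Fin Λ → Fin n → Fin M) * (Real.exp (-((ρ : ℝ) / 128)) *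
        Fintype.card (Fin R → Fin n → Fin (8 * s))) := by
        push_cast
        refine mul_le_mul_of_nonneg_left (h2.trans ?_) (by positivity)
        exact mul_le_mul_of_nonneg_right h3 (by positivity)
    _ = _ := by rw [card_seed]; push_cast; ring

open Classical in
/-- The Monte Carlo algorithms fail with probability at most `1 / 100`: no trial succeeds with
probability at most `1 / 1000`, as `exp (-1280 / 128) ≤ 1 / 1000`; and for each of the two orders of
the hidden sets, the budget is exceeded with probability at most `1 / 1000`, and there is a false
candidate on the last level with probability at most `4 / 2000`. -/
theorem card_not_success_le (hP : Params 1280 γ n S₁.card S₂.card s k Λ (Λ * (4 * s)) R)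
    (hdisj : Disjoint S₁ S₂) {leaf : Prop} (hγ : leaf → 2000 ≤ γ) :
    100 * (Finset.univ.filter fun ω : Seed n Λ (4 * s) R (8 * s) =>
      ¬ Success S₁ S₂ (tableOf k ω) k Λ (Λ * (4 * s)) R (4000 * (s * (Λ + 1))) leaf).card ≤
      Fintype.card (Seed n Λ (4 * s) R (8 * s)) := by
  set N := Fintype.card (Seed n Λ (4 * s) R (8 * s)) with hN
  have hs1 := hP.one_le
  have hsn := hP.le_n
  have hroots := hP.roots_le
  have c1 : S₁.card ≤ s := hP.max_eq ▸ le_max_left _ _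
  have c2 : S₂.card ≤ s := hP.max_eq ▸ le_max_right _ _
  set A := Finset.univ.filter fun ω : Seed n Λ (4 * s) R (8 * s) =>
    ∀ r < R, ¬ GoodTrial S₁ S₂ (tableOf k ω) (Λ * (4 * s)) r with hA
  let B : (ℕ → Finset (Fin n)) → Finset (Seed n Λ (4 * s) R (8 * s)) := fun D =>
    Finset.univ.filter fun ω =>
      4000 * (s * (Λ + 1)) ≤ (allCand (hit (tableOf k ω) D) n Λ (2 ^ k)).length
  let C : (ℕ → Finset (Fin n)) → Finset (Seed n Λ (4 * s) R (8 * s)) := fun D =>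
    Finset.univ.filter fun ω => leaf ∧ ¬ NoFalseLeaf (tableOf k ω) D k Λ
  have hB : ∀ D, IsOrder S₁ S₂ D → 1000 * (B D).card ≤ N := fun D hD =>
    card_overBudget_le (hD.card_le c1 c2) hs1 hroots
  have hC : ∀ D, IsOrder S₁ S₂ D → 500 * (C D).card ≤ N := fun D hD => by
    by_cases hl : leaf
    · have h1 := card_falseLeaf_le (γ := γ) (R := R) (m := 8 * s) (Λ := Λ) (k := k)
        (hD.card_le c1 c2) hsn (by omega) hroots (G := doublings 1 (γ * n))
        (by rw [← hP.levels_eq, levels, hP.doublings_eq])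
        (by have := le_doublings le_rfl (γ * n); simpa using this)
      have h2 : (C D).card ≤ (Finset.univ.filter fun ω : Seed n Λ (4 * s) R (8 * s) =>
          ¬ NoFalseLeaf (tableOf k ω) D k Λ).card :=
        Finset.card_le_card fun ω hω => by
          simp only [C, Finset.mem_filter] at hω ⊢
          exact ⟨hω.1, hω.2.2⟩
      have h3 := Nat.mul_le_mul (hγ hl) h2
      omega
    · have : C D = ∅ := Finset.filter_eq_empty_iff.2 fun ω _ h => hl h.1
      simp [this]
  have hA' : 1000 * A.card ≤ N := by
    have h1 := card_noTrial_le (k := k) (Λ := Λ) (M := 4 * s) hdisj hP.one_le₁ hP.one_le₂ hP.max_eq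
      hP.trials_eq
    have h2 : Real.exp (-(((1280 : ℕ) : ℝ) / 128)) ≤ 1 / 1000 := by
      rw [Real.exp_neg, one_div]
      refine inv_anti₀ (by norm_num) ?_
      have e : (((1280 : ℕ) : ℝ) / 128) = (10 : ℕ) * 1 := by norm_num
      rw [e, Real.exp_nat_mul]
      calc (1000 : ℝ) ≤ 2 ^ 10 := by norm_num
        _ ≤ _ := pow_le_pow_left₀ (by norm_num) (by have := Real.add_one_le_exp 1; linarith) 10
    have h3 : ((1000 * A.card : ℕ) : ℝ) ≤ (N : ℕ) := by
      have := h1.trans (mul_le_mul_of_nonneg_right h2 (Nat.cast_nonneg _))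
      push_cast
      linarith
    exact_mod_cast h3
  have hsub : (Finset.univ.filter fun ω : Seed n Λ (4 * s) R (8 * s) =>
      ¬ Success S₁ S₂ (tableOf k ω) k Λ (Λ * (4 * s)) R (4000 * (s * (Λ + 1))) leaf) ⊆
      A ∪ (B (tagged S₁ S₂) ∪ B (tagged S₂ S₁)) ∪ (C (tagged S₁ S₂) ∪ C (tagged S₂ S₁)) := by
    intro ω hω
    by_contra hc
    simp only [Finset.mem_union, not_or, A, B, C, Finset.mem_filter, Finset.mem_univ, true_and,
      not_forall, not_not, not_and, not_le] at hc hω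
    obtain ⟨⟨⟨r, hr, hg⟩, hb1, hb2⟩, hc1, hc2⟩ := hc
    refine hω ⟨splits_tableOf k ω, ⟨r, hr, hg⟩, ?_, ?_⟩
    · rintro D (rfl | rfl) <;> assumption
    · rintro hl D (rfl | rfl)
      exacts [hc1 hl, hc2 hl]
  have h0 := (Finset.card_le_card hsub).trans ((Finset.card_union_le _ _).trans (add_le_add
    ((Finset.card_union_le _ _).trans (add_le_add le_rfl (Finset.card_union_le _ _)))
    (Finset.card_union_le _ _)))
  have b1 := hB _ (.inl rfl)
  have b2 := hB _ (.inr rfl)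
  have b3 := hC _ (.inl rfl)
  have b4 := hC _ (.inr rfl)
  omega

end Failure

/-! ### The distribution of the tables -/

section Distribution

variable {n Λ M R m k : ℕ}

/-- The distribution of the table of a uniformly random seed. -/
noncomputable def randomTable (n Λ M R m k : ℕ) : Measure (PoolTable n (Λ * M + 2 * R)) :=
  (Fintype.card (Seed n Λ M R m) : ENNReal)⁻¹ •
    ∑ ω : Seed n Λ M R m, Measure.dirac (tableOf k ω)

instance (n N : ℕ) : DiscreteMeasurableSpace (PoolTable n N) := ⟨fun _ => trivial⟩

theorem lintegral_randomTable (f : PoolTable n (Λ * M + 2 * R) → ENNReal) :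
    ∫⁻ L, f L ∂randomTable n Λ M R m k =
      (Fintype.card (Seed n Λ M R m) : ENNReal)⁻¹ * ∑ ω : Seed n Λ M R m, f (tableOf k ω) := by
  rw [randomTable, lintegral_smul_measure, lintegral_finsetSum_measure]
  simp

open Classical in
theorem randomTable_apply (A : Set (PoolTable n (Λ * M + 2 * R))) :
    randomTable n Λ M R m k A = (Fintype.card (Seed n Λ M R m) : ENNReal)⁻¹ *
      (Finset.univ.filter fun ω : Seed n Λ M R m => tableOf k ω ∈ A).card := by
  rw [← lintegral_indicator_one (MeasurableSet.of_discrete), lintegral_randomTable,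
    Finset.card_filter]
  push_cast
  simp [Set.indicator]

theorem isProbabilityMeasure_randomTable (hM : 0 < M) (hm : 0 < m) :
    IsProbabilityMeasure (randomTable n Λ M R m k) := by
  classical
  have : Nonempty (Fin M) := ⟨⟨0, hM⟩⟩
  have : Nonempty (Fin m) := ⟨⟨0, hm⟩⟩
  refine ⟨?_⟩
  rw [randomTable_apply]
  simp only [Set.mem_univ, Finset.filter_true, Finset.card_univ]
  exact ENNReal.inv_mul_cancel (by exact_mod_cast Fintype.card_ne_zero) (ENNReal.natCast_ne_top _)

theorem ae_randomTable {p : PoolTable n (Λ * M + 2 * R) → Prop}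
    (h : ∀ ω : Seed n Λ M R m, p (tableOf k ω)) : ∀ᵐ L ∂randomTable n Λ M R m k, p L := by
  classical
  rw [ae_iff, randomTable_apply]
  simp [h]

open Classical in
theorem randomTable_le_ofReal {A : Set (PoolTable n (Λ * M + 2 * R))} {δ : ℝ} (hδ : 0 ≤ δ)
    (h : ((Finset.univ.filter fun ω : Seed n Λ M R m => tableOf k ω ∈ A).card : ℝ) ≤
      δ * Fintype.card (Seed n Λ M R m)) :
    randomTable n Λ M R m k A ≤ ENNReal.ofReal δ := by
  rw [randomTable_apply, mul_comm, ← div_eq_mul_inv]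
  refine ENNReal.div_le_of_le_mul ?_
  rw [← ENNReal.ofReal_natCast, ← ENNReal.ofReal_natCast (Fintype.card _), ← ENNReal.ofReal_mul hδ]
  exact ENNReal.ofReal_le_ofReal h

/-- Independent random tables. -/
noncomputable def randomTables (n Λ M R m k : ℕ) [IsProbabilityMeasure (randomTable n Λ M R m k)] :
    ProbabilityMeasure (ℕ → PoolTable n (Λ * M + 2 * R)) :=
  ⟨Measure.infinitePi fun _ => randomTable n Λ M R m k, inferInstance⟩

end Distribution

/-! ### From executions to Monte Carlo guarantees -/

section MonteCarlo

variable {n Λ R k s γ : ℕ} {S₁ S₂ : Finset (Fin n)}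

theorem isProbabilityMeasure_randomTable_of_le (hs : 1 ≤ s) :
    IsProbabilityMeasure (randomTable n Λ (4 * s) R (8 * s) k) :=
  isProbabilityMeasure_randomTable (by omega) (by omega)

/-- An algorithm that always keeps its bounds and that is right whenever the first table is good has
the success probability of the good event. -/
theorem monteCarlo_of_runs [IsProbabilityMeasure (randomTable n Λ (4 * s) R (8 * s) k)]
    (hP : Params 1280 γ n S₁.card S₂.card s k Λ (Λ * (4 * s)) R)
    (hdisj : Disjoint S₁ S₂) {leaf : Prop} (hγ : leaf → 2000 ≤ γ) {P : Program} {W q : ℕ} {t r : ℝ}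
    (h : ∀ T : ℕ → PoolTable n (Λ * (4 * s) + 2 * R),
      Runs S₁ S₂ T W P (State.init n S₁.card S₂.card) fun τ =>
      τ.stages ≤ q ∧ (τ.tests : ℝ) ≤ t ∧ (τ.time : ℝ) ≤ r ∧
      (Success S₁ S₂ (T 0) k Λ (Λ * (4 * s)) R (4000 * (s * (Λ + 1))) leaf →
        τ.Identifies S₁ S₂)) :
    MonteCarlo P W (randomTables n Λ (4 * s) R (8 * s) k) S₁ S₂ q t r (99 / 100) := by
  classical
  refine ⟨.of_forall fun T => ?_, ?_⟩
  · obtain ⟨τ, h1, h2, h3, h4, -⟩ := h T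
    exact ⟨τ, h1, h2, h3, h4⟩
  · set A : Set (PoolTable n (Λ * (4 * s) + 2 * R)) :=
      {L | Success S₁ S₂ L k Λ (Λ * (4 * s)) R (4000 * (s * (Λ + 1))) leaf} with hA
    set ν := randomTable n Λ (4 * s) R (8 * s) k with hν
    have hbad : ν Aᶜ ≤ ENNReal.ofReal (1 / 100) := by
      refine randomTable_le_ofReal (by norm_num) ?_
      have h1 := card_not_success_le hP hdisj hγ
      have h2 : ((100 * (Finset.univ.filter fun ω : Seed n Λ (4 * s) R (8 * s) =>
          tableOf k ω ∈ Aᶜ).card : ℕ) : ℝ) ≤ Fintype.card (Seed n Λ (4 * s) R (8 * s)) := by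
        refine Nat.cast_le.2 (le_trans (le_of_eq ?_) h1)
        congr 2
      push_cast at h2
      have h3 : ((Finset.univ.filter fun ω : Seed n Λ (4 * s) R (8 * s) =>
          tableOf k ω ∈ Aᶜ).card : ℝ) ≤ 1 / 100 * Fintype.card (Seed n Λ (4 * s) R (8 * s)) := by
        linarith
      convert h3
    have hgood : 99 / 100 ≤ ν A := by
      have h1 : ν A + ν Aᶜ = 1 := prob_add_prob_compl MeasurableSet.of_discrete
      have h2 : (99 / 100 : ENNReal) + ENNReal.ofReal (1 / 100) = 1 := by
        have : (99 / 100 : ENNReal) = ENNReal.ofReal (99 / 100) := by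
          rw [ENNReal.ofReal_div_of_pos (by norm_num)]; norm_num
        rw [this, ← ENNReal.ofReal_add (by norm_num) (by norm_num)]
        norm_num
      have h3 : (99 / 100 : ENNReal) + ENNReal.ofReal (1 / 100) ≤
          ν A + ENNReal.ofReal (1 / 100) := by
        rw [h2, ← h1]
        exact add_le_add le_rfl hbad
      exact (ENNReal.add_le_add_iff_right ENNReal.ofReal_ne_top).1 h3
    refine hgood.trans ?_
    have he := (measurePreserving_eval_infinitePi (fun _ : ℕ => ν) 0).measure_preimage
      (s := A) MeasurableSet.of_discrete.nullMeasurableSet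
    rw [← he]
    refine measure_mono fun T hT => ?_
    obtain ⟨τ, h1, -, -, -, h2⟩ := h T
    exact ⟨τ, h1, h2 hT⟩

end MonteCarlo

/-! ### Determinism and measurability of executions -/

section Exec

variable {n N : ℕ} {S₁ S₂ : Finset (Fin n)} {T : ℕ → PoolTable n N} {W : ℕ}

theorem Exec.unique {P : Program} {σ τ τ' : State n} (h : Exec S₁ S₂ T W P σ τ)
    (h' : Exec S₁ S₂ T W P σ τ') : τ = τ' := by
  induction h generalizing τ' with
  | atom a σ => cases h'; rfl
  | seq _ _ ih₁ ih₂ =>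
    cases h' with
    | seq h₁ h₂ =>
      have := ih₁ h₁
      subst this
      exact ih₂ h₂
  | iteTrue h _ ih =>
    cases h' with
    | iteTrue _ h₂ => exact ih h₂
    | iteFalse h₁ _ => exact absurd h₁ h
  | iteFalse h _ ih =>
    cases h' with
    | iteTrue h₁ _ => exact absurd h h₁
    | iteFalse _ h₂ => exact ih h₂
  | loopTrue h _ _ ih₁ ih₂ =>
    cases h' with
    | loopTrue _ h₁ h₂ =>
      have := ih₁ h₁
      subst this
      exact ih₂ h₂
    | loopFalse h₁ => exact absurd h₁ h
  | loopFalse h =>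
    cases h' with
    | loopTrue h₁ _ _ => exact absurd h h₁
    | loopFalse _ => rfl

theorem Atom.step_congr {a : Atom} {σ : State n} {T' : ℕ → PoolTable n N}
    (h : T' σ.table = T σ.table) : a.step S₁ S₂ T' W σ = a.step S₁ S₂ T W σ := by
  cases a <;> simp only [Atom.step, h]

/-- An execution only depends on finitely many tables. -/
theorem Exec.exists_prefix {P : Program} {σ τ : State n} (h : Exec S₁ S₂ T W P σ τ) :
    ∃ K, ∀ T' : ℕ → PoolTable n N, (∀ i < K, T' i = T i) → Exec S₁ S₂ T' W P σ τ := by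
  induction h with
  | atom a σ =>
    refine ⟨σ.table + 1, fun T' h => ?_⟩
    rw [← Atom.step_congr (h σ.table (by omega))]
    exact .atom a σ
  | seq _ _ ih₁ ih₂ =>
    obtain ⟨K₁, h₁⟩ := ih₁
    obtain ⟨K₂, h₂⟩ := ih₂
    exact ⟨max K₁ K₂, fun T' h => .seq (h₁ T' fun i hi => h i (lt_max_of_lt_left hi))
      (h₂ T' fun i hi => h i (lt_max_of_lt_right hi))⟩
  | @iteTrue e P Q σ τ he _ ih =>
    obtain ⟨K, h₁⟩ := ih
    refine ⟨max (σ.table + 1) K, fun T' h => .iteTrue ?_ (h₁ T' fun i hi =>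
      h i (lt_max_of_lt_right hi))⟩
    rwa [h σ.table (lt_max_of_lt_left (by omega))]
  | @iteFalse e P Q σ τ he _ ih =>
    obtain ⟨K, h₁⟩ := ih
    refine ⟨max (σ.table + 1) K, fun T' h => .iteFalse ?_ (h₁ T' fun i hi =>
      h i (lt_max_of_lt_right hi))⟩
    rwa [h σ.table (lt_max_of_lt_left (by omega))]
  | @loopTrue e P σ σ' τ he _ _ ih₁ ih₂ =>
    obtain ⟨K₁, h₁⟩ := ih₁
    obtain ⟨K₂, h₂⟩ := ih₂
    refine ⟨max (σ.table + 1) (max K₁ K₂), fun T' h => .loopTrue ?_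
      (h₁ T' fun i hi => h i (lt_max_of_lt_right (lt_max_of_lt_left hi)))
      (h₂ T' fun i hi => h i (lt_max_of_lt_right (lt_max_of_lt_right hi)))⟩
    rwa [h σ.table (lt_max_of_lt_left (by omega))]
  | @loopFalse e P σ he =>
    refine ⟨σ.table + 1, fun T' h => .loopFalse ?_⟩
    rwa [h σ.table (by omega)]

/-- Sets of sequences that are determined by finite prefixes are measurable. -/
theorem measurableSet_of_prefix {X : Type*} [Finite X] [MeasurableSpace X]
    [DiscreteMeasurableSpace X] {U : Set (ℕ → X)}
    (h : ∀ T ∈ U, ∃ K, ∀ T' : ℕ → X, (∀ i < K, T' i = T i) → T' ∈ U) : MeasurableSet U := by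
  let res : ∀ K, (ℕ → X) → Fin K → X := fun K T i => T i
  have hU : U = ⋃ K, res K ⁻¹' {p | ∀ T', res K T' = p → T' ∈ U} := by
    ext T
    simp only [Set.mem_iUnion, Set.mem_preimage, Set.mem_ofPred_eq]
    constructor
    · intro hT
      obtain ⟨K, hK⟩ := h T hT
      exact ⟨K, fun T' h' => hK T' fun i hi => congrFun h' ⟨i, hi⟩⟩
    · rintro ⟨K, hK⟩
      exact hK T rfl
  rw [hU]
  refine MeasurableSet.iUnion fun K => ?_
  have hm : Measurable (res K) := measurable_pi_lambda _ fun i => measurable_pi_apply _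
  exact hm (Set.toFinite _).measurableSet

open Classical in
/-- The final state if the program halts, the initial state otherwise. -/
noncomputable def finalState (S₁ S₂ : Finset (Fin n)) (W : ℕ) (P : Program) (σ : State n)
    (T : ℕ → PoolTable n N) : State n :=
  if h : ∃ τ, Exec S₁ S₂ T W P σ τ then h.choose else σ

theorem finalState_eq {P : Program} {σ τ : State n} (h : Exec S₁ S₂ T W P σ τ) :
    finalState S₁ S₂ W P σ T = τ := by
  have h' : ∃ τ, Exec S₁ S₂ T W P σ τ := ⟨τ, h⟩
  rw [finalState, dif_pos h']
  exact h'.choose_spec.unique h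

instance (n N : ℕ) : Finite (PoolTable n N) := inferInstanceAs (Finite (Fin N → Finset (Fin n)))

theorem measurable_finalState {P : Program} {σ : State n} (f : State n → ℕ) :
    Measurable fun T : ℕ → PoolTable n N => f (finalState S₁ S₂ W P σ T) := by
  have hm : ∀ p : State n → Prop,
      MeasurableSet {T : ℕ → PoolTable n N | ∃ τ, Exec S₁ S₂ T W P σ τ ∧ p τ} := fun p => by
    refine measurableSet_of_prefix ?_
    rintro T ⟨τ, h, hp⟩
    obtain ⟨K, hK⟩ := h.exists_prefix
    exact ⟨K, fun T' h' => ⟨τ, hK T' h', hp⟩⟩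
  refine measurable_to_countable' fun c => ?_
  have e : (fun T : ℕ → PoolTable n N => f (finalState S₁ S₂ W P σ T)) ⁻¹' {c} =
      {T | ∃ τ, Exec S₁ S₂ T W P σ τ ∧ f τ = c} ∪
        ({T | ∃ τ, Exec S₁ S₂ T W P σ τ ∧ True}ᶜ ∩ {_T | f σ = c}) := by
    ext T
    by_cases h : ∃ τ, Exec S₁ S₂ T W P σ τ
    · obtain ⟨τ, h⟩ := h
      have h1 : (∃ τ', Exec S₁ S₂ T W P σ τ' ∧ f τ' = c) ↔ f τ = c :=
        ⟨fun ⟨τ', h', hc⟩ => h.unique h' ▸ hc, fun hc => ⟨τ, h, hc⟩⟩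
      have h2 : ∃ τ, Exec S₁ S₂ T W P σ τ := ⟨τ, h⟩
      simp [finalState_eq h, h1, h2]
    · have h1 : ∀ τ, ¬ Exec S₁ S₂ T W P σ τ := fun τ hτ => h ⟨τ, hτ⟩
      simp [finalState, h1]
  rw [e]
  exact (hm _).union ((hm _).compl.inter (MeasurableSet.const _))

end Exec

/-! ### Repetition until the first success -/

section Repetition

variable {X : Type*} [MeasurableSpace X] {ν : Measure X} [IsProbabilityMeasure ν] {F : Set X}

/-- The total cost of independent rounds until the first success, `F` being the set of failures. -/
noncomputable def totalCost {X : Type*} (F : Set X) (g : X → ENNReal) (T : ℕ → X) : ENNReal :=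
  ∑' i, Set.indicator (Set.pi (Finset.range i : Set ℕ) fun _ => F) (fun T => g (T i)) T

theorem measurableSet_firstFail [DiscreteMeasurableSpace X] (i : ℕ) :
    MeasurableSet (Set.pi (Finset.range i : Set ℕ) fun _ => F) :=
  MeasurableSet.pi (Finset.countable_toSet _) fun _ _ => MeasurableSet.of_discrete

/-- Round `i` takes place if all previous rounds fail, and is independent of them. -/
theorem lintegral_round [Finite X] [DiscreteMeasurableSpace X] (g : X → ENNReal) (i : ℕ) :
    ∫⁻ T, Set.indicator (Set.pi (Finset.range i : Set ℕ) fun _ => F) (fun T => g (T i)) T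
      ∂(Measure.infinitePi fun _ : ℕ => ν) = ν F ^ i * ∫⁻ x, g x ∂ν := by
  classical
  have := Fintype.ofFinite X
  set A : Set (ℕ → X) := Set.pi (Finset.range i : Set ℕ) fun _ => F with hA
  have hi : Measurable fun T : ℕ → X => T i := measurable_pi_apply i
  have hB : ∀ x, MeasurableSet (A ∩ {T : ℕ → X | T i = x}) := fun x =>
    (measurableSet_firstFail i).inter (hi (MeasurableSet.singleton x))
  have e1 : ∀ T, A.indicator (fun T => g (T i)) T =
      ∑ x, (A ∩ {T : ℕ → X | T i = x}).indicator (fun _ => g x) T := by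
    intro T
    by_cases hT : T ∈ A <;> simp [Set.indicator, hT]
  have e2 : ∀ x, (Measure.infinitePi fun _ : ℕ => ν) (A ∩ {T : ℕ → X | T i = x}) =
      ν F ^ i * ν {x} := by
    intro x
    have : A ∩ {T : ℕ → X | T i = x} =
        Set.pi (Finset.range (i + 1) : Set ℕ) fun j => if j = i then {x} else F := by
      ext T
      simp only [hA, Set.mem_inter_iff, Set.mem_pi, Finset.coe_range, Set.mem_Iio, Set.mem_ofPred_eq]
      constructor
      · rintro ⟨h1, h2⟩ j hj
        split_ifs with hji
        · rw [hji]; exact h2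
        · exact h1 j (by omega)
      · intro h
        refine ⟨fun j hj => ?_, ?_⟩
        · have := h j (by omega)
          rwa [if_neg (by omega)] at this
        · have := h i (by omega)
          rwa [if_pos rfl] at this
    rw [this, Measure.infinitePi_pi _ fun _ _ => MeasurableSet.of_discrete, Finset.prod_range_succ,
      if_pos rfl]
    congr 1
    rw [Finset.prod_congr rfl (g := fun _ => ν F), Finset.prod_const, Finset.card_range]
    intro j hj
    rw [if_neg (by have := Finset.mem_range.1 hj; omega)]
  simp only [e1]
  rw [lintegral_finsetSum _ fun x _ => measurable_const.indicator (hB x)]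
  simp only [lintegral_indicator_const (hB _), e2]
  rw [lintegral_fintype, Finset.mul_sum]
  exact Finset.sum_congr rfl fun x _ => by ring

/-- Wald's identity for the number of rounds. -/
theorem lintegral_totalCost [Finite X] [DiscreteMeasurableSpace X] (g : X → ENNReal) :
    ∫⁻ T, totalCost F g T ∂(Measure.infinitePi fun _ : ℕ => ν) =
      (1 - ν F)⁻¹ * ∫⁻ x, g x ∂ν := by
  have hi : ∀ i, Measurable fun T : ℕ → X => T i := fun i => measurable_pi_apply i
  have hm : ∀ i, Measurable (Set.indicator (Set.pi (Finset.range i : Set ℕ) fun _ => F)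
      fun T : ℕ → X => g (T i)) := fun i =>
    ((Measurable.of_discrete (f := g)).comp (hi i)).indicator (measurableSet_firstFail i)
  unfold totalCost
  rw [lintegral_tsum fun i => (hm i).aemeasurable]
  simp only [lintegral_round]
  rw [ENNReal.tsum_mul_right, ENNReal.tsum_geometric]

theorem sum_le_totalCost {X : Type*} {F : Set X} (g : X → ENNReal) {T : ℕ → X} {j : ℕ}
    (h : ∀ i < j, T i ∈ F) :
    ∑ i ∈ Finset.range (j + 1), g (T i) ≤ totalCost F g T := by
  refine le_trans (le_of_eq (Finset.sum_congr rfl fun i hi => ?_)) (ENNReal.sum_le_tsum _)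
  rw [Set.indicator_of_mem]
  intro i' hi'
  have h1 := Finset.mem_range.1 hi
  have h2 := Finset.mem_range.1 hi'
  exact h i' (by omega)

theorem ae_exists_success [DiscreteMeasurableSpace X] (h : ν F < 1) :
    ∀ᵐ T ∂(Measure.infinitePi fun _ : ℕ => ν), ∃ j, T j ∉ F := by
  rw [ae_iff]
  have h1 : ∀ i, (Measure.infinitePi fun _ : ℕ => ν) {T | ¬ ∃ j, T j ∉ F} ≤ ν F ^ i := by
    intro i
    have h2 := Measure.infinitePi_pi (fun _ : ℕ => ν) (s := Finset.range i) (t := fun _ => F)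
      fun _ _ => MeasurableSet.of_discrete
    rw [Finset.prod_const, Finset.card_range] at h2
    rw [← h2]
    refine measure_mono fun T hT j _ => ?_
    by_contra hj
    exact hT ⟨j, hj⟩
  exact le_antisymm (ge_of_tendsto' (ENNReal.tendsto_pow_atTop_nhds_zero_of_lt_one h) h1) bot_le

theorem ae_forall_eval {p : X → Prop} (h : ∀ᵐ x ∂ν, p x) :
    ∀ᵐ T ∂(Measure.infinitePi fun _ : ℕ => ν), ∀ i, p (T i) :=
  ae_all_iff.2 fun i =>
    (measurePreserving_eval_infinitePi (fun _ : ℕ => ν) i).quasiMeasurePreserving.ae h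

end Repetition

theorem integrable_natCast_and_integral_le {Ω : Type*} [MeasurableSpace Ω] {μ : Measure Ω}
    {f : Ω → ℕ} (hf : Measurable f) {b : ℝ} (hb : 0 ≤ b)
    (h : ∫⁻ x, (f x : ENNReal) ∂μ ≤ ENNReal.ofReal b) :
    Integrable (fun x => (f x : ℝ)) μ ∧ ∫ x, (f x : ℝ) ∂μ ≤ b := by
  have hm : Measurable fun x => (f x : ℝ) := (Measurable.of_discrete (f := Nat.cast)).comp hf
  have he : ∫⁻ x, ENNReal.ofReal (f x : ℝ) ∂μ ≤ ENNReal.ofReal b := by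
    simpa only [ENNReal.ofReal_natCast] using h
  refine ⟨⟨hm.aestronglyMeasurable, ?_⟩, ?_⟩
  · rw [hasFiniteIntegral_iff_ofReal (.of_forall fun _ => Nat.cast_nonneg _)]
    exact he.trans_lt ENNReal.ofReal_lt_top
  · rw [integral_eq_lintegral_of_nonneg_ae (.of_forall fun _ => Nat.cast_nonneg _)
      hm.aestronglyMeasurable]
    exact ENNReal.toReal_le_of_le_ofReal hb he

section LasVegas

variable {n N : ℕ} {S₁ S₂ : Finset (Fin n)}

/-- An algorithm that turns to a new table until a table outside `F` appears, where `g` and `g'`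
bound the tests and the time spent on a table. The expected number of rounds is at most
`1 / (1 - δ)`, and two more stages follow. -/
theorem lasVegas_of_runs {ν : Measure (PoolTable n N)} [IsProbabilityMeasure ν]
    {F : Set (PoolTable n N)} {δ : ℝ} (hδ : 0 ≤ δ) (hδ' : δ < 1) (hF : ν F ≤ ENNReal.ofReal δ)
    {p : PoolTable n N → Prop} (hp : ∀ᵐ L ∂ν, p L) {P : Program} {W : ℕ}
    {g g' : PoolTable n N → ℕ} {b b' : ℝ} (hb : 0 ≤ b) (hb' : 0 ≤ b')
    (hg : ∫⁻ L, (g L : ENNReal) ∂ν ≤ ENNReal.ofReal b)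
    (hg' : ∫⁻ L, (g' L : ENNReal) ∂ν ≤ ENNReal.ofReal b')
    (h : ∀ T j, (∀ i < j, T i ∈ F) → T j ∉ F → p (T j) →
      Runs S₁ S₂ T W P (State.init n S₁.card S₂.card) fun τ => τ.stages = j + 3 ∧
        τ.tests ≤ ∑ i ∈ Finset.range (j + 1), g (T i) ∧
        τ.time ≤ ∑ i ∈ Finset.range (j + 1), g' (T i) ∧ τ.Identifies S₁ S₂) :
    LasVegas P W ⟨Measure.infinitePi fun _ : ℕ => ν, inferInstance⟩ S₁ S₂ (2 + 1 / (1 - δ))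
      (b / (1 - δ)) (b' / (1 - δ)) := by
  have hpos : 0 < 1 - δ := by linarith
  have hF1 : ν F < 1 := hF.trans_lt (by
    rw [← ENNReal.ofReal_one]; exact (ENNReal.ofReal_lt_ofReal_iff one_pos).2 hδ')
  have hinv : (1 - ν F)⁻¹ ≤ ENNReal.ofReal (1 / (1 - δ)) := by
    rw [one_div, ENNReal.ofReal_inv_of_pos hpos, ENNReal.inv_le_inv, ENNReal.ofReal_sub _ hδ,
      ENNReal.ofReal_one]
    exact tsub_le_tsub_left hF 1
  set σ : (ℕ → PoolTable n N) → State n :=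
    finalState S₁ S₂ W P (State.init n S₁.card S₂.card) with hσ
  have hae : ∀ᵐ T ∂(Measure.infinitePi fun _ : ℕ => ν),
      Exec S₁ S₂ T W P (State.init n S₁.card S₂.card) (σ T) ∧ (σ T).Identifies S₁ S₂ ∧
      ((σ T).stages : ENNReal) ≤ 2 + totalCost F (fun _ => 1) T ∧
      ((σ T).tests : ENNReal) ≤ totalCost F (fun L => (g L : ENNReal)) T ∧
      ((σ T).time : ENNReal) ≤ totalCost F (fun L => (g' L : ENNReal)) T := by
    classical
    filter_upwards [ae_exists_success hF1, ae_forall_eval hp] with T hT hpT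
    have hfail : ∀ i < Nat.find hT, T i ∈ F := fun i hi => by
      have := Nat.find_min hT hi
      rwa [not_not] at this
    obtain ⟨τ, h1, h2, h3, h4, h5⟩ := h T (Nat.find hT) hfail (Nat.find_spec hT) (hpT _)
    rw [hσ, finalState_eq h1]
    refine ⟨h1, h5, ?_, ?_, ?_⟩
    · refine le_trans (le_of_eq ?_) (add_le_add le_rfl (sum_le_totalCost _ hfail))
      rw [h2, Finset.sum_const, Finset.card_range, nsmul_eq_mul]
      push_cast
      ring
    · refine le_trans ?_ (sum_le_totalCost _ hfail)
      exact_mod_cast h3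
    · refine le_trans ?_ (sum_le_totalCost _ hfail)
      exact_mod_cast h4
  have hcost : ∀ {f : PoolTable n N → ENNReal} {c : ℝ}, ∫⁻ L, f L ∂ν ≤ ENNReal.ofReal c →
      ∫⁻ T, totalCost F f T ∂(Measure.infinitePi fun _ : ℕ => ν) ≤ ENNReal.ofReal (c / (1 - δ)) := by
    intro f c hc
    rw [lintegral_totalCost, div_eq_mul_one_div, mul_comm c, ENNReal.ofReal_mul (by positivity)]
    exact mul_le_mul' hinv hc
  refine ⟨σ, hae.mono fun T hT => ⟨hT.1, hT.2.1⟩, ?_, ?_, ?_⟩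
  · refine integrable_natCast_and_integral_le (measurable_finalState _) (by positivity) ?_
    refine (lintegral_mono_ae (hae.mono fun T hT => hT.2.2.1)).trans ?_
    rw [lintegral_add_left measurable_const, ENNReal.ofReal_add (by norm_num) (by positivity)]
    refine add_le_add ?_ (hcost ?_)
    · simp
    · simp
  · refine integrable_natCast_and_integral_le (measurable_finalState _) (by positivity) ?_
    exact (lintegral_mono_ae (hae.mono fun T hT => hT.2.2.2.1)).trans (hcost hg)
  · refine integrable_natCast_and_integral_le (measurable_finalState _) (by positivity) ?_
    exact (lintegral_mono_ae (hae.mono fun T hT => hT.2.2.2.2)).trans (hcost hg')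

theorem LasVegas.mono {P : Program} {W : ℕ} {μ : ProbabilityMeasure (ℕ → PoolTable n N)}
    {q q' t t' r r' : ℝ} (h : LasVegas P W μ S₁ S₂ q t r) (hq : q ≤ q') (ht : t ≤ t')
    (hr : r ≤ r') : LasVegas P W μ S₁ S₂ q' t' r' :=
  let ⟨σ, h1, h2, h3, h4⟩ := h
  ⟨σ, h1, ⟨h2.1, h2.2.trans hq⟩, ⟨h3.1, h3.2.trans ht⟩, ⟨h4.1, h4.2.trans hr⟩⟩

end LasVegas

/-! ### Size of the parameters -/

section Size

variable {n s s₁ s₂ ρ γ : ℕ}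

theorem params_mk (ρ γ : ℕ) (h₁ : 1 ≤ s₁) (h₂ : 1 ≤ s₂) (hn : s₁ + s₂ ≤ n) :
    Params ρ γ n s₁ s₂ (max s₁ s₂) (doublings (max s₁ s₂) n) (levels γ n (max s₁ s₂))
      (levels γ n (max s₁ s₂) * (4 * max s₁ s₂)) (trials ρ s₁ s₂) :=
  ⟨h₁, h₂, hn, rfl, rfl, rfl, rfl, rfl⟩

/-- An exponent `K`, independent of the instance, for which all numbers that occur are below
`n ^ K`. The constants are generous. -/
def wordExp (ρ γ : ℕ) : ℕ := 10000 * ((ρ + 1) * (γ + 2)) + 3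

/-- Apart from constants, all numbers are bounded by `n ^ 3`, and the word bound exceeds the
constants because `n ≥ 2`. -/
theorem fits_pow (h₁ : 1 ≤ s₁) (h₂ : 1 ≤ s₂) (hn : s₁ + s₂ ≤ n) {bud : ℕ}
    (hbud : bud ≤ 4000 * (max s₁ s₂ * (levels γ n (max s₁ s₂) + 1)) + 16 * n) :
    Fits ρ γ n (max s₁ s₂) (levels γ n (max s₁ s₂))
      (levels γ n (max s₁ s₂) * (4 * max s₁ s₂)) (trials ρ s₁ s₂) bud (n ^ wordExp ρ γ) := by
  set s := max s₁ s₂ with hs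
  have hs1 : 1 ≤ s := le_max_of_le_left h₁
  have hsn : s + 1 ≤ n := by omega
  set Λ := levels γ n s with hΛdef
  set R := trials ρ s₁ s₂ with hRdef
  have hΛ : Λ ≤ (γ + 1) * n := by
    have a1 := doublings_le (n := n) hs1
    have a2 := doublings_le (n := γ * n) le_rfl
    rw [hΛdef, levels, add_mul]
    omega
  have hR : R ≤ ρ * n := by
    rw [hRdef, trials, ← hs]
    refine Nat.mul_le_mul_left _ ?_
    have := Nat.div_le_self s (min s₁ s₂)
    omega
  have hn2 : n ≤ n ^ 2 := Nat.le_self_pow (by norm_num) n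
  have hn3 : n ^ 2 ≤ n ^ 3 := Nat.pow_le_pow_right (by omega) (by norm_num)
  have hV : Λ * (4 * s) ≤ 4 * (γ + 1) * n ^ 2 := by
    calc Λ * (4 * s) ≤ (γ + 1) * n * (4 * n) := Nat.mul_le_mul hΛ (by omega)
      _ = _ := by ring
  have hRV : R * (Λ * (4 * s)) ≤ 4 * (ρ * (γ + 1)) * n ^ 3 := by
    calc R * (Λ * (4 * s)) ≤ ρ * n * (4 * (γ + 1) * n ^ 2) := Nat.mul_le_mul hR hV
      _ = _ := by ring
  have hb : s * (Λ + 1) ≤ (γ + 2) * n ^ 2 := by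
    calc s * (Λ + 1) ≤ n * ((γ + 1) * n + n) := Nat.mul_le_mul (by omega) (by omega)
      _ = _ := by ring
  have hW : 10000 * ((ρ + 1) * (γ + 2)) * n ^ 3 < n ^ wordExp ρ γ := by
    rw [wordExp, pow_add]
    refine Nat.mul_lt_mul_of_pos_right ?_ (Nat.pow_pos (by omega))
    exact Nat.lt_two_pow_self.trans_le (Nat.pow_le_pow_left (by omega) _)
  have e1 : γ * n ≤ γ * n ^ 3 := Nat.mul_le_mul_left _ (hn2.trans hn3)
  have e2 : ρ * n ≤ ρ * n ^ 3 := Nat.mul_le_mul_left _ (hn2.trans hn3)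
  have e3 : γ * n ^ 2 ≤ γ * n ^ 3 := Nat.mul_le_mul_left _ hn3
  have e4 : ρ ≤ ρ * n := Nat.le_mul_of_pos_right _ (by omega)
  have e5 : γ ≤ γ * n := Nat.le_mul_of_pos_right _ (by omega)
  have e6 : 10000 * ((ρ + 1) * (γ + 2)) * n ^ 3 = 10000 * (ρ * γ * n ^ 3) + 20000 * (ρ * n ^ 3) +
    10000 * (γ * n ^ 3) + 20000 * n ^ 3 := by ring
  have e7 : 4 * (ρ * (γ + 1)) * n ^ 3 = 4 * (ρ * γ * n ^ 3) + 4 * (ρ * n ^ 3) := by ring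
  have e8 : 4 * (γ + 1) * n ^ 2 = 4 * (γ * n ^ 2) + 4 * n ^ 2 := by ring
  have e9 : (γ + 2) * n ^ 2 = γ * n ^ 2 + 2 * n ^ 2 := by ring
  have e10 : (γ + 1) * n = γ * n + n := by ring
  have e11 : 2 * R * (Λ * (4 * s)) = 2 * (R * (Λ * (4 * s))) := by ring
  refine ⟨?_, ?_, ?_, ?_, ?_⟩
  · omega
  · omega
  · omega
  · omega
  · omega

theorem doublings_le_log {a b c : ℕ} (ha : 1 ≤ a) (hab : a ≤ b) :
    (doublings a (2 ^ c * b) : ℝ) ≤ c + 1 + 2 * Real.log (b / a) := by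
  have ha0 : (0 : ℝ) < a := by exact_mod_cast ha
  have hle : (1 : ℝ) ≤ b / a := by
    rw [le_div_iff₀ ha0, one_mul]
    exact_mod_cast hab
  have hlog := Real.log_nonneg hle
  by_cases hd : doublings a (2 ^ c * b) ≤ c + 1
  · have : (doublings a (2 ^ c * b) : ℝ) ≤ c + 1 := by exact_mod_cast hd
    linarith
  · obtain ⟨j, hj⟩ : ∃ j, doublings a (2 ^ c * b) = c + 1 + j :=
      ⟨doublings a (2 ^ c * b) - (c + 1), by omega⟩
    have h1 := lt_of_lt_doublings (s := a) (n := 2 ^ c * b) (i := c + j) (by omega)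
    rw [pow_add, mul_assoc] at h1
    have h2 : 2 ^ j * a < b := Nat.lt_of_mul_lt_mul_left h1
    have h3 : (2 : ℝ) ^ j ≤ b / a := by
      rw [le_div_iff₀ ha0]
      exact_mod_cast h2.le
    have h4 := Real.log_le_log (by positivity) h3
    rw [Real.log_pow] at h4
    have h5 : (1 : ℝ) / 2 ≤ Real.log 2 := by have := Real.log_two_gt_d9; linarith
    have h6 : (j : ℝ) * (1 / 2) ≤ j * Real.log 2 := mul_le_mul_of_nonneg_left h5 (by positivity)
    rw [hj]
    push_cast
    linarith

theorem trials_le_div (h₁ : 1 ≤ s₁) (h₂ : 1 ≤ s₂) :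
    (trials ρ s₁ s₂ : ℝ) ≤ 2 * ρ * ((max s₁ s₂ : ℕ) / (min s₁ s₂ : ℕ)) := by
  have hm : (1 : ℝ) ≤ (min s₁ s₂ : ℕ) := by exact_mod_cast le_min h₁ h₂
  have hms : ((min s₁ s₂ : ℕ) : ℝ) ≤ (max s₁ s₂ : ℕ) := by exact_mod_cast min_le_max
  have h3 : (1 : ℝ) ≤ (max s₁ s₂ : ℕ) / (min s₁ s₂ : ℕ) := by
    rw [le_div_iff₀ (by linarith)]; linarith
  have h4 : ((max s₁ s₂ / min s₁ s₂ : ℕ) : ℝ) ≤ (max s₁ s₂ : ℕ) / (min s₁ s₂ : ℕ) := Nat.cast_div_le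
  rw [trials, Nat.cast_mul, Nat.cast_add, Nat.cast_one]
  nlinarith [mul_le_mul_of_nonneg_left h4 (Nat.cast_nonneg (α := ℝ) ρ),
    mul_le_mul_of_nonneg_left h3 (Nat.cast_nonneg (α := ℝ) ρ)]

end Size

/-! ### Guarantees of the algorithms -/

section Algorithms

variable {n s₁ s₂ ρ γ : ℕ}

/-- The distribution of the sequence of tables for the given parameters. -/
noncomputable def design (ρ γ n : ℕ) (s₁ s₂ : ℕ) (h₁ : 1 ≤ s₁) :
    ProbabilityMeasure (ℕ → PoolTable n (levels γ n (max s₁ s₂) * (4 * max s₁ s₂) +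
      2 * trials ρ s₁ s₂)) :=
  haveI := isProbabilityMeasure_randomTable_of_le (n := n) (Λ := levels γ n (max s₁ s₂))
    (R := trials ρ s₁ s₂) (k := doublings (max s₁ s₂) n) (le_max_of_le_left (b := s₁) (c := s₂) h₁)
  randomTables n (levels γ n (max s₁ s₂)) (4 * max s₁ s₂) (trials ρ s₁ s₂) (8 * max s₁ s₂)
    (doublings (max s₁ s₂) n)

variable {S₁ S₂ : Finset (Fin n)}

theorem monteCarlo_design (hdisj : Disjoint S₁ S₂) (h₁ : 1 ≤ S₁.card) (h₂ : 1 ≤ S₂.card)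
    (hn : S₁.card + S₂.card ≤ n) {leaf : Prop} (hγ : leaf → 2000 ≤ γ) {P : Program} {W q a b : ℕ}
    {t r : ℝ} (ha : (a : ℝ) ≤ t) (hb : (b : ℝ) ≤ r)
    (h : ∀ T : ℕ → PoolTable n (levels γ n (max S₁.card S₂.card) * (4 * max S₁.card S₂.card) +
        2 * trials 1280 S₁.card S₂.card),
      Runs S₁ S₂ T W P (State.init n S₁.card S₂.card) fun τ =>
        τ.stages ≤ q ∧ τ.tests ≤ a ∧ τ.time ≤ b ∧
        (Success S₁ S₂ (T 0) (doublings (max S₁.card S₂.card) n) (levels γ n (max S₁.card S₂.card))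
          (levels γ n (max S₁.card S₂.card) * (4 * max S₁.card S₂.card))
          (trials 1280 S₁.card S₂.card)
          (4000 * (max S₁.card S₂.card * (levels γ n (max S₁.card S₂.card) + 1))) leaf →
          τ.Identifies S₁ S₂)) :
    MonteCarlo P W (design 1280 γ n S₁.card S₂.card h₁) S₁ S₂ q t r (99 / 100) := by
  have := isProbabilityMeasure_randomTable_of_le (n := n) (Λ := levels γ n (max S₁.card S₂.card))
    (R := trials 1280 S₁.card S₂.card) (k := doublings (max S₁.card S₂.card) n)
    (le_max_of_le_left (b := S₁.card) (c := S₂.card) h₁)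
  refine monteCarlo_of_runs (params_mk 1280 γ h₁ h₂ hn) hdisj hγ fun T => (h T).mono ?_
  rintro τ ⟨h1, h2, h3, h4⟩
  exact ⟨h1, (Nat.cast_le.2 h2).trans ha, (Nat.cast_le.2 h3).trans hb, h4⟩

theorem monteCarlo_oneStage (hdisj : Disjoint S₁ S₂) (h₁ : 1 ≤ S₁.card) (h₂ : 1 ≤ S₂.card)
    (hn : S₁.card + S₂.card ≤ n) {s Λ R V : ℕ} (hs : max S₁.card S₂.card = s)
    (hΛ : levels 2048 n s = Λ) (hR : trials 1280 S₁.card S₂.card = R) (hV : Λ * (4 * s) = V)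
    {t r : ℝ} (ht : ((3 * R + 2 * R * V : ℕ) : ℝ) ≤ t)
    (hr : ((50 * Λ + 200 * R + 60 * (R * V) + 600 * (4000 * (s * (Λ + 1))) + 3000 : ℕ) : ℝ) ≤ r) :
    MonteCarlo (oneStage 1280 2048) (n ^ wordExp 1280 2048)
      (design 1280 2048 n S₁.card S₂.card h₁) S₁ S₂ 1 t r (99 / 100) := by
  subst hV hΛ hR hs
  exact monteCarlo_design hdisj h₁ h₂ hn (leaf := True) (fun _ => by norm_num) ht hr fun T =>
    runs_oneStage (params_mk 1280 2048 h₁ h₂ hn) (fits_pow h₁ h₂ hn (by omega)) rfl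

theorem monteCarlo_twoStage (hdisj : Disjoint S₁ S₂) (h₁ : 1 ≤ S₁.card) (h₂ : 1 ≤ S₂.card)
    (hn : S₁.card + S₂.card ≤ n) {s Λ R V : ℕ} (hs : max S₁.card S₂.card = s)
    (hΛ : levels 2048 n s = Λ) (hR : trials 1280 S₁.card S₂.card = R) (hV : Λ * (4 * s) = V)
    {t r : ℝ} (ht : ((3 * R + 2 * V : ℕ) : ℝ) ≤ t)
    (hr : ((50 * Λ + 100 * R + 60 * V + 500 * (4000 * (s * (Λ + 1))) + 3000 : ℕ) : ℝ) ≤ r) :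
    MonteCarlo (twoStage 1280 2048) (n ^ wordExp 1280 2048)
      (design 1280 2048 n S₁.card S₂.card h₁) S₁ S₂ 2 t r (99 / 100) := by
  subst hV hΛ hR hs
  exact monteCarlo_design hdisj h₁ h₂ hn (leaf := True) (fun _ => by norm_num) ht hr fun T =>
    runs_twoStage (params_mk 1280 2048 h₁ h₂ hn) (fits_pow h₁ h₂ hn (by omega)) rfl

theorem monteCarlo_threeStage (hdisj : Disjoint S₁ S₂) (h₁ : 1 ≤ S₁.card) (h₂ : 1 ≤ S₂.card)
    (hn : S₁.card + S₂.card ≤ n) {s Λ R V : ℕ} (hs : max S₁.card S₂.card = s)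
    (hΛ : levels 0 n s = Λ) (hR : trials 1280 S₁.card S₂.card = R) (hV : Λ * (4 * s) = V)
    {t r : ℝ} (ht : ((3 * R + 2 * V + 2 * (4000 * (s * (Λ + 1))) + 2 : ℕ) : ℝ) ≤ t)
    (hr : ((50 * Λ + 100 * R + 60 * V + 600 * (4000 * (s * (Λ + 1))) + 3000 : ℕ) : ℝ) ≤ r) :
    MonteCarlo (threeStage 1280) (n ^ wordExp 1280 0)
      (design 1280 0 n S₁.card S₂.card h₁) S₁ S₂ 3 t r (99 / 100) := by
  subst hV hΛ hR hs
  exact monteCarlo_design hdisj h₁ h₂ hn (leaf := False) (fun h => h.elim) ht hr fun T =>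
    runs_threeStage (params_mk 1280 0 h₁ h₂ hn) (fits_pow h₁ h₂ hn (by omega)) rfl

theorem levels_zero (n s : ℕ) : levels 0 n s = doublings s n := by
  have : doublings 1 0 = 0 := Nat.sInf_eq_zero.2 (.inl (by simp))
  rw [levels, zero_mul, this, add_zero]

/-- The number of candidates for the two orders of the hidden sets together. It bounds the number of
candidates for whichever order a successful trial determines. -/
noncomputable def candidates {N : ℕ} (S₁ S₂ : Finset (Fin n)) (k Λ : ℕ) (L : PoolTable n N) :
    ℕ :=
  (allCand (hit L (tagged S₁ S₂)) n Λ (2 ^ k)).length +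
    (allCand (hit L (tagged S₂ S₁)) n Λ (2 ^ k)).length

theorem lintegral_candidates_le {Λ R m s k : ℕ} (c1 : S₁.card ≤ s) (c2 : S₂.card ≤ s) (hs : 1 ≤ s)
    (hm : 0 < m) (hroots : (roots n (2 ^ k)).length ≤ 2 * s) (a b : ℕ) :
    ∫⁻ L, ((a + b * candidates S₁ S₂ k Λ L : ℕ) : ENNReal) ∂randomTable n Λ (4 * s) R m k ≤
      ENNReal.ofReal (a + b * (8 * (s * (Λ + 1)))) := by
  set N := Fintype.card (Seed n Λ (4 * s) R m) with hN
  have : Nonempty (Fin (4 * s)) := ⟨⟨0, by omega⟩⟩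
  have : Nonempty (Fin m) := ⟨⟨0, hm⟩⟩
  have hN0 : N ≠ 0 := Fintype.card_ne_zero
  have h1 : ∑ ω : Seed n Λ (4 * s) R m, (a + b * candidates S₁ S₂ k Λ (tableOf k ω)) ≤
      (a + b * (8 * (s * (Λ + 1)))) * N := by
    have o1 : IsOrder S₁ S₂ (tagged S₁ S₂) := .inl rfl
    have o2 : IsOrder S₁ S₂ (tagged S₂ S₁) := .inr rfl
    have i1 := sum_length_allCand_tableOf_le (Λ := Λ) (R := R) (m := m) (o1.card_le c1 c2) hroots
    have i2 := sum_length_allCand_tableOf_le (Λ := Λ) (R := R) (m := m) (o2.card_le c1 c2) hroots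
    have i3 := Nat.mul_le_mul_left b (add_le_add i1 i2)
    simp only [candidates]
    rw [Finset.sum_add_distrib, Finset.sum_const, Finset.card_univ, smul_eq_mul, ← Finset.mul_sum,
      Finset.sum_add_distrib, mul_comm _ a, add_mul]
    refine add_le_add le_rfl (i3.trans (le_of_eq ?_))
    ring
  rw [lintegral_randomTable, mul_comm, ← div_eq_mul_inv]
  refine ENNReal.div_le_of_le_mul ?_
  have e : ENNReal.ofReal (a + b * (8 * (s * (Λ + 1)))) =
      ((a + b * (8 * (s * (Λ + 1))) : ℕ) : ENNReal) := by
    rw [← ENNReal.ofReal_natCast]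
    push_cast
    rfl
  rw [e]
  exact_mod_cast h1

/-- Each round fails with probability at most `δ ≤ 1 / 2`, so that there are at most two on average.
The costs of the final stages are charged to every round, which keeps the cost of a round a function
of its table alone. -/
theorem lasVegas_untilSuccess (hdisj : Disjoint S₁ S₂) (h₁ : 1 ≤ S₁.card) (h₂ : 1 ≤ S₂.card)
    (hn : S₁.card + S₂.card ≤ n) {s k R V : ℕ} (hs : max S₁.card S₂.card = s)
    (hk : levels 0 n s = k) (hR : trials ρ S₁.card S₂.card = R) (hV : k * (4 * s) = V)
    {q t r δ : ℝ} (hδ : Real.exp (-((ρ : ℝ) / 128)) = δ) (hδ' : δ ≤ 1 / 2)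
    (hq : 2 + 1 / (1 - δ) ≤ q)
    (ht : 2 * (3 * R + 2 * V + 8 * (s * (k + 1)) : ℝ) ≤ t)
    (hr : 2 * (50 * k + 100 * R + 430 + 60 * V + 300 * (8 * (s * (k + 1))) : ℝ) ≤ r) :
    LasVegas (untilSuccess ρ) (n ^ wordExp ρ 0) (design ρ 0 n S₁.card S₂.card h₁) S₁ S₂ q t r := by
  subst hV hk hR hs
  have hP := params_mk (n := n) ρ 0 h₁ h₂ hn
  have hF := fits_pow (ρ := ρ) (γ := 0) h₁ h₂ hn (bud := 16 * n) (by omega)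
  have hs1 := hP.one_le
  have hroots := hP.roots_le
  have hk := levels_zero n (max S₁.card S₂.card)
  set s := max S₁.card S₂.card with hs
  set k := doublings s n with hkdef
  set Λ := levels 0 n s with hΛ
  set R := trials ρ S₁.card S₂.card with hR
  have c1 : S₁.card ≤ s := le_max_left _ _
  have c2 : S₂.card ≤ s := le_max_right _ _
  have : IsProbabilityMeasure (randomTable n Λ (4 * s) R (8 * s) k) :=
    isProbabilityMeasure_randomTable_of_le hs1
  have hδ0 : 0 ≤ δ := hδ ▸ (Real.exp_pos _).le
  have hδ1 : 1 / (1 - δ) ≤ 2 := by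
    rw [div_le_iff₀ (by linarith)]; linarith
  have hscale : ∀ {x : ℝ}, 0 ≤ x → x / (1 - δ) ≤ 2 * x := fun {x} hx => by
    rw [div_eq_mul_one_div, mul_comm]
    exact mul_le_mul_of_nonneg_right hδ1 hx
  have hlt : ∀ pos, (allCand pos n Λ (2 ^ k)).length < 16 * n := fun pos => by
    have i1 := length_allCand_lt (pos := pos) hs1 hroots
    have i2 := two_pow_doublings_mul_le (i := k) hP.le_n le_rfl
    rw [hk]
    have i3 : 2 ^ k * (4 * s) = 4 * (2 ^ k * s) := by ring
    omega
  have key := lasVegas_of_runs (S₁ := S₁) (S₂ := S₂) (ν := randomTable n Λ (4 * s) R (8 * s) k)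
    (F := {L | ∀ r < R, ¬ GoodTrial S₁ S₂ L (Λ * (4 * s)) r})
    (p := fun L => Splits L k Λ (Λ * (4 * s))) hδ0 (by linarith)
    (randomTable_le_ofReal hδ0 (by
      have h := card_noTrial_le (ρ := ρ) (k := k) (Λ := Λ) (M := 4 * s) hdisj h₁ h₂ rfl hR.symm
      rw [hδ] at h
      convert h
      exact Iff.rfl))
    (ae_randomTable fun ω => splits_tableOf k ω) (P := untilSuccess ρ) (W := n ^ wordExp ρ 0)
    (g := fun L => (3 * R + 2 * (Λ * (4 * s))) + 1 * candidates S₁ S₂ k Λ L)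
    (g' := fun L => (50 * Λ + 100 * R + 430 + 60 * (Λ * (4 * s))) + 300 * candidates S₁ S₂ k Λ L)
    (by positivity) (by positivity)
    (lintegral_candidates_le c1 c2 hs1 (by omega) hroots _ _)
    (lintegral_candidates_le c1 c2 hs1 (by omega) hroots _ _)
    (fun T j hj hj' hT => by
      simp only [Set.mem_ofPred_eq, not_forall, not_not] at hj'
      obtain ⟨r, hr, hg⟩ := hj'
      refine (runs_untilSuccess hP hF rfl hj ⟨r, hr, hg⟩ hT fun D _ => hlt _).mono ?_
      rintro τ ⟨D, hD, m, hm, a1, a2, a3, a4⟩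
      have hm' : m ≤ candidates S₁ S₂ k Λ (T j) := by
        unfold candidates
        rcases hD with rfl | rfl <;> omega
      refine ⟨a1, ?_, ?_, a4⟩
      · rw [Finset.sum_range_succ, a2]
        have : ∑ i ∈ Finset.range j, 3 * R ≤ ∑ i ∈ Finset.range j,
            ((3 * R + 2 * (Λ * (4 * s))) + 1 * candidates S₁ S₂ k Λ (T i)) :=
          Finset.sum_le_sum fun i _ => by omega
        rw [Finset.sum_const, Finset.card_range, smul_eq_mul] at this
        have e : 3 * R * (j + 1) = j * (3 * R) + 3 * R := by ring
        omega
      · rw [Finset.sum_range_succ]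
        have : ∑ i ∈ Finset.range j, (100 * R + 30) ≤ ∑ i ∈ Finset.range j,
            ((50 * Λ + 100 * R + 430 + 60 * (Λ * (4 * s))) + 300 * candidates S₁ S₂ k Λ (T i)) :=
          Finset.sum_le_sum fun i _ => by omega
        rw [Finset.sum_const, Finset.card_range, smul_eq_mul] at this
        have e : (100 * R + 30) * (j + 1) = j * (100 * R + 30) + (100 * R + 30) := by ring
        omega)
  refine key.mono hq ((hscale (by positivity)).trans (le_trans (le_of_eq ?_) ht))
    ((hscale (by positivity)).trans (le_trans (le_of_eq ?_) hr))
  · push_cast; ring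
  · push_cast; ring

end Algorithms

/-! ### Bounds on tests and time -/

section Bounds

variable {n s₁ s₂ s Λ R V : ℕ}

/-- The parameters of the one-stage and the two-stage algorithm in terms of `s * log n`. The factor
`2048 = 2 ^ 11` in the number of levels is the least power of two that is at least `2000`. -/
theorem bounds_log (h₁ : 1 ≤ s₁) (h₂ : 1 ≤ s₂) (hn : s₁ + s₂ ≤ n) (hs : max s₁ s₂ = s)
    (hΛ : levels 2048 n s = Λ) (hR : trials 1280 s₁ s₂ = R) (hV : Λ * (4 * s) = V) :
    1 ≤ 2 * (s * Real.log n) ∧ (Λ : ℝ) ≤ 32 * (s * Real.log n) ∧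
      (R : ℝ) ≤ 5120 * (s * Real.log n) ∧ (V : ℝ) ≤ 128 * (s * Real.log n) ∧
      (s * (Λ + 1) : ℝ) ≤ 32 * (s * Real.log n) := by
  have hs1 : 1 ≤ s := hs ▸ le_max_of_le_left h₁
  have hsn : s ≤ n := by omega
  have hn2 : 2 ≤ n := by omega
  have hs1' : (1 : ℝ) ≤ s := by exact_mod_cast hs1
  have hn2' : (2 : ℝ) ≤ n := by exact_mod_cast hn2
  have hℓ : (1 : ℝ) / 2 ≤ Real.log n := by
    have h1 := Real.log_two_gt_d9
    have h2 := Real.log_le_log (by norm_num) hn2'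
    linarith
  set ℓ := Real.log n with hℓdef
  have hsℓ : s * (1 / 2 : ℝ) ≤ s * ℓ := mul_le_mul_of_nonneg_left hℓ (by linarith)
  have hℓs : ℓ ≤ s * ℓ := le_mul_of_one_le_left (by linarith) hs1'
  have hlev : (Λ : ℝ) + 1 ≤ 32 * ℓ := by
    have a1 := doublings_le_log (c := 0) hs1 hsn
    have a2 := doublings_le_log (c := 11) (le_refl 1) (show 1 ≤ n by omega)
    have a3 : Real.log (n / s) ≤ ℓ := by
      refine Real.log_le_log (by positivity) ?_
      exact div_le_self (by positivity) hs1'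
    norm_num at a1 a2
    rw [← hΛ, levels]
    push_cast
    linarith
  have hR' : (R : ℝ) ≤ 2560 * s := by
    have a1 := trials_le_div (ρ := 1280) h₁ h₂
    have a2 : (1 : ℝ) ≤ (min s₁ s₂ : ℕ) := by exact_mod_cast le_min h₁ h₂
    have a3 : ((max s₁ s₂ : ℕ) : ℝ) / (min s₁ s₂ : ℕ) ≤ (max s₁ s₂ : ℕ) :=
      div_le_self (by positivity) a2
    rw [hR, hs] at a1
    rw [hs] at a3
    push_cast at a1 a3
    linarith
  have hsΛ : (s * (Λ + 1) : ℝ) ≤ s * (32 * ℓ) := mul_le_mul_of_nonneg_left hlev (by linarith)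
  have hV' : (V : ℝ) = 4 * (s * Λ) := by rw [← hV]; push_cast; ring
  refine ⟨by linarith, by linarith, by linarith, ?_, by linarith⟩
  rw [hV']
  linarith

/-- The parameters of the three-stage algorithms in terms of `s * log (n / s)`. -/
theorem bounds_log_div {ρ : ℕ} {c : ℝ} (h₁ : 1 ≤ s₁) (h₂ : 1 ≤ s₂) (hn : s₁ + s₂ ≤ n) (hc0 : 0 < c)
    (hc : c < 1) (hsc : (s : ℝ) ≤ c * n) (hs : max s₁ s₂ = s) (hΛ : levels 0 n s = Λ)
    (hR : trials ρ s₁ s₂ = R) (hV : Λ * (4 * s) = V) :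
    ∃ Z, Z = (2 / Real.log (1 / c) + 2) * (s * Real.log (n / s)) ∧ 1 ≤ Z ∧ Λ ≤ Z ∧
      R ≤ 2 * ρ * Z ∧ V ≤ 4 * Z ∧ (s * (Λ + 1) : ℝ) ≤ Z ∧
      1 ≤ (2 / Real.log (1 / c) + 2) * Real.log (n / s) := by
  have hs1 : 1 ≤ s := hs ▸ le_max_of_le_left h₁
  have hsn : s ≤ n := by omega
  have hs1' : (1 : ℝ) ≤ s := by exact_mod_cast hs1
  have hlam : 0 < Real.log (1 / c) := Real.log_pos (by rw [lt_div_iff₀ hc0]; linarith)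
  set lam := Real.log (1 / c) with hlamdef
  set a := 2 / lam + 2 with ha
  have hlg : lam ≤ Real.log (n / s) := by
    refine Real.log_le_log (by positivity) ?_
    rw [div_le_div_iff₀ hc0 (by linarith)]
    linarith
  set lg := Real.log (n / s) with hlgdef
  have h2 : 2 ≤ 2 / lam * lg := by
    rw [div_mul_eq_mul_div, le_div_iff₀ hlam]
    linarith
  have halg : 2 + 2 * lg ≤ a * lg := by rw [ha, add_mul]; linarith
  have hk : (Λ : ℝ) + 1 ≤ a * lg := by
    have a1 := doublings_le_log (c := 0) hs1 hsn
    norm_num at a1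
    rw [← hΛ, levels_zero]
    linarith
  have h1 : 1 ≤ a * lg := by linarith
  have hZ : a * (s * lg) = s * (a * lg) := by ring
  have hsZ : (s : ℝ) ≤ s * (a * lg) := le_mul_of_one_le_right (by linarith) h1
  have hsΛ : (s * (Λ + 1) : ℝ) ≤ s * (a * lg) := mul_le_mul_of_nonneg_left hk (by linarith)
  have hR' : (R : ℝ) ≤ 2 * ρ * s := by
    have a1 := trials_le_div (ρ := ρ) h₁ h₂
    have a2 : (1 : ℝ) ≤ (min s₁ s₂ : ℕ) := by exact_mod_cast le_min h₁ h₂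
    have a3 : ((max s₁ s₂ : ℕ) : ℝ) / (min s₁ s₂ : ℕ) ≤ (max s₁ s₂ : ℕ) :=
      div_le_self (by positivity) a2
    rw [hR, hs] at a1
    rw [hs] at a3
    exact a1.trans (mul_le_mul_of_nonneg_left a3 (by positivity))
  have hV' : (V : ℝ) = 4 * (s * Λ) := by rw [← hV]; push_cast; ring
  refine ⟨_, rfl, by linarith, ?_, ?_, by linarith, by linarith, h1⟩
  · have : (Λ : ℝ) + 1 ≤ s * (Λ + 1) := le_mul_of_one_le_left (by positivity) hs1'
    linarith
  · rw [hZ]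
    exact hR'.trans (mul_le_mul_of_nonneg_left hsZ (by positivity))

theorem bounds_oneStage (h₁ : 1 ≤ s₁) (h₂ : 1 ≤ s₂) (hn : s₁ + s₂ ≤ n) (hs : max s₁ s₂ = s)
    (hΛ : levels 2048 n s = Λ) (hR : trials 1280 s₁ s₂ = R) (hV : Λ * (4 * s) = V) {X : ℝ}
    (hX : (max s₁ s₂ : ℝ) ^ 2 / (min s₁ s₂ : ℝ) * Real.log n = X) :
    ((V + 2 * R : ℕ) : ℝ) ≤ 10 ^ 8 * X ∧ ((3 * R + 2 * R * V : ℕ) : ℝ) ≤ 10 ^ 8 * X ∧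
      ((50 * Λ + 200 * R + 60 * (R * V) + 600 * (4000 * (s * (Λ + 1))) + 3000 : ℕ) : ℝ) ≤
        10 ^ 8 * X := by
  obtain ⟨b1, b2, b3, b4, b5⟩ := bounds_log h₁ h₂ hn hs hΛ hR hV
  have a2 : (1 : ℝ) ≤ (min s₁ s₂ : ℕ) := by exact_mod_cast le_min h₁ h₂
  have hm0 : (0 : ℝ) < (min s₁ s₂ : ℕ) := by linarith
  have hms : ((min s₁ s₂ : ℕ) : ℝ) ≤ s := by rw [← hs]; exact_mod_cast min_le_max
  have hX' : X = (s / (min s₁ s₂ : ℕ)) * (s * Real.log n) := by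
    rw [← hX, ← hs]
    push_cast
    ring
  have hY : s * Real.log n ≤ X := by
    rw [hX']
    refine le_mul_of_one_le_left (by linarith) ?_
    rw [le_div_iff₀ hm0]
    linarith
  have hRV : (R * V : ℝ) ≤ 327680 * X := by
    have a1 := trials_le_div (ρ := 1280) h₁ h₂
    rw [hR, hs] at a1
    rw [hX']
    calc (R * V : ℝ) ≤ 2 * (1280 : ℕ) * (s / (min s₁ s₂ : ℕ)) * (128 * (s * Real.log n)) :=
          mul_le_mul a1 b4 (by positivity) (by positivity)
      _ = _ := by push_cast; ring
  refine ⟨?_, ?_, ?_⟩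
  · push_cast; linarith
  · push_cast; rw [mul_assoc]; linarith
  · push_cast; linarith

theorem bounds_twoStage (h₁ : 1 ≤ s₁) (h₂ : 1 ≤ s₂) (hn : s₁ + s₂ ≤ n) (hs : max s₁ s₂ = s)
    (hΛ : levels 2048 n s = Λ) (hR : trials 1280 s₁ s₂ = R) (hV : Λ * (4 * s) = V) {Y : ℝ}
    (hY : (max s₁ s₂ : ℝ) * Real.log n = Y) :
    ((V + 2 * R : ℕ) : ℝ) ≤ 10 ^ 8 * Y ∧ ((3 * R + 2 * V : ℕ) : ℝ) ≤ 10 ^ 8 * Y ∧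
      ((50 * Λ + 100 * R + 60 * V + 500 * (4000 * (s * (Λ + 1))) + 3000 : ℕ) : ℝ) ≤
        10 ^ 8 * Y := by
  obtain ⟨b1, b2, b3, b4, b5⟩ := bounds_log h₁ h₂ hn hs hΛ hR hV
  have hY' : s * Real.log n = Y := by
    rw [← hY, ← hs]
    push_cast
    ring
  rw [hY'] at b1 b2 b3 b4 b5
  refine ⟨?_, ?_, ?_⟩
  · push_cast; linarith
  · push_cast; linarith
  · push_cast; linarith

/-- The constant in the bounds for the three-stage and the Las Vegas algorithm. Since `s ≤ c n`, the
number `(2 / log (1 / c) + 2) * log (n / s)` is at least one. One such factor absorbs additive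
constants, and a second one turns `log (n / s)` into its square in the bounds on the time. -/
noncomputable def boundConst (ρ : ℕ) (c : ℝ) : ℝ :=
  10 ^ 7 * (ρ + 1) * (2 / Real.log (1 / c) + 2) ^ 2

theorem bounds_threeStage {ρ : ℕ} {c : ℝ} (h₁ : 1 ≤ s₁) (h₂ : 1 ≤ s₂) (hn : s₁ + s₂ ≤ n)
    (hc0 : 0 < c) (hc : c < 1) (hsc : (max s₁ s₂ : ℝ) ≤ c * n) (hs : max s₁ s₂ = s)
    (hΛ : levels 0 n s = Λ) (hR : trials ρ s₁ s₂ = R) (hV : Λ * (4 * s) = V) {t r : ℝ}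
    (ht : boundConst ρ c * ((max s₁ s₂ : ℝ) * Real.log (n / (max s₁ s₂ : ℝ))) = t)
    (hr : boundConst ρ c * ((max s₁ s₂ : ℝ) * Real.log (n / (max s₁ s₂ : ℝ)) ^ 2) = r) :
    ((V + 2 * R : ℕ) : ℝ) ≤ t ∧
      ((3 * R + 2 * V + 2 * (4000 * (s * (Λ + 1))) + 2 : ℕ) : ℝ) ≤ t ∧
      ((50 * Λ + 100 * R + 60 * V + 600 * (4000 * (s * (Λ + 1))) + 3000 : ℕ) : ℝ) ≤ r ∧
      2 * (3 * R + 2 * V + 8 * (s * (Λ + 1)) : ℝ) ≤ t ∧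
      2 * (50 * Λ + 100 * R + 430 + 60 * V + 300 * (8 * (s * (Λ + 1))) : ℝ) ≤ r := by
  have e : (max s₁ s₂ : ℝ) = s := by rw [← hs]; push_cast; rfl
  rw [e] at hsc ht hr
  obtain ⟨Z, hZ, b1, b2, b3, b4, b5, b6⟩ := bounds_log_div h₁ h₂ hn hc0 hc hsc hs hΛ hR hV
  have hlam : 0 < Real.log (1 / c) := Real.log_pos (by rw [lt_div_iff₀ hc0]; linarith)
  set a := 2 / Real.log (1 / c) + 2 with ha
  have ha1 : 1 ≤ a := by
    have : 0 < 2 / Real.log (1 / c) := by positivity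
    linarith
  have hρ : (0 : ℝ) ≤ ρ := Nat.cast_nonneg _
  have hρZ : 0 ≤ ρ * Z := by positivity
  have ht' : 10 ^ 7 * ((ρ + 1) * Z) ≤ t := by
    have h1 : 0 ≤ 10 ^ 7 * ((ρ + 1) * Z) := by positivity
    calc 10 ^ 7 * ((ρ + 1) * Z) ≤ a * (10 ^ 7 * ((ρ + 1) * Z)) := le_mul_of_one_le_left h1 ha1
      _ = t := by rw [← ht, boundConst, hZ]; ring
  have hr' : 10 ^ 7 * ((ρ + 1) * Z) ≤ r := by
    have h1 : 0 ≤ 10 ^ 7 * ((ρ + 1) * Z) := by positivity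
    calc 10 ^ 7 * ((ρ + 1) * Z) ≤ (a * Real.log (n / s)) * (10 ^ 7 * ((ρ + 1) * Z)) :=
          le_mul_of_one_le_left h1 b6
      _ = r := by rw [← hr, boundConst, hZ]; ring
  have e1 : (ρ + 1) * Z = ρ * Z + Z := by ring
  rw [e1] at ht' hr'
  rw [mul_assoc] at b3
  refine ⟨?_, ?_, ?_, ?_, ?_⟩
  · push_cast; linarith
  · push_cast; linarith
  · push_cast; linarith
  · linarith
  · linarith

/-- A factor `ρ` in the number of trials for which the Las Vegas algorithm has at most `3 + η`
stages on average. -/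
theorem exists_exp_le {η : ℝ} (hη : 0 < η) : ∃ (ρ : ℕ) (δ : ℝ), Real.exp (-((ρ : ℝ) / 128)) = δ ∧
    δ ≤ 1 / 2 ∧ 2 + 1 / (1 - δ) ≤ 3 + η := by
  refine ⟨128 * (⌈2 / η⌉₊ + 1), _, rfl, ?_⟩
  have h1 := Nat.le_ceil (2 / η)
  have h2 : ((128 * (⌈2 / η⌉₊ + 1) : ℕ) : ℝ) / 128 = ⌈2 / η⌉₊ + 1 := by push_cast; ring
  have h3 := Real.add_one_le_exp ((⌈2 / η⌉₊ : ℝ) + 1)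
  have h4 : 0 < 2 / η := by positivity
  have h5 : Real.exp (-((⌈2 / η⌉₊ : ℝ) + 1)) ≤ (2 + 2 / η)⁻¹ := by
    rw [Real.exp_neg]
    exact inv_anti₀ (by linarith) (by linarith)
  have h6 : (2 + 2 / η)⁻¹ = η / (2 * η + 2) := by field_simp
  have h7 : η / (2 * η + 2) ≤ 1 / 2 := by
    rw [div_le_div_iff₀ (by linarith) (by norm_num)]; linarith
  rw [h2]
  rw [h6] at h5
  refine ⟨h5.trans h7, ?_⟩
  have h8 : (η + 2) / (2 * η + 2) ≤ 1 - Real.exp (-((⌈2 / η⌉₊ : ℝ) + 1)) := by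
    have : (η + 2) / (2 * η + 2) = 1 - η / (2 * η + 2) := by field_simp; ring
    linarith
  have h9 : 1 / (1 - Real.exp (-((⌈2 / η⌉₊ : ℝ) + 1))) ≤ 1 / ((η + 2) / (2 * η + 2)) :=
    one_div_le_one_div_of_le (by positivity) h8
  have h10 : 1 / ((η + 2) / (2 * η + 2)) ≤ 1 + η := by
    rw [one_div_div, div_le_iff₀ (by linarith)]
    nlinarith
  linarith

end Bounds

end ConcGT

theorem theorem4 :
    -- (i) non-adaptive Monte Carlo design
    (∃ (P : Program) (K : ℕ) (C : ℝ), ∀ n s₁ s₂ : ℕ, 1 ≤ s₁ → 1 ≤ s₂ → s₁ + s₂ ≤ n →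
      ∃ (N : ℕ) (μ : ProbabilityMeasure (ℕ → PoolTable n N)),
        (N : ℝ) ≤ C * ((max s₁ s₂ : ℝ) ^ 2 / (min s₁ s₂ : ℝ) * Real.log n) ∧
        ∀ S₁ S₂ : Finset (Fin n), Disjoint S₁ S₂ → S₁.card = s₁ → S₂.card = s₂ →
          MonteCarlo P (n ^ K) μ S₁ S₂ 1
            (C * ((max s₁ s₂ : ℝ) ^ 2 / (min s₁ s₂ : ℝ) * Real.log n))
            (C * ((max s₁ s₂ : ℝ) ^ 2 / (min s₁ s₂ : ℝ) * Real.log n)) (99 / 100)) ∧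
    -- (ii) two-stage Monte Carlo design
    (∃ (P : Program) (K : ℕ) (C : ℝ), ∀ n s₁ s₂ : ℕ, 1 ≤ s₁ → 1 ≤ s₂ → s₁ + s₂ ≤ n →
      ∃ (N : ℕ) (μ : ProbabilityMeasure (ℕ → PoolTable n N)),
        (N : ℝ) ≤ C * ((max s₁ s₂ : ℝ) * Real.log n) ∧
        ∀ S₁ S₂ : Finset (Fin n), Disjoint S₁ S₂ → S₁.card = s₁ → S₂.card = s₂ →
          MonteCarlo P (n ^ K) μ S₁ S₂ 2
            (C * ((max s₁ s₂ : ℝ) * Real.log n))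
            (C * ((max s₁ s₂ : ℝ) * Real.log n)) (99 / 100)) ∧
    -- (iii) three-stage Monte Carlo design
    (∃ (P : Program) (K : ℕ), ∀ c : ℝ, 0 < c → c < 1 → ∃ C : ℝ,
      ∀ n s₁ s₂ : ℕ, 1 ≤ s₁ → 1 ≤ s₂ → s₁ + s₂ ≤ n → (max s₁ s₂ : ℝ) ≤ c * n →
      ∃ (N : ℕ) (μ : ProbabilityMeasure (ℕ → PoolTable n N)),
        (N : ℝ) ≤ C * ((max s₁ s₂ : ℝ) * Real.log (n / (max s₁ s₂ : ℝ))) ∧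
        ∀ S₁ S₂ : Finset (Fin n), Disjoint S₁ S₂ → S₁.card = s₁ → S₂.card = s₂ →
          MonteCarlo P (n ^ K) μ S₁ S₂ 3
            (C * ((max s₁ s₂ : ℝ) * Real.log (n / (max s₁ s₂ : ℝ))))
            (C * ((max s₁ s₂ : ℝ) * Real.log (n / (max s₁ s₂ : ℝ)) ^ 2)) (99 / 100)) ∧
    -- (iv) Las Vegas design
    (∀ η : ℝ, 0 < η → ∃ (P : Program) (K : ℕ), ∀ c : ℝ, 0 < c → c < 1 → ∃ C : ℝ,
      ∀ n s₁ s₂ : ℕ, 1 ≤ s₁ → 1 ≤ s₂ → s₁ + s₂ ≤ n → (max s₁ s₂ : ℝ) ≤ c * n →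
      ∃ (N : ℕ) (μ : ProbabilityMeasure (ℕ → PoolTable n N)),
        (N : ℝ) ≤ C * ((max s₁ s₂ : ℝ) * Real.log (n / (max s₁ s₂ : ℝ))) ∧
        ∀ S₁ S₂ : Finset (Fin n), Disjoint S₁ S₂ → S₁.card = s₁ → S₂.card = s₂ →
          LasVegas P (n ^ K) μ S₁ S₂ (3 + η)
            (C * ((max s₁ s₂ : ℝ) * Real.log (n / (max s₁ s₂ : ℝ))))
            (C * ((max s₁ s₂ : ℝ) * Real.log (n / (max s₁ s₂ : ℝ)) ^ 2))) := by
  refine ⟨⟨oneStage 1280 2048, wordExp 1280 2048, 10 ^ 8, fun n s₁ s₂ h₁ h₂ hn =>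
      ⟨_, design 1280 2048 n s₁ s₂ h₁, (bounds_oneStage h₁ h₂ hn rfl rfl rfl rfl rfl).1, ?_⟩⟩,
    ⟨twoStage 1280 2048, wordExp 1280 2048, 10 ^ 8, fun n s₁ s₂ h₁ h₂ hn =>
      ⟨_, design 1280 2048 n s₁ s₂ h₁, (bounds_twoStage h₁ h₂ hn rfl rfl rfl rfl rfl).1, ?_⟩⟩,
    ⟨threeStage 1280, wordExp 1280 0, fun c hc0 hc => ⟨boundConst 1280 c,
      fun n s₁ s₂ h₁ h₂ hn hsc => ⟨_, design 1280 0 n s₁ s₂ h₁,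
        (bounds_threeStage h₁ h₂ hn hc0 hc hsc rfl rfl rfl rfl rfl rfl).1, ?_⟩⟩⟩,
    fun η hη => ?_⟩
  · rintro S₁ S₂ hd rfl rfl
    obtain ⟨-, b1, b2⟩ := bounds_oneStage h₁ h₂ hn rfl rfl rfl rfl rfl
    exact monteCarlo_oneStage hd h₁ h₂ hn rfl rfl rfl rfl b1 b2
  · rintro S₁ S₂ hd rfl rfl
    obtain ⟨-, b1, b2⟩ := bounds_twoStage h₁ h₂ hn rfl rfl rfl rfl rfl
    exact monteCarlo_twoStage hd h₁ h₂ hn rfl rfl rfl rfl b1 b2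
  · rintro S₁ S₂ hd rfl rfl
    obtain ⟨-, b1, b2, -, -⟩ := bounds_threeStage h₁ h₂ hn hc0 hc hsc rfl rfl rfl rfl rfl rfl
    exact monteCarlo_threeStage hd h₁ h₂ hn rfl rfl rfl rfl b1 b2
  · obtain ⟨ρ, δ, hδ, hδ', hq⟩ := exists_exp_le hη
    refine ⟨untilSuccess ρ, wordExp ρ 0, fun c hc0 hc => ⟨boundConst ρ c,
      fun n s₁ s₂ h₁ h₂ hn hsc => ⟨_, design ρ 0 n s₁ s₂ h₁,
        (bounds_threeStage h₁ h₂ hn hc0 hc hsc rfl rfl rfl rfl rfl rfl).1, ?_⟩⟩⟩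
    rintro S₁ S₂ hd rfl rfl
    obtain ⟨-, -, -, b1, b2⟩ := bounds_threeStage h₁ h₂ hn hc0 hc hsc rfl rfl rfl rfl rfl rfl
    exact lasVegas_untilSuccess hd h₁ h₂ hn rfl rfl rfl rfl hδ hδ' hq b1 b2
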